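/- **Theorem 5 (Exponential decay on the circle).** Let $\mathbb{S}^1=\mathbb{R}/2\pi\mathbb{Z}$. For $\theta\in\mathbb{S}^1$ and $\beta\in\mathbb{R}$, let $X^\beta_\theta$ be the set of measurable functions $f:\mathbb{S}^1\to\mathbb{R}$ for which there are $C_0,\sigma>0$ with $C_0^{-1}V^\beta\le f\le C_0V^\beta$ almost everywhere, where, in the coordinate $x\in[-\pi,\pi)$ on $\mathbb{S}^1$ centred at $\theta$, $V^\beta(x)=0$ if $|x|\le\sigma$ and $V^\beta(x)=(|x|-\sigma)^\beta$ if $|x|>\sigma$. Let $W=\sum_{j=1}^n W_j$, where for each $j$ the real-valued function $W_j$ either is in $L^\infty(\mathbb{S}^1)$ or belongs to $X^{\beta_j}_{\theta_j}$ for some $\beta_j\in(-1,0)$ and $\theta_j\in\mathbb{S}^1$. Assume that $W\ge 0$ almost everywhere and that $W$ is not almost everywhere zero. On the complex Hilbert space $\mathcal{H}=H^1(\mathbb{S}^1)\times L^2(\mathbb{S}^1)$ consider the operator $\mathcal{A}(u,v)=(v,\ \Delta u-Wv)$ with domain $\mathcal{D}=\{(u,v)\in H^1\times H^1:\ -\Delta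 u+Wv\in L^2\}$. Then $\mathcal{A}$ generates a unique strongly continuous semigroup $e^{t\mathcal{A}}$ on $\mathcal{H}$, and there exist $C,c>0$ such that for all $(u_0,u_1)\in H^1\times L^2$ and all $t\ge 0$, $$E(u,t)\le Ce^{-ct}E(u,0),\qquad E(u,t)=\frac12\int_{\mathbb{S}^1}|\partial_xu(t,x)|^2+|\partial_tu(t,x)|^2\,dx,$$ where $(u(t),\partial_tu(t))=e^{t\mathcal{A}}(u_0,u_1)$ is the solution of the damped wave equation $(\partial_t^2-\Delta+W\partial_t)u=0$ with $(u,\partial_tu)|_{t=0}=(u_0,u_1)$. -/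

import Mathlib

open MeasureTheory Filter Topology Set Real
open scoped NNReal ENNReal ContDiff

noncomputable section

namespace DampedWave

/-- The period of the circle `ℝ / 2πℤ` is positive. -/
instance fact_two_pi_pos : Fact (0 < 2 * π) := ⟨Real.two_pi_pos⟩

/-- The circle `𝕊¹ = ℝ / 2πℤ`. Its `volume` is arc length (total mass `2π`), and `‖z‖` is the
distance from `z` to `0`, that is `|x|` for the representative `x ∈ [-π, π)` of `z`. -/
abbrev S1 : Type := AddCircle (2 * π)

/-- The complex space `L²(𝕊¹)`. -/
abbrev L2 : Type := Lp ℂ 2 (volume : Measure S1)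

/-! ### Polynomially controlled damping -/

/-- The model profile `V^β`, in the coordinate centred at `θ`: with `|x| = ‖z - θ‖`, it is `0` where
`|x| ≤ σ`, and `(|x| - σ)^β` where `|x| > σ`. -/
def profile (β : ℝ) (θ : S1) (σ : ℝ) (z : S1) : ℝ :=
  if ‖z - θ‖ ≤ σ then 0 else (‖z - θ‖ - σ) ^ β

/-- The class `X^β_θ` of polynomially controlled functions on the circle. (The bounds are required
almost everywhere, as the functions matter only up to null sets.) -/
def IsPolyControlled (β : ℝ) (θ : S1) (f : S1 → ℝ) : Prop :=
  Measurable f ∧ ∃ C₀ σ : ℝ, 0 < C₀ ∧ 0 < σ ∧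
    ∀ᵐ z : S1, C₀⁻¹ * profile β θ σ z ≤ f z ∧ f z ≤ C₀ * profile β θ σ z

/-! ### Test functions, weak derivatives and the Sobolev space `H¹` -/

/-- Smooth complex functions on the circle. -/
def IsTest (φ : S1 → ℂ) : Prop := ContDiff ℝ ∞ (fun x : ℝ => φ (x : S1))

/-- The derivative of a function on the circle with respect to arc length. -/
def circleDeriv (φ : S1 → ℂ) (z : S1) : ℂ := deriv (fun s : ℝ => φ (z + (s : S1))) 0

theorem circleDeriv_coe (φ : S1 → ℂ) (x : ℝ) :
    circleDeriv φ (x : S1) = deriv (fun y : ℝ => φ (y : S1)) x := by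
  have h : (fun s : ℝ => φ ((x : S1) + (s : S1)))
      = fun s : ℝ => (fun y : ℝ => φ (y : S1)) (x + s) := by
    funext s
    simp
  unfold circleDeriv
  rw [h, deriv_comp_const_add (f := fun y : ℝ => φ (y : S1)), add_zero]

theorem IsTest.continuous {φ : S1 → ℂ} (h : IsTest φ) : Continuous φ :=
  (QuotientAddGroup.isQuotientMap_mk _).continuous_iff.2 (ContDiff.continuous h)

theorem IsTest.continuous_circleDeriv {φ : S1 → ℂ} (h : IsTest φ) :
    Continuous (circleDeriv φ) := by
  refine (QuotientAddGroup.isQuotientMap_mk _).continuous_iff.2 ?_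
  have h1 : Continuous (deriv (fun y : ℝ => φ (y : S1))) :=
    ContDiff.continuous_deriv h (by exact_mod_cast le_top)
  exact h1.congr fun x => (circleDeriv_coe φ x).symm

theorem integrable_mul_continuous (u : L2) {ψ : S1 → ℂ} (hψ : Continuous ψ) :
    Integrable (fun z => u z * ψ z) := by
  obtain ⟨K, hK⟩ := (isCompact_range hψ.norm).bddAbove
  have hu : Integrable (fun z => u z) := (Lp.memLp u).integrable (by norm_num)
  exact hu.mul_bdd (c := K) hψ.aestronglyMeasurable
    (Eventually.of_forall fun z => hK ⟨z, rfl⟩)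

/-- `g` is the weak derivative of `u`. -/
def HasWeakDeriv (u g : L2) : Prop :=
  ∀ φ : S1 → ℂ, IsTest φ → ∫ z, u z * circleDeriv φ z = - ∫ z, g z * φ z

/-- The Sobolev space `H¹(𝕊¹)`, realized as the space of pairs `(u, u')` in `L² × L²` with `u'` the
weak derivative of `u`. The inherited Hilbert norm is `(‖u‖² + ‖u'‖²)^{1/2}`. -/
def H1 : Submodule ℂ (WithLp 2 (L2 × L2)) where
  carrier := {p | HasWeakDeriv p.fst p.snd}
  zero_mem' := by
    intro φ _
    have h1 : ∀ ψ : S1 → ℂ, ∫ z, (0 : L2) z * ψ z = 0 := fun ψ => by simp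
    simp only [WithLp.zero_fst, WithLp.zero_snd, h1, neg_zero]
  add_mem' := by
    intro p q hp hq φ hφ
    have key : ∀ (a b : L2) (ψ : S1 → ℂ), Continuous ψ →
        ∫ z, (a + b : L2) z * ψ z = (∫ z, a z * ψ z) + ∫ z, b z * ψ z := by
      intro a b ψ hψ
      rw [← integral_add (integrable_mul_continuous a hψ) (integrable_mul_continuous b hψ)]
      refine integral_congr_ae ?_
      filter_upwards [Lp.coeFn_add a b] with z hz
      rw [hz, Pi.add_apply, add_mul]
    simp only [WithLp.add_fst, WithLp.add_snd]
    rw [key _ _ _ hφ.continuous_circleDeriv, key _ _ _ hφ.continuous, hp φ hφ, hq φ hφ]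
    ring
  smul_mem' := by
    intro c p hp φ hφ
    have key : ∀ (a : L2) (ψ : S1 → ℂ),
        ∫ z, (c • a : L2) z * ψ z = c * ∫ z, a z * ψ z := by
      intro a ψ
      rw [← integral_const_mul]
      refine integral_congr_ae ?_
      filter_upwards [Lp.coeFn_smul c a] with z hz
      rw [hz, Pi.smul_apply, smul_eq_mul, mul_assoc]
    simp only [WithLp.smul_fst, WithLp.smul_snd]
    rw [key, key, hp φ hφ]
    ring

/-- The function underlying an element of `H¹`, as an element of `L²`. -/
def H1.toL2 (u : H1) : L2 := (u : WithLp 2 (L2 × L2)).fst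

/-- The weak derivative `∂ₓu ∈ L²` of `u ∈ H¹`. -/
def H1.grad (u : H1) : L2 := (u : WithLp 2 (L2 × L2)).snd

/-! ### The damped wave semigroup -/

/-- The state space `ℋ = H¹ × L²` of pairs `(u, ∂ₜu)`, with its Hilbert norm. -/
abbrev State : Type := WithLp 2 (H1 × L2)

/-- The graph of the damped wave operator `𝒜 = (0, Id; Δ, -W)`: `IsDampedWaveOp W U F` says that
`U = (u, v)` belongs to `𝒟 = {(u, v) ∈ H¹ × H¹ : -Δu + Wv ∈ L²}` and that
`F = (v, Δu - Wv)`, the second component being taken in the sense of distributions. -/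
def IsDampedWaveOp (W : S1 → ℝ) (U F : State) : Prop :=
  U.snd = H1.toL2 F.fst ∧
    ∀ φ : S1 → ℂ, IsTest φ →
      ∫ z, F.snd z * φ z
        = - (∫ z, H1.grad U.fst z * circleDeriv φ z) - ∫ z, (W z : ℂ) * U.snd z * φ z

/-- `S` is a strongly continuous semigroup of bounded operators on `E` whose infinitesimal generator
has the graph `G` (so `S t = e^{t𝒜}`, where `𝒜` is the operator with graph `G`). -/
structure IsSemigroupGeneratedBy {E : Type*} [NormedAddCommGroup E] [NormedSpace ℂ E]
    (S : ℝ≥0 → E →L[ℂ] E) (G : E → E → Prop) : Prop where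
  map_zero : S 0 = ContinuousLinearMap.id ℂ E
  map_add : ∀ s t : ℝ≥0, S (s + t) = (S s).comp (S t)
  continuous_orbit : ∀ x : E, Continuous fun t : ℝ≥0 => S t x
  generator : ∀ x y : E,
    Tendsto (fun h : ℝ≥0 => (((h : ℝ) : ℂ))⁻¹ • (S h x - x)) (𝓝[>] 0) (𝓝 y) ↔ G x y

/-- The energy `½ ∫ |∂ₓu|² + |∂ₜu|² dx` of the state `U = (u, ∂ₜu)`. -/
def energy (U : State) : ℝ :=
  (1 / 2) * ∫ z, (‖H1.grad U.fst z‖ ^ 2 + ‖U.snd z‖ ^ 2)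

end DampedWave

end

/-! The singular damping enters only through three facts: $W\in L^1$ (because $\beta_j>-1$), $W\ge
0$, and $\int W>0$. In one dimension $H^1\subset L^\infty$, so $Wv\in L^1$ for $v\in H^1$ and the
form $\int W\bar v w$ is bounded on $H^1$. Multiplying by $W$ is therefore harmless once velocities
in the domain are known to be in $H^1$.

Generation. In the full norm of $H^1\times L^2$ the operator $\mathcal A$ is dissipative only up to
the term $\mathrm{Re}\langle u,v\rangle$, so $\mathcal A-1$ is treated instead. Eliminating the
velocity reduces surjectivity of $\mu-\mathcal A$ to inverting $-\Delta+\mu^2+\mu W$, which is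
coercive on $H^1$ (`isUnit_helmholtzOp`). Lumer–Phillips, proved by Yosida approximation
(`MaxDissipative.isSemigroupGeneratedBy`), gives a contraction semigroup, and multiplication by
$e^t$ removes the shift.

Stationary estimate. Suppose $(i\tau-\mathcal A)U=F$ with $U=(u,v)$, and let $D=\int W|v|^2$. The
combinations $v\pm u'$ solve $a'=\pm i\tau a+{}$error. The $L^1$ norm of the error is bounded
through $\|Wv\|_{L^1}\le(\int W)^{1/2}D^{1/2}$ and the energy of $F$. Thus $v\pm u'$ are close to
plane waves $\alpha e^{i\tau x}$ and $\beta e^{-i\tau x}$. The amplitudes are recovered from $\int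
W|\alpha e^{i\tau x}+\beta e^{-i\tau x}|^2$, which $D$ controls, together with $|\int(\alpha
e^{i\tau x}-\beta e^{-i\tau x})|^2$, which is small because $\int u'=0$. Their sum is at least
$c(|\alpha|^2+|\beta|^2)$ uniformly in $\tau$: by Riemann–Lebesgue for large $|\tau|$, by
compactness otherwise (`exists_waveForm_lower_bound`). Since $D$ is the real part of the energy
pairing of $U$ with $F$, it can be absorbed, which bounds the energy of $U$ by $K$ times that of $F$
for every real $\tau$ (`exists_resolvent_bound`).

Decay. An orbit cut off by $\sin(\pi t/T)$ has time Fourier coefficients on $[0,T]$ that solve the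
stationary equation, the source coming from the derivative of the cutoff. Parseval and the resolvent
bound give $\int\sin^2 E\le K(\pi/T)^2\int\cos^2E$. As $E$ is nonincreasing, $E(T)\le
K(\pi/T)^2E(0)$, which is $E(0)/2$ for a suitable $T$. Iteration gives the exponential rate. -/

noncomputable section

namespace DampedWave

section

/-! ### Indefinite integrals -/

/-- `f` is an indefinite integral of the integrable function `k` on `[0, L]`. -/
structure IsPrimitive (L : ℝ) (f k : ℝ → ℂ) : Prop where
  integrable : IntervalIntegrable k volume 0 L
  eq : ∀ x ∈ Icc 0 L, f x = f 0 + ∫ y in 0..x, k y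

namespace IsPrimitive

variable {L : ℝ} {f g k l : ℝ → ℂ}

theorem integrable_sub (h : IsPrimitive L f k) {x y : ℝ} (hx : x ∈ Icc 0 L) (hy : y ∈ Icc 0 L) :
    IntervalIntegrable k volume x y := by
  have hL : 0 ≤ L := hx.1.trans hx.2
  refine h.integrable.mono_set ?_
  rw [uIcc_of_le hL]
  exact uIcc_subset_Icc hx hy

theorem sub_eq (h : IsPrimitive L f k) {x y : ℝ} (hx : x ∈ Icc 0 L) (hy : y ∈ Icc 0 L) :
    f y - f x = ∫ t in x..y, k t := by
  have hL : 0 ≤ L := hx.1.trans hx.2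
  have h0 : (0 : ℝ) ∈ Icc 0 L := ⟨le_rfl, hL⟩
  rw [h.eq x hx, h.eq y hy, ← intervalIntegral.integral_interval_sub_left
    (h.integrable_sub h0 hy) (h.integrable_sub h0 hx)]
  ring

theorem of_sub_eq (hk : IntervalIntegrable k volume 0 L)
    (h : ∀ x ∈ Icc 0 L, f x - f 0 = ∫ t in 0..x, k t) : IsPrimitive L f k :=
  ⟨hk, fun x hx => by rw [← h x hx]; ring⟩

theorem continuousOn (h : IsPrimitive L f k) (hL : 0 ≤ L) : ContinuousOn f (Icc 0 L) := by
  have h1 : ContinuousOn (fun x => f 0 + ∫ y in 0..x, k y) (Icc 0 L) := by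
    refine continuousOn_const.add ?_
    have := intervalIntegral.continuousOn_primitive_interval' h.integrable
      (left_mem_uIcc : (0 : ℝ) ∈ uIcc 0 L)
    rwa [uIcc_of_le hL] at this
  exact h1.congr h.eq

theorem congr (h : IsPrimitive L f k) (hkl : ∀ᵐ x ∂volume.restrict (Ioc 0 L), k x = l x)
    (hL : 0 ≤ L) : IsPrimitive L f l := by
  have hkl' := (ae_restrict_iff' measurableSet_Ioc).1 hkl
  refine ⟨h.integrable.congr_ae (by rwa [uIoc_of_le hL]), fun x hx => ?_⟩
  rw [h.eq x hx]
  congr 1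
  refine intervalIntegral.integral_congr_ae ?_
  filter_upwards [hkl'] with y hy hy'
  rw [uIoc_of_le hx.1] at hy'
  exact hy ⟨hy'.1, hy'.2.trans hx.2⟩

theorem add (hf : IsPrimitive L f k) (hg : IsPrimitive L g l) :
    IsPrimitive L (fun x => f x + g x) (fun x => k x + l x) := by
  refine ⟨hf.integrable.add hg.integrable, fun x hx => ?_⟩
  have h0 : (0 : ℝ) ∈ Icc 0 L := ⟨le_rfl, hx.1.trans hx.2⟩
  rw [intervalIntegral.integral_add (hf.integrable_sub h0 hx) (hg.integrable_sub h0 hx),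
    hf.eq x hx, hg.eq x hx]
  ring

theorem const_mul (hf : IsPrimitive L f k) (c : ℂ) :
    IsPrimitive L (fun x => c * f x) (fun x => c * k x) := by
  refine ⟨hf.integrable.const_mul c, fun x hx => ?_⟩
  rw [intervalIntegral.integral_const_mul, hf.eq x hx]
  ring

theorem sub (hf : IsPrimitive L f k) (hg : IsPrimitive L g l) :
    IsPrimitive L (fun x => f x - g x) (fun x => k x - l x) := by
  have := hf.add (hg.const_mul (-1))
  simpa [sub_eq_add_neg] using this

theorem conj (hf : IsPrimitive L f k) :
    IsPrimitive L (fun x => starRingEnd ℂ (f x)) (fun x => starRingEnd ℂ (k x)) := by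
  refine ⟨?_, fun x hx => ?_⟩
  · rw [intervalIntegrable_iff] at *
    have h := (intervalIntegrable_iff.1 hf.integrable)
    exact (LinearIsometryEquiv.integrable_comp_iff (Complex.conjLIE)).2 h
  · rw [hf.eq x hx, map_add]
    congr 1
    rw [intervalIntegral.integral_of_le hx.1, intervalIntegral.integral_of_le hx.1, integral_conj]

theorem of_hasDerivAt (h : ∀ x, HasDerivAt f (k x) x) (hk : Continuous k) : IsPrimitive L f k :=
  of_sub_eq (hk.intervalIntegrable _ _) fun _ _ =>
    (intervalIntegral.integral_eq_sub_of_hasDerivAt (fun y _ => h y)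
      (hk.intervalIntegrable _ _)).symm

/-- Increments of `f` are dominated by increments of the primitive of `‖k‖`, so the `δ` of that
scalar function serves for `f`. -/
theorem absolutelyContinuous (h : IsPrimitive L f k) (hL : 0 ≤ L) :
    AbsolutelyContinuousOnInterval f 0 L := by
  have h1 := h.integrable.norm.absolutelyContinuousOnInterval_intervalIntegral
    (left_mem_uIcc : (0 : ℝ) ∈ uIcc 0 L)
  rw [absolutelyContinuousOnInterval_iff] at h1 ⊢
  intro ε hε
  obtain ⟨δ, hδ, H⟩ := h1 ε hε
  refine ⟨δ, hδ, fun E hE hlt => lt_of_le_of_lt (Finset.sum_le_sum fun i hi => ?_) (H E hE hlt)⟩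
  obtain ⟨ha, hb⟩ := hE.1 i hi
  rw [uIcc_of_le hL] at ha hb
  have h0 : (0 : ℝ) ∈ Icc 0 L := ⟨le_rfl, hL⟩
  rw [dist_comm, dist_eq_norm, h.sub_eq ha hb, dist_comm, Real.dist_eq,
    intervalIntegral.integral_interval_sub_left (h.integrable_sub h0 hb).norm
      (h.integrable_sub h0 ha).norm]
  exact intervalIntegral.norm_integral_le_abs_integral_norm

theorem ae_hasDerivAt (h : IsPrimitive L f k) (hL : 0 ≤ L) :
    ∀ᵐ x, x ∈ Icc 0 L → HasDerivAt f (k x) x := by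
  have h1 := h.integrable.ae_hasDerivAt_integral
  have h2 : ∀ᵐ x : ℝ, x ≠ 0 := by simp [ae_iff, measure_singleton]
  have h3 : ∀ᵐ x : ℝ, x ≠ L := by simp [ae_iff, measure_singleton]
  filter_upwards [h1, h2, h3] with x hx hx0 hxL hmem
  have h4 := hx (by rwa [uIcc_of_le hL]) 0 left_mem_uIcc
  refine (h4.const_add (f 0)).congr_of_eventuallyEq ?_
  have : Ioo 0 L ∈ 𝓝 x :=
    Ioo_mem_nhds (lt_of_le_of_ne hmem.1 hx0.symm) (lt_of_le_of_ne hmem.2 hxL)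
  filter_upwards [this] with y hy
  exact h.eq y ⟨hy.1.le, hy.2.le⟩

/-- Product rule for indefinite integrals. -/
theorem mul (hf : IsPrimitive L f k) (hg : IsPrimitive L g l) (hL : 0 ≤ L) :
    IsPrimitive L (fun x => f x * g x) (fun x => k x * g x + f x * l x) := by
  have hfc := hf.continuousOn hL
  have hgc := hg.continuousOn hL
  have hint : IntervalIntegrable (fun x => k x * g x + f x * l x) volume 0 L :=
    (hf.integrable.mul_continuousOn (by rwa [uIcc_of_le hL])).add
      (hg.integrable.continuousOn_mul (by rwa [uIcc_of_le hL]))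
  set m := fun x => k x * g x + f x * l x with hm
  have hP : IsPrimitive L (fun x => ∫ y in 0..x, m y) m :=
    of_sub_eq hint fun x _ => by simp
  -- The difference between the product and the candidate primitive is absolutely continuous with
  -- zero derivative almost everywhere, hence constant.
  have hac : AbsolutelyContinuousOnInterval (fun x => f x * g x - ∫ y in 0..x, m y) 0 L := by
    have h1 := (hf.absolutelyContinuous hL).fun_smul (hg.absolutelyContinuous hL)
    exact h1.fun_sub (hP.absolutelyContinuous hL)
  obtain ⟨C, hC⟩ := hac.const_of_ae_hasDerivAt_zero (by
    filter_upwards [hf.ae_hasDerivAt hL, hg.ae_hasDerivAt hL, hP.ae_hasDerivAt hL]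
      with x h1 h2 h3 hx
    rw [uIcc_of_le hL] at hx
    exact (((h1 hx).mul (h2 hx)).sub (h3 hx)).congr_deriv (by simp [hm]))
  rw [uIcc_of_le hL] at hC
  refine of_sub_eq hint fun x hx => ?_
  have e1 := hC x hx
  have e2 := hC 0 ⟨le_rfl, hL⟩
  simp only [intervalIntegral.integral_same, sub_zero] at e2
  rw [e2, ← e1]
  ring

theorem norm_sub_le (h : IsPrimitive L f k) {x y : ℝ} (hx : x ∈ Icc 0 L) (hy : y ∈ Icc 0 L) :
    ‖f y - f x‖ ≤ ∫ t in 0..L, ‖k t‖ := by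
  have hL : 0 ≤ L := hx.1.trans hx.2
  rw [h.sub_eq hx hy]
  refine intervalIntegral.norm_integral_le_abs_integral_norm.trans ?_
  refine (intervalIntegral.abs_integral_mono_interval (c := 0) (d := L) ?_ ?_
    h.integrable.norm).trans_eq ?_
  · rw [uIoc_of_le hL]
    exact fun z hz => ⟨lt_of_le_of_lt (le_min hx.1 hy.1) hz.1, hz.2.trans (max_le hx.2 hy.2)⟩
  · exact Eventually.of_forall fun t => norm_nonneg _
  · exact abs_of_nonneg (intervalIntegral.integral_nonneg hL fun t _ => norm_nonneg _)

/-- A solution of `a' = iτ a + k` stays close to a multiple of `exp (iτx)`. -/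
theorem norm_sub_exp_le {a : ℝ → ℂ} {τ : ℝ}
    (h : IsPrimitive L a (fun x => Complex.I * τ * a x + k x)) (hL : 0 ≤ L) {x : ℝ}
    (hx : x ∈ Icc 0 L) :
    ‖a x - a 0 * Complex.exp (Complex.I * τ * x)‖ ≤ ∫ t in 0..L, ‖k t‖ := by
  have hE : IsPrimitive L (fun x : ℝ => Complex.exp (-(Complex.I * τ * x)))
      (fun x : ℝ => -(Complex.I * τ) * Complex.exp (-(Complex.I * τ * x))) := by
    refine of_hasDerivAt (fun x => ?_) (by fun_prop)
    have h1 : HasDerivAt (fun x : ℝ => -(Complex.I * τ * (x : ℂ))) (-(Complex.I * τ)) x := by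
      exact ((Complex.ofRealCLM.hasDerivAt (x := x)).const_mul (Complex.I * τ)).neg.congr_deriv
        (by simp)
    exact h1.cexp.congr_deriv (mul_comm _ _)
  have hp := hE.mul h hL
  have hn : ∀ y : ℝ, ‖Complex.exp (-(Complex.I * τ * y))‖ = 1 := fun y => by
    rw [Complex.norm_exp]; simp
  have hb := hp.norm_sub_le ⟨le_rfl, hL⟩ hx
  have e1 : ∀ y : ℝ, ‖-(Complex.I * τ) * Complex.exp (-(Complex.I * τ * y)) * a y
      + Complex.exp (-(Complex.I * τ * y)) * (Complex.I * τ * a y + k y)‖ = ‖k y‖ := fun y => by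
    rw [show -(Complex.I * τ) * Complex.exp (-(Complex.I * τ * y)) * a y
      + Complex.exp (-(Complex.I * τ * y)) * (Complex.I * τ * a y + k y)
      = Complex.exp (-(Complex.I * τ * y)) * k y by ring, norm_mul, hn, one_mul]
  simp only [e1] at hb
  refine le_trans (le_of_eq ?_) hb
  have e2 : a x - a 0 * Complex.exp (Complex.I * τ * x)
      = Complex.exp (Complex.I * τ * x) * (Complex.exp (-(Complex.I * τ * x)) * a x
        - Complex.exp (-(Complex.I * τ * (0 : ℝ))) * a 0) := by
    have : Complex.exp (Complex.I * τ * x) * Complex.exp (-(Complex.I * τ * x)) = 1 := by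
      rw [← Complex.exp_add]; simp
    simp only [Complex.ofReal_zero, mul_zero, neg_zero, Complex.exp_zero]
    linear_combination (-a x) * this
  rw [e2, norm_mul]
  have : ‖Complex.exp (Complex.I * τ * x)‖ = 1 := by rw [Complex.norm_exp]; simp
  rw [this, one_mul]

end IsPrimitive

end

section

/-! ### From the circle to the interval -/

theorem ae_coe {P : S1 → Prop} (h : ∀ᵐ z : S1, P z) :
    ∀ᵐ x : ℝ ∂volume.restrict (Ioc 0 (2 * π)), P (x : S1) := by
  have := (AddCircle.measurePreserving_mk (2 * π) 0).quasiMeasurePreserving.ae h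
  rwa [zero_add] at this

theorem integral_coe {E : Type*} [NormedAddCommGroup E] [NormedSpace ℝ E] (f : S1 → E) :
    ∫ z, f z = ∫ x in 0..2 * π, f (x : S1) := by
  rw [← AddCircle.intervalIntegral_preimage (2 * π) 0 f, zero_add]

theorem intervalIntegrable_coe {E : Type*} [NormedAddCommGroup E] {f : S1 → E}
    (h : Integrable f) : IntervalIntegrable (fun x : ℝ => f (x : S1)) volume 0 (2 * π) := by
  rw [intervalIntegrable_iff_integrableOn_Ioc_of_le Real.two_pi_pos.le]
  have h1 := AddCircle.measurePreserving_mk (2 * π) 0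
  rw [zero_add] at h1
  exact h1.integrable_comp_of_integrable h

theorem intervalIntegral_congr_coe {E : Type*} [NormedAddCommGroup E] [NormedSpace ℝ E]
    {f g : ℝ → E} (h : ∀ᵐ x ∂volume.restrict (Ioc 0 (2 * π)), f x = g x) :
    ∫ x in 0..2 * π, f x = ∫ x in 0..2 * π, g x := by
  rw [intervalIntegral.integral_of_le Real.two_pi_pos.le,
    intervalIntegral.integral_of_le Real.two_pi_pos.le]
  exact integral_congr_ae h

/-! ### Fourier modes as test functions -/

theorem fourier_two_pi (n : ℤ) (x : ℝ) :
    fourier n (x : S1) = Complex.exp (Complex.I * n * x) := by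
  rw [fourier_coe_apply]
  congr 1
  have : (π : ℂ) ≠ 0 := by exact_mod_cast Real.pi_ne_zero
  push_cast
  field_simp

theorem hasDerivAt_fourier_two_pi (n : ℤ) (x : ℝ) :
    HasDerivAt (fun y : ℝ => fourier n (y : S1)) (Complex.I * n * fourier n (x : S1)) x := by
  refine (hasDerivAt_fourier (2 * π) n x).congr_deriv ?_
  have : (π : ℂ) ≠ 0 := by exact_mod_cast Real.pi_ne_zero
  push_cast
  field_simp

theorem isTest_fourier (n : ℤ) : IsTest (fun z : S1 => fourier n z) := by
  unfold IsTest
  have : (fun x : ℝ => (fourier n (x : S1) : ℂ)) = fun x : ℝ => Complex.exp (Complex.I * n * x) :=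
    funext fun x => fourier_two_pi n x
  rw [this]
  exact (contDiff_const.mul Complex.ofRealCLM.contDiff).cexp

theorem circleDeriv_fourier (n : ℤ) (z : S1) :
    circleDeriv (fun z : S1 => fourier n z) z = Complex.I * n * fourier n z := by
  induction z using QuotientAddGroup.induction_on with
  | H x =>
    exact (circleDeriv_coe _ x).trans (hasDerivAt_fourier_two_pi n x).deriv

/-- An `L²` function on the circle all of whose nonconstant Fourier modes vanish is constant. -/
theorem ae_eq_const_of_fourier {d : S1 → ℂ} (hd : MemLp d 2)
    (h : ∀ n : ℤ, n ≠ 0 → ∫ z, d z * fourier n z = 0) : ∃ c : ℂ, ∀ᵐ z : S1, d z = c := by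
  have hd' : MemLp d 2 (AddCircle.haarAddCircle : Measure S1) :=
    memLp_haarAddCircle_iff.2 hd
  have hc : ∀ n : ℤ, n ≠ 0 → fourierCoeff (hd'.toLp d) n = 0 := by
    intro n hn
    rw [fourierCoeff_congr_ae hd'.coeFn_toLp]
    unfold fourierCoeff
    rw [AddCircle.integral_haarAddCircle]
    have := h (-n) (neg_ne_zero.2 hn)
    simp only [smul_eq_mul]
    simp_rw [mul_comm (d _)] at this
    rw [this, smul_zero]
  have hs := hasSum_fourier_series_L2 (hd'.toLp d)
  have h1 := hs.unique (hasSum_single (0 : ℤ) fun n hn => by rw [hc n hn, zero_smul])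
  set c := fourierCoeff (hd'.toLp d) 0
  refine ⟨c, ?_⟩
  have h2 : ∀ᵐ z ∂(AddCircle.haarAddCircle : Measure S1), d z = c := by
    have e2 := Lp.coeFn_smul c (fourierLp 2 0 : Lp ℂ 2 (AddCircle.haarAddCircle : Measure S1))
    rw [← h1] at e2
    filter_upwards [hd'.coeFn_toLp, e2, coeFn_fourierLp (T := 2 * π) 2 0] with z h3 h4 h5
    rw [← h3, h4, Pi.smul_apply, h5]
    simp
  rw [AddCircle.volume_eq_smul_haarAddCircle]
  exact Measure.ae_smul_measure h2 _

/-- A function with an integrable weak derivative is an indefinite integral of it. -/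
theorem exists_isPrimitive_of_weak (p : L2) {k : S1 → ℂ} (hk : Integrable k)
    (h : ∀ φ : S1 → ℂ, IsTest φ → ∫ z, p z * circleDeriv φ z = -∫ z, k z * φ z) :
    ∃ f : ℝ → ℂ, IsPrimitive (2 * π) f (fun x => k (x : S1)) ∧ f (2 * π) = f 0 ∧
      ∀ᵐ x : ℝ ∂volume.restrict (Ioc 0 (2 * π)), p (x : S1) = f x := by
  have hL := Real.two_pi_pos.le
  set F : ℝ → ℂ := fun x => ∫ y in 0..x, k (y : S1) with hF
  have hkI := intervalIntegrable_coe hk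
  have hFp : IsPrimitive (2 * π) F (fun x => k (x : S1)) :=
    IsPrimitive.of_sub_eq hkI fun x _ => by simp [hF]
  have hF0 : F 0 = 0 := by simp [hF]
  -- Testing against the constant mode gives `∫ k = 0`, so the primitive closes up around the
  -- circle.
  have hF1 : F (2 * π) = 0 := by
    have := h _ (isTest_fourier 0)
    simp only [circleDeriv_fourier] at this
    rw [hF]
    simp only
    rw [← integral_coe]
    simpa using this
  have hFm : MemLp F 2 (volume.restrict (Ioc 0 (0 + 2 * π))) := by
    rw [zero_add]
    have hc := (hFp.continuousOn hL)
    obtain ⟨K, hK⟩ := isCompact_Icc.exists_bound_of_continuousOn hc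
    refine MemLp.of_bound
      ((hc.mono Ioc_subset_Icc_self).aestronglyMeasurable measurableSet_Ioc) K ?_
    exact (ae_restrict_iff' measurableSet_Ioc).2
      (Eventually.of_forall fun x hx => hK x (Ioc_subset_Icc_self hx))
  have hq : MemLp (AddCircle.liftIoc (2 * π) 0 F) 2 := hFm.memLp_liftIoc
  have hqc : ∀ᵐ x : ℝ ∂volume.restrict (Ioc 0 (2 * π)),
      AddCircle.liftIoc (2 * π) 0 F (x : S1) = F x :=
    (ae_restrict_iff' measurableSet_Ioc).2 (Eventually.of_forall fun x hx =>
      AddCircle.liftIoc_coe_apply (by rwa [zero_add]))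
  set q := AddCircle.liftIoc (2 * π) 0 F with hqdef
  -- `p` and the periodic primitive `q` have the same weak derivative. Their `n`-th modes agree
  -- after multiplication by `i n`, hence agree for `n ≠ 0`, and `p - q` is constant.
  have hcoef : ∀ n : ℤ, n ≠ 0 → ∫ z, (p z - q z) * fourier n z = 0 := by
    intro n hn
    have hn' : Complex.I * n ≠ 0 := by simpa using hn
    have e1 := h _ (isTest_fourier n)
    have e2 : (Complex.I * n) * ∫ z, p z * fourier n z = -∫ z, k z * fourier n z := by
      rw [← e1, ← integral_const_mul]
      refine integral_congr_ae (Eventually.of_forall fun z => ?_)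
      simp only [circleDeriv_fourier]
      ring
    have hen : IsPrimitive (2 * π) (fun x : ℝ => fourier n (x : S1))
        (fun x : ℝ => Complex.I * n * fourier n (x : S1)) :=
      IsPrimitive.of_hasDerivAt (hasDerivAt_fourier_two_pi n)
        (continuous_const.mul ((map_continuous (fourier n)).comp (AddCircle.continuous_mk' _)))
    have hmul := hFp.mul hen hL
    have e3 := hmul.sub_eq (x := 0) (y := 2 * π) ⟨le_rfl, hL⟩ ⟨hL, le_rfl⟩
    simp only [hF0, hF1, zero_mul, sub_zero] at e3
    have hqi : Integrable q := hq.integrable (by norm_num)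
    have hpi : Integrable (fun z => p z) := (Lp.memLp p).integrable (by norm_num)
    have hb : ∀ {f : S1 → ℂ}, Integrable f → Integrable (fun z => f z * fourier n z) := by
      intro f hf
      exact hf.mul_bdd (c := 1) (map_continuous (fourier n)).aestronglyMeasurable
        (Eventually.of_forall fun z => by rw [fourier_apply]; exact (Circle.norm_coe _).le)
    have e4 : ∫ z, k z * fourier n z + (Complex.I * n) * (q z * fourier n z) = 0 := by
      rw [integral_coe, e3]
      refine intervalIntegral_congr_coe ?_
      filter_upwards [hqc] with x hx
      rw [hx]
      ring
    rw [integral_add (hb hk) ((hb hqi).const_mul _), integral_const_mul] at e4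
    have e5 : ∫ z, (p z - q z) * fourier n z
        = (∫ z, p z * fourier n z) - ∫ z, q z * fourier n z := by
      rw [← integral_sub (hb hpi) (hb hqi)]
      simp only [sub_mul]
    rw [e5]
    refine (mul_eq_zero.1 (?_ : Complex.I * n * _ = 0)).resolve_left hn'
    rw [mul_sub, e2]
    linear_combination -e4
  obtain ⟨c, hc⟩ := ae_eq_const_of_fourier ((Lp.memLp p).sub hq) hcoef
  refine ⟨fun x => c + F x, ⟨hkI, fun x hx => ?_⟩, by simp [hF0, hF1], ?_⟩
  · simp [hF]
  · filter_upwards [ae_coe hc, hqc] with x h1 h2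
    rw [← h2, ← h1]
    simp

/-! ### Elements of `H¹` -/

theorem integrable_coeFn (u : L2) : Integrable (fun z => u z) :=
  (Lp.memLp u).integrable (by norm_num)

theorem exists_isPrimitive (u : H1) :
    ∃ f : ℝ → ℂ, IsPrimitive (2 * π) f (fun x => H1.grad u (x : S1)) ∧ f (2 * π) = f 0 ∧
      ∀ᵐ x : ℝ ∂volume.restrict (Ioc 0 (2 * π)), H1.toL2 u (x : S1) = f x :=
  exists_isPrimitive_of_weak _ (integrable_coeFn _) u.2

/-- A smooth function on the circle is an indefinite integral of its derivative. -/
theorem IsTest.isPrimitive {φ : S1 → ℂ} (h : IsTest φ) :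
    IsPrimitive (2 * π) (fun x : ℝ => φ x) (fun x : ℝ => circleDeriv φ x) := by
  refine IsPrimitive.of_hasDerivAt (fun x => ?_)
    (h.continuous_circleDeriv.comp (AddCircle.continuous_mk' _))
  rw [circleDeriv_coe]
  exact (ContDiff.differentiable h (by simp) x).hasDerivAt

theorem coe_two_pi : ((2 * π : ℝ) : S1) = ((0 : ℝ) : S1) := by
  rw [AddCircle.coe_period]
  rfl

theorem intervalIntegral_norm_sq (u : L2) : ∫ x in 0..2 * π, ‖u (x : S1)‖ ^ 2 = ‖u‖ ^ 2 := by
  rw [← integral_coe (fun z => ‖u z‖ ^ 2), ← RCLike.ofReal_inj (K := ℂ), ← integral_ofReal]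
  have := inner_self_eq_norm_sq_to_K (𝕜 := ℂ) u
  push_cast
  rw [← this, MeasureTheory.L2.inner_def]
  refine integral_congr_ae (Eventually.of_forall fun z => ?_)
  simp only [RCLike.inner_apply, RCLike.mul_conj]

theorem integrable_norm_sq (u : L2) : Integrable (fun z => ‖u z‖ ^ 2) :=
  (Lp.memLp u).integrable_norm_pow (by norm_num)

/-- Cauchy–Schwarz against the constant `1`, obtained by expanding the nonnegative variance of `‖u‖`
about its mean. -/
theorem sq_intervalIntegral_norm_le (u : L2) :
    (∫ x in 0..2 * π, ‖u (x : S1)‖) ^ 2 ≤ 2 * π * ‖u‖ ^ 2 := by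
  set m := ∫ x in 0..2 * π, ‖u (x : S1)‖ with hm
  have h1 := intervalIntegrable_coe (integrable_norm_sq u)
  have h2 := intervalIntegrable_coe (integrable_coeFn u).norm
  have hpos := Real.two_pi_pos
  have key : 0 ≤ ∫ x in 0..2 * π, (‖u (x : S1)‖ - m / (2 * π)) ^ 2 :=
    intervalIntegral.integral_nonneg hpos.le fun x _ => sq_nonneg _
  have e : ∫ x in 0..2 * π, (‖u (x : S1)‖ - m / (2 * π)) ^ 2
      = ‖u‖ ^ 2 - m ^ 2 / (2 * π) := by
    have : ∀ x : ℝ, (‖u (x : S1)‖ - m / (2 * π)) ^ 2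
        = ‖u (x : S1)‖ ^ 2 - (2 * (m / (2 * π))) * ‖u (x : S1)‖ + (m / (2 * π)) ^ 2 :=
      fun x => by ring
    simp only [this]
    rw [intervalIntegral.integral_add (h1.sub (h2.const_mul _)) (by simp),
      intervalIntegral.integral_sub h1 (h2.const_mul _), intervalIntegral.integral_const_mul,
      intervalIntegral_norm_sq, intervalIntegral.integral_const, ← hm]
    simp only [sub_zero, smul_eq_mul]
    field_simp
    ring
  rw [e, sub_nonneg, div_le_iff₀ hpos] at key
  linarith

theorem norm_sq_H1 (u : H1) : ‖u‖ ^ 2 = ‖H1.toL2 u‖ ^ 2 + ‖H1.grad u‖ ^ 2 :=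
  WithLp.prod_norm_sq_eq_of_L2 _

/-- The embedding of `H¹` into the bounded functions. -/
theorem norm_le_of_isPrimitive (u : H1) {f : ℝ → ℂ}
    (hf : IsPrimitive (2 * π) f (fun x => H1.grad u (x : S1)))
    (hu : ∀ᵐ x : ℝ ∂volume.restrict (Ioc 0 (2 * π)), H1.toL2 u (x : S1) = f x)
    {x : ℝ} (hx : x ∈ Icc 0 (2 * π)) : ‖f x‖ ≤ 4 * ‖u‖ := by
  have hpos := Real.two_pi_pos
  set m := ∫ t in 0..2 * π, ‖H1.grad u (t : S1)‖ with hm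
  set s := ∫ t in 0..2 * π, ‖H1.toL2 u (t : S1)‖ with hs
  -- The value at `x` is compared with the value at every `y`, up to the total variation bound `m`,
  -- and the comparison is averaged over `y`.
  have h1 : (2 * π) * ‖f x‖ ≤ s + (2 * π) * m := by
    have e1 : ∫ _ in 0..2 * π, ‖f x‖ = (2 * π) * ‖f x‖ := by simp
    have e2 : ∫ y in 0..2 * π, (‖f y‖ + m) = s + (2 * π) * m := by
      rw [intervalIntegral.integral_add]
      · rw [hs, intervalIntegral_congr_coe (hu.mono fun y hy => congrArg norm hy)]
        simp
      · have := (hf.continuousOn hpos.le).norm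
        rw [← uIcc_of_le hpos.le] at this
        exact this.intervalIntegrable
      · simp
    rw [← e1, ← e2]
    refine intervalIntegral.integral_mono_on hpos.le (by simp) ?_ fun y hy => ?_
    · have := ((hf.continuousOn hpos.le).norm).add (continuousOn_const (c := m))
      rw [← uIcc_of_le hpos.le] at this
      exact this.intervalIntegrable
    · have := hf.norm_sub_le hy hx
      have h3 : ‖f x‖ ≤ ‖f y‖ + ‖f x - f y‖ := by
        simpa using norm_add_le (f y) (f x - f y)
      linarith
  have h2 := sq_intervalIntegral_norm_le (H1.grad u)
  have h3 := sq_intervalIntegral_norm_le (H1.toL2 u)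
  have hn := norm_sq_H1 u
  have hm0 : 0 ≤ m := intervalIntegral.integral_nonneg hpos.le fun _ _ => norm_nonneg _
  have hs0 : 0 ≤ s := intervalIntegral.integral_nonneg hpos.le fun _ _ => norm_nonneg _
  have hpi := Real.pi_gt_three
  have hpi' := Real.pi_lt_four
  have h5 : ‖f x‖ ≤ s / (2 * π) + m := by
    rw [div_add' _ _ _ hpos.ne', le_div_iff₀ hpos]
    linarith
  have h6 : s / (2 * π) ≤ s / 6 := by gcongr; linarith
  rw [← hm] at h2
  rw [← hs] at h3
  -- Here `s²` and `m²` are at most `2π < 8` times the squared norms, and Cauchy–Schwarz for the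
  -- weights `(1/6, 1)` costs a factor `37/36`. The constant `16` leaves room.
  have h7 : (s / 6 + m) ^ 2 ≤ (4 * ‖u‖) ^ 2 := by
    nlinarith [sq_nonneg (s - m / 6), sq_nonneg (‖H1.toL2 u‖), sq_nonneg (‖H1.grad u‖)]
  have h8 := abs_le_of_sq_le_sq h7 (by positivity)
  linarith [le_of_abs_le h8]

end

section

/-! ### Maximal dissipative operators and contraction semigroups -/

section Monotone

/-- A function with right derivative at most `C` grows at most with slope `C`. -/
theorem le_add_mul_of_deriv_right_le {f f' : ℝ → ℝ} {C b : ℝ} (hf : ContinuousOn f (Icc 0 b))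
    (hd : ∀ x ∈ Ico 0 b, HasDerivWithinAt f (f' x) (Ici x) x) (hC : ∀ x ∈ Ico 0 b, f' x ≤ C)
    {x : ℝ} (hx : x ∈ Icc 0 b) : f x ≤ f 0 + C * x := by
  refine image_le_of_deriv_right_le_deriv_boundary hf hd (B := fun x => f 0 + C * x)
    (B' := fun _ => C) (by simp) (by fun_prop) (fun x _ => ?_) hC hx
  have := (((hasDerivAt_id x).const_mul C).const_add (f 0)).hasDerivWithinAt (s := Ici x)
  simpa using! this

end Monotone

variable {E : Type*} [NormedAddCommGroup E] [InnerProductSpace ℂ E]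

theorem hasDerivWithinAt_norm_sq {f : ℝ → E} {f' : E} {s : Set ℝ} {t : ℝ}
    (h : HasDerivWithinAt f f' s t) :
    HasDerivWithinAt (fun t => ‖f t‖ ^ 2) (2 * (inner ℂ (f t) f').re) s t := by
  have h1 := Complex.reCLM.hasFDerivAt.comp_hasDerivWithinAt t (h.inner ℂ h)
  have h2 : (fun t => ‖f t‖ ^ 2) = Complex.reCLM ∘ fun t => inner ℂ (f t) (f t) := by
    funext r
    simp [inner_self_eq_norm_sq_to_K, ← Complex.ofReal_pow]
  rw [h2]
  refine h1.congr_deriv ?_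
  have : (inner ℂ f' (f t)).re = (inner ℂ (f t) f').re := by
    rw [← inner_conj_symm, Complex.conj_re]
  simp [this, two_mul]

/-- A linear relation `G` (the graph of an operator `A`) is maximal dissipative if
it is single-valued, `Re ⟪x, A x⟫ ≤ 0` and `l - A` is onto for every `l > 0`. -/
structure MaxDissipative (G : Submodule ℂ (E × E)) : Prop where
  single : ∀ y, ((0 : E), y) ∈ G → y = 0
  dissip : ∀ p ∈ G, (inner ℂ p.1 p.2).re ≤ 0
  surj : ∀ l : ℝ, 0 < l → ∀ f, ∃ p ∈ G, (l : ℂ) • p.1 - p.2 = f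

namespace MaxDissipative

variable {G : Submodule ℂ (E × E)}

/-- Pairing `l x - A x` with `x` and dropping the dissipative term gives `l ‖x‖² ≤ ‖x‖ ‖l x - A x‖`.
-/
theorem norm_le (hG : MaxDissipative G) {p : E × E} (hp : p ∈ G) {l : ℝ} :
    l * ‖p.1‖ ≤ ‖(l : ℂ) • p.1 - p.2‖ := by
  rcases eq_or_ne p.1 0 with h | h
  · simp [h]
  have h1 : (inner ℂ p.1 ((l : ℂ) • p.1 - p.2)).re = l * ‖p.1‖ ^ 2 - (inner ℂ p.1 p.2).re := by
    rw [inner_sub_right, inner_smul_right, inner_self_eq_norm_sq_to_K]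
    simp [← Complex.ofReal_pow]
  have h2 : (inner ℂ p.1 ((l : ℂ) • p.1 - p.2)).re ≤ ‖p.1‖ * ‖(l : ℂ) • p.1 - p.2‖ :=
    re_inner_le_norm (𝕜 := ℂ) _ _
  have h3 := hG.dissip p hp
  have h4 : 0 < ‖p.1‖ := norm_pos_iff.2 h
  refine le_of_mul_le_mul_left ?_ h4
  nlinarith

theorem unique (hG : MaxDissipative G) {p q : E × E} (hp : p ∈ G) (hq : q ∈ G) {l : ℝ}
    (hl : 0 < l) (h : (l : ℂ) • p.1 - p.2 = (l : ℂ) • q.1 - q.2) : p.1 = q.1 := by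
  have h1 := hG.norm_le (G.sub_mem hp hq) (l := l)
  have h2 : (l : ℂ) • (p - q).1 - (p - q).2 = 0 := by
    rw [Prod.fst_sub, Prod.snd_sub, smul_sub, ← sub_eq_zero.2 h]
    abel
  rw [h2, norm_zero] at h1
  have h3 : ‖(p - q).1‖ = 0 := by
    have := norm_nonneg (p - q).1
    nlinarith
  exact sub_eq_zero.1 (norm_eq_zero.1 h3)

/-- The domain of a maximal dissipative operator is dense. -/
theorem dense [CompleteSpace E] (hG : MaxDissipative G) :
    Dense {x : E | ∃ y, (x, y) ∈ G} := by
  have h1 : (G.map (LinearMap.fst ℂ E E)).topologicalClosure = ⊤ := by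
    rw [Submodule.topologicalClosure_eq_top_iff, Submodule.eq_bot_iff]
    intro y hy
    -- If `y` is orthogonal to the domain, write `y = x - A x`. Orthogonality to `x` gives `‖x‖² =
    -- Re ⟪x, A x⟫ ≤ 0`, so `x = 0`, and single-valuedness gives `A x = 0`.
    obtain ⟨p, hp, hpy⟩ := hG.surj 1 one_pos y
    have h2 : inner ℂ p.1 y = 0 := hy p.1 ⟨p, hp, rfl⟩
    have h3 := hG.norm_le hp (l := 1)
    have h4 := hG.dissip p hp
    rw [← hpy, inner_sub_right, inner_smul_right, inner_self_eq_norm_sq_to_K] at h2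
    have h5 := congrArg Complex.re h2
    simp only [Complex.sub_re, Complex.ofReal_one, one_mul, ← Complex.ofReal_pow,
      Complex.coe_algebraMap, Complex.ofReal_re, Complex.zero_re] at h5
    have h6 : p.1 = 0 := by
      have : ‖p.1‖ ^ 2 = 0 := le_antisymm (by linarith) (sq_nonneg _)
      exact norm_eq_zero.1 (pow_eq_zero_iff (two_ne_zero) |>.1 this)
    have h7 : p.2 = 0 := hG.single p.2 (by rwa [← h6])
    rw [← hpy, h6, h7]
    simp
  have h2 : Dense ((G.map (LinearMap.fst ℂ E E) : Submodule ℂ E) : Set E) :=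
    (Submodule.dense_iff_topologicalClosure_eq_top).2 h1
  refine h2.mono ?_
  rintro x ⟨p, hp, rfl⟩
  exact ⟨p.2, hp⟩

/-- The resolvent `(l - A)⁻¹`. -/
def resolvent (hG : MaxDissipative G) {l : ℝ} (hl : 0 < l) : E →L[ℂ] E :=
  LinearMap.mkContinuous
    { toFun := fun f => (hG.surj l hl f).choose.1
      map_add' := fun f g => by
        obtain ⟨h1, h2⟩ := (hG.surj l hl f).choose_spec
        obtain ⟨h3, h4⟩ := (hG.surj l hl g).choose_spec
        obtain ⟨h5, h6⟩ := (hG.surj l hl (f + g)).choose_spec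
        refine hG.unique h5 (G.add_mem h1 h3) hl ?_
        rw [h6, Prod.fst_add, Prod.snd_add, smul_add, add_sub_add_comm, h2, h4]
      map_smul' := fun c f => by
        obtain ⟨h1, h2⟩ := (hG.surj l hl f).choose_spec
        obtain ⟨h5, h6⟩ := (hG.surj l hl (c • f)).choose_spec
        refine hG.unique h5 (G.smul_mem c h1) hl ?_
        rw [h6, Prod.smul_fst, Prod.smul_snd, smul_comm, ← smul_sub, h2] } l⁻¹ (by
    intro f
    obtain ⟨h1, h2⟩ := (hG.surj l hl f).choose_spec
    have := hG.norm_le h1 (l := l)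
    rw [h2] at this
    rw [inv_mul_eq_div, le_div_iff₀ hl, mul_comm]
    exact this)

theorem resolvent_mem (hG : MaxDissipative G) {l : ℝ} (hl : 0 < l) (f : E) :
    (hG.resolvent hl f, (l : ℂ) • hG.resolvent hl f - f) ∈ G := by
  obtain ⟨h1, h2⟩ := (hG.surj l hl f).choose_spec
  have h3 : (l : ℂ) • hG.resolvent hl f - f = (hG.surj l hl f).choose.2 := by
    rw [sub_eq_iff_eq_add, add_comm, ← sub_eq_iff_eq_add]
    exact h2
  rw [h3]
  exact h1

theorem resolvent_eq (hG : MaxDissipative G) {l : ℝ} (hl : 0 < l) {x y : E} (h : (x, y) ∈ G) :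
    hG.resolvent hl ((l : ℂ) • x - y) = x :=
  hG.unique (hG.resolvent_mem hl _) h hl (by simp)

theorem smul_resolvent_norm_le (hG : MaxDissipative G) {l : ℝ} (hl : 0 < l) (f : E) :
    ‖(l : ℂ) • hG.resolvent hl f‖ ≤ ‖f‖ := by
  have := hG.norm_le (hG.resolvent_mem hl f) (l := l)
  rw [norm_smul, Complex.norm_real, Real.norm_of_nonneg hl.le]
  simpa using this

/-- The Yosida approximation `l A (l - A)⁻¹`. -/
def yosida (hG : MaxDissipative G) {l : ℝ} (hl : 0 < l) : E →L[ℂ] E :=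
  (l : ℂ) • ((l : ℂ) • hG.resolvent hl - ContinuousLinearMap.id ℂ E)

theorem yosida_apply (hG : MaxDissipative G) {l : ℝ} (hl : 0 < l) (f : E) :
    hG.yosida hl f = (l : ℂ) • ((l : ℂ) • hG.resolvent hl f - f) := rfl

/-- The Yosida approximation on the domain is `l (l - A)⁻¹ A`. -/
theorem yosida_eq (hG : MaxDissipative G) {l : ℝ} (hl : 0 < l) {x y : E} (h : (x, y) ∈ G) :
    hG.yosida hl x = (l : ℂ) • hG.resolvent hl y := by
  have h1 := hG.resolvent_eq hl h
  rw [map_sub, map_smul] at h1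
  rw [yosida_apply]
  congr 1
  rw [sub_eq_iff_eq_add, add_comm, ← sub_eq_iff_eq_add]
  exact h1

theorem yosida_norm_le (hG : MaxDissipative G) {l : ℝ} (hl : 0 < l) {x y : E} (h : (x, y) ∈ G) :
    ‖hG.yosida hl x‖ ≤ ‖y‖ := by
  rw [hG.yosida_eq hl h]
  exact hG.smul_resolvent_norm_le hl y

theorem smul_resolvent_sub (hG : MaxDissipative G) {l : ℝ} (hl : 0 < l) (x : E) :
    (l : ℂ) • hG.resolvent hl x - x = ((l⁻¹ : ℝ) : ℂ) • hG.yosida hl x := by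
  rw [yosida_apply, smul_smul, ← Complex.ofReal_mul, inv_mul_cancel₀ hl.ne']
  simp

/-- With `x = (l - A)⁻¹ f` and `y = A x` one has `f = l x - y`, and the approximation sends `f` to
`l y`. The pairing is then `l (l Re ⟪x, y⟫ - ‖y‖²)`. -/
theorem yosida_dissip (hG : MaxDissipative G) {l : ℝ} (hl : 0 < l) (f : E) :
    (inner ℂ f (hG.yosida hl f)).re ≤ 0 := by
  set x := hG.resolvent hl f
  set y := (l : ℂ) • x - f with hy
  have h1 : (inner ℂ x y).re ≤ 0 := hG.dissip _ (hG.resolvent_mem hl f)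
  have h2 : f = (l : ℂ) • x - y := by rw [hy]; abel
  have h3 : hG.yosida hl f = (l : ℂ) • y := rfl
  rw [h3, inner_smul_right, h2, inner_sub_left, inner_smul_left, inner_self_eq_norm_sq_to_K]
  have : (l * (l * (inner ℂ x y).re - ‖y‖ ^ 2)) ≤ 0 := by
    have := sq_nonneg ‖y‖
    exact mul_nonpos_of_nonneg_of_nonpos hl.le (by nlinarith)
  simpa [← Complex.ofReal_pow] using this

/-! ### The contraction semigroup as the limit of the Yosida semigroups. -/

variable [CompleteSpace E]

/-- The semigroup generated by the Yosida approximation. -/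
def approx (hG : MaxDissipative G) {l : ℝ} (hl : 0 < l) (t : ℝ) : E →L[ℂ] E :=
  NormedSpace.exp (t • hG.yosida hl)

theorem approx_zero (hG : MaxDissipative G) {l : ℝ} (hl : 0 < l) (x : E) :
    hG.approx hl 0 x = x := by
  simp [approx, NormedSpace.exp_zero]

theorem approx_add (hG : MaxDissipative G) {l : ℝ} (hl : 0 < l) (s t : ℝ) (x : E) :
    hG.approx hl (s + t) x = hG.approx hl s (hG.approx hl t x) := by
  have hcomm : Commute (s • hG.yosida hl) (t • hG.yosida hl) :=
    ((Commute.refl _).smul_left s).smul_right t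
  let _ : NormedAlgebra ℚ (E →L[ℂ] E) := NormedAlgebra.restrictScalars ℚ ℂ _
  rw [approx, add_smul, NormedSpace.exp_add_of_commute hcomm]
  rfl

theorem approx_yosida (hG : MaxDissipative G) {l : ℝ} (hl : 0 < l) (t : ℝ) (x : E) :
    hG.approx hl t (hG.yosida hl x) = hG.yosida hl (hG.approx hl t x) := by
  have : Commute (hG.approx hl t) (hG.yosida hl) :=
    ((Commute.refl (hG.yosida hl)).smul_left t).exp_left
  exact DFunLike.congr_fun this.eq x

theorem hasDerivAt_approx (hG : MaxDissipative G) {l : ℝ} (hl : 0 < l) (t : ℝ) (x : E) :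
    HasDerivAt (fun t => hG.approx hl t x) (hG.yosida hl (hG.approx hl t x)) t := by
  have h1 := hasDerivAt_exp_smul_const' (𝕂 := ℝ) (hG.yosida hl) t
  have h2 := ((ContinuousLinearMap.apply ℂ E x).restrictScalars ℝ).hasFDerivAt.comp_hasDerivAt t h1
  exact h2

theorem approx_norm_le (hG : MaxDissipative G) {l : ℝ} (hl : 0 < l) {t : ℝ} (ht : 0 ≤ t)
    (x : E) : ‖hG.approx hl t x‖ ≤ ‖x‖ := by
  have h1 := le_add_mul_of_deriv_right_le (f := fun t => ‖hG.approx hl t x‖ ^ 2) (C := 0) (b := t)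
    (fun s _ => ((hG.hasDerivAt_approx hl s x).continuousAt.norm.pow 2).continuousWithinAt)
    (fun s _ => hasDerivWithinAt_norm_sq (hG.hasDerivAt_approx hl s x).hasDerivWithinAt)
    (fun s _ => by have := hG.yosida_dissip hl (hG.approx hl s x); linarith)
    (x := t) ⟨ht, le_rfl⟩
  simp only [approx_zero, zero_mul, add_zero] at h1
  exact le_of_sq_le_sq h1 (norm_nonneg _)

/-- This quantifies the Cauchy property. Write `A_l`, `A_m` for the Yosida approximations and `u`,
`v` for the two orbits. Then `u - v` is a difference of domain elements whose images under `A` are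
`A_l u` and `A_m v`, minus `l⁻¹ A_l u - m⁻¹ A_m v`. Dissipativity handles the first part. The second
is small because `A_l u` and `A_m v` stay bounded by `‖y‖`. -/
theorem approx_sub_sq_le (hG : MaxDissipative G) {l m : ℝ} (hl : 0 < l) (hm : 0 < m) {x y : E}
    (h : (x, y) ∈ G) {t : ℝ} (ht : 0 ≤ t) :
    ‖hG.approx hl t x - hG.approx hm t x‖ ^ 2 ≤ 4 * ‖y‖ ^ 2 * (l⁻¹ + m⁻¹) * t := by
  have h1 := le_add_mul_of_deriv_right_le
    (f := fun t => ‖hG.approx hl t x - hG.approx hm t x‖ ^ 2)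
    (C := 4 * ‖y‖ ^ 2 * (l⁻¹ + m⁻¹)) (b := t)
    (fun s _ => (((hG.hasDerivAt_approx hl s x).sub
      (hG.hasDerivAt_approx hm s x)).continuousAt.norm.pow 2).continuousWithinAt)
    (fun s _ => hasDerivWithinAt_norm_sq ((hG.hasDerivAt_approx hl s x).sub
      (hG.hasDerivAt_approx hm s x)).hasDerivWithinAt)
    (fun s hs => ?_) (x := t) ⟨ht, le_rfl⟩
  · simpa [approx_zero] using h1
  set u := hG.approx hl s x with hu
  set v := hG.approx hm s x with hv
  have hBu : ‖hG.yosida hl u‖ ≤ ‖y‖ := by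
    rw [hu, ← approx_yosida]
    exact (hG.approx_norm_le hl hs.1 _).trans (hG.yosida_norm_le hl h)
  have hBv : ‖hG.yosida hm v‖ ≤ ‖y‖ := by
    rw [hv, ← approx_yosida]
    exact (hG.approx_norm_le hm hs.1 _).trans (hG.yosida_norm_le hm h)
  set p := hG.yosida hl u with hp
  set q := hG.yosida hm v with hq
  have h2 : (inner ℂ (((l : ℂ) • hG.resolvent hl u) - (m : ℂ) • hG.resolvent hm v) (p - q)).re
      ≤ 0 := by
    have e1 := G.smul_mem (l : ℂ) (hG.resolvent_mem hl u)
    have e2 := G.smul_mem (m : ℂ) (hG.resolvent_mem hm v)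
    exact hG.dissip _ (G.sub_mem e1 e2)
  have e3 := hG.smul_resolvent_sub hl u
  have e4 := hG.smul_resolvent_sub hm v
  have e5 : u - v = (((l : ℂ) • hG.resolvent hl u) - (m : ℂ) • hG.resolvent hm v)
      - (((l⁻¹ : ℝ) : ℂ) • p - ((m⁻¹ : ℝ) : ℂ) • q) := by
    rw [hp, hq, ← e3, ← e4]
    abel
  have e6 : ‖((l⁻¹ : ℝ) : ℂ) • p - ((m⁻¹ : ℝ) : ℂ) • q‖ ≤ (l⁻¹ + m⁻¹) * ‖y‖ := by
    refine (norm_sub_le _ _).trans ?_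
    rw [norm_smul, norm_smul, Complex.norm_real, Complex.norm_real,
      Real.norm_of_nonneg (inv_pos.2 hl).le, Real.norm_of_nonneg (inv_pos.2 hm).le, add_mul]
    gcongr
  have e7 : ‖p - q‖ ≤ 2 * ‖y‖ := (norm_sub_le _ _).trans (by linarith)
  have e8 : -(inner ℂ (((l⁻¹ : ℝ) : ℂ) • p - ((m⁻¹ : ℝ) : ℂ) • q) (p - q)).re
      ≤ ((l⁻¹ + m⁻¹) * ‖y‖) * (2 * ‖y‖) := by
    have := (abs_le.1 ((Complex.abs_re_le_norm _).trans
      (norm_inner_le_norm (𝕜 := ℂ) (((l⁻¹ : ℝ) : ℂ) • p - ((m⁻¹ : ℝ) : ℂ) • q) (p - q)))).1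
    refine le_trans (neg_le_of_neg_le this) ?_
    gcongr
  change 2 * (inner ℂ (u - v) (p - q)).re ≤ _
  rw [e5, inner_sub_left, Complex.sub_re]
  nlinarith

/-- On the domain `l (l - A)⁻¹ x - x` is `l⁻¹` times a bounded vector. Density and the contraction
bound carry the convergence to all of `E`. -/
theorem smul_resolvent_tendsto (hG : MaxDissipative G) (y : E) {ε : ℝ} (hε : 0 < ε) :
    ∃ N : ℝ, ∀ l (hl : 0 < l), N ≤ l → ‖(l : ℂ) • hG.resolvent hl y - y‖ ≤ ε := by
  obtain ⟨x, ⟨z, hz⟩, hx⟩ := hG.dense.exists_dist_lt y (show (0 : ℝ) < ε / 4 by positivity)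
  rw [dist_eq_norm] at hx
  refine ⟨2 * ‖z‖ / ε + 1, fun l hl hN => ?_⟩
  have h1 := hG.smul_resolvent_sub hl x
  have h2 : ‖(l : ℂ) • hG.resolvent hl x - x‖ ≤ ε / 2 := by
    rw [h1, norm_smul, Complex.norm_real, Real.norm_of_nonneg (inv_pos.2 hl).le, inv_mul_eq_div,
      div_le_iff₀ hl]
    have h3 := hG.yosida_norm_le hl hz
    have h4 : 2 * ‖z‖ / ε ≤ l := by linarith
    rw [div_le_iff₀ hε] at h4
    linarith
  have h5 := hG.smul_resolvent_norm_le hl (y - x)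
  have e : (l : ℂ) • hG.resolvent hl y - y
      = (l : ℂ) • hG.resolvent hl (y - x) + ((l : ℂ) • hG.resolvent hl x - x) - (y - x) := by
    rw [map_sub, smul_sub]
    abel
  rw [e]
  refine (norm_sub_le _ _).trans ?_
  have := norm_add_le ((l : ℂ) • hG.resolvent hl (y - x)) ((l : ℂ) • hG.resolvent hl x - x)
  linarith

theorem approx_sub_le (hG : MaxDissipative G) {l : ℝ} (hl : 0 < l) {x y : E} (h : (x, y) ∈ G)
    {t : ℝ} (ht : 0 ≤ t) : ‖hG.approx hl t x - x‖ ≤ ‖y‖ * t := by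
  have h1 := norm_image_sub_le_of_norm_deriv_le_segment' (a := 0) (b := t) (C := ‖y‖)
    (fun s _ => (hG.hasDerivAt_approx hl s x).hasDerivWithinAt)
    (fun s hs => by
      rw [← approx_yosida]
      exact (hG.approx_norm_le hl hs.1 _).trans (hG.yosida_norm_le hl h)) t ⟨ht, le_rfl⟩
  simpa [approx_zero] using h1

/-- The sequence of approximating semigroups. -/
def approxSeq (hG : MaxDissipative G) (n : ℕ) (t : ℝ) : E →L[ℂ] E :=
  hG.approx (l := (n : ℝ) + 1) (by positivity) t

theorem cauchySeq_approxSeq (hG : MaxDissipative G) {t : ℝ} (ht : 0 ≤ t) (x : E) :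
    CauchySeq fun n => hG.approxSeq n t x := by
  rw [Metric.cauchySeq_iff']
  intro ε hε
  -- The explicit rate holds only on the domain. A nearby domain vector costs `ε / 4` for each of
  -- the two contractions.
  obtain ⟨x', ⟨y, hy⟩, hx⟩ := hG.dense.exists_dist_lt x (show (0 : ℝ) < ε / 4 by positivity)
  rw [dist_eq_norm] at hx
  have hlim : Tendsto (fun n : ℕ => 4 * ‖y‖ ^ 2 * (((n : ℝ) + 1)⁻¹ + ((n : ℝ) + 1)⁻¹) * t) atTop
      (𝓝 (4 * ‖y‖ ^ 2 * (0 + 0) * t)) := by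
    have h1 : Tendsto (fun n : ℕ => ((n : ℝ) + 1)⁻¹) atTop (𝓝 0) := by
      simpa using tendsto_one_div_add_atTop_nhds_zero_nat (𝕜 := ℝ)
    exact ((h1.add h1).const_mul _).mul_const _
  simp only [add_zero, mul_zero, zero_mul] at hlim
  obtain ⟨N, hN⟩ := (hlim.eventually (gt_mem_nhds (show (0 : ℝ) < (ε / 2) ^ 2 by
    positivity))).exists
  refine ⟨N, fun n hn => ?_⟩
  have h1 := hG.approx_sub_sq_le (l := (n : ℝ) + 1) (m := (N : ℝ) + 1) (by positivity)
    (by positivity) hy ht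
  have h2 : ((n : ℝ) + 1)⁻¹ ≤ ((N : ℝ) + 1)⁻¹ := by gcongr
  have h3 : ‖hG.approxSeq n t x' - hG.approxSeq N t x'‖ ^ 2 < (ε / 2) ^ 2 := by
    refine lt_of_le_of_lt (h1.trans ?_) hN
    gcongr
  have h4 := lt_of_pow_lt_pow_left₀ 2 (by positivity) h3
  have h5 : ‖hG.approxSeq n t (x - x')‖ ≤ ‖x - x'‖ := hG.approx_norm_le _ ht _
  have h6 : ‖hG.approxSeq N t (x - x')‖ ≤ ‖x - x'‖ := hG.approx_norm_le _ ht _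
  have e : hG.approxSeq n t x - hG.approxSeq N t x = hG.approxSeq n t (x - x')
      + (hG.approxSeq n t x' - hG.approxSeq N t x') - hG.approxSeq N t (x - x') := by
    simp only [map_sub]
    abel
  rw [dist_eq_norm, e]
  refine (norm_sub_le _ _).trans_lt ?_
  have := norm_add_le (hG.approxSeq n t (x - x')) (hG.approxSeq n t x' - hG.approxSeq N t x')
  linarith

/-- The orbit of the contraction semigroup. -/
def orbit (hG : MaxDissipative G) (t : ℝ≥0) (x : E) : E :=
  (cauchySeq_tendsto_of_complete (hG.cauchySeq_approxSeq t.2 x)).choose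

theorem tendsto_orbit (hG : MaxDissipative G) (t : ℝ≥0) (x : E) :
    Tendsto (fun n => hG.approxSeq n t x) atTop (𝓝 (hG.orbit t x)) :=
  (cauchySeq_tendsto_of_complete (hG.cauchySeq_approxSeq t.2 x)).choose_spec

theorem orbit_norm_le (hG : MaxDissipative G) (t : ℝ≥0) (x : E) : ‖hG.orbit t x‖ ≤ ‖x‖ :=
  le_of_tendsto (hG.tendsto_orbit t x).norm
    (Eventually.of_forall fun _ => hG.approx_norm_le _ t.2 _)

/-- The contraction semigroup generated by a maximal dissipative operator. -/
def semigroup (hG : MaxDissipative G) (t : ℝ≥0) : E →L[ℂ] E :=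
  LinearMap.mkContinuous
    { toFun := hG.orbit t
      map_add' := fun x y => tendsto_nhds_unique (hG.tendsto_orbit t (x + y)) (by
        simpa only [map_add] using (hG.tendsto_orbit t x).add (hG.tendsto_orbit t y))
      map_smul' := fun c x => tendsto_nhds_unique (hG.tendsto_orbit t (c • x)) (by
        simpa only [map_smul, RingHom.id_apply] using (hG.tendsto_orbit t x).const_smul c) } 1 (by
    intro x
    rw [one_mul]
    exact hG.orbit_norm_le t x)

theorem tendsto_semigroup (hG : MaxDissipative G) (t : ℝ≥0) (x : E) :
    Tendsto (fun n => hG.approxSeq n t x) atTop (𝓝 (hG.semigroup t x)) :=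
  hG.tendsto_orbit t x

theorem semigroup_norm_le (hG : MaxDissipative G) (t : ℝ≥0) (x : E) :
    ‖hG.semigroup t x‖ ≤ ‖x‖ :=
  hG.orbit_norm_le t x

theorem semigroup_zero (hG : MaxDissipative G) (x : E) : hG.semigroup 0 x = x := by
  refine tendsto_nhds_unique (hG.tendsto_semigroup 0 x) ?_
  simp [approxSeq, approx_zero]

theorem semigroup_add (hG : MaxDissipative G) (s t : ℝ≥0) (x : E) :
    hG.semigroup (s + t) x = hG.semigroup s (hG.semigroup t x) := by
  refine tendsto_nhds_unique (hG.tendsto_semigroup (s + t) x) ?_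
  have h1 := hG.tendsto_semigroup s (hG.semigroup t x)
  -- The argument of the approximating semigroup moves with `n` as well. Contractivity makes this
  -- error vanish.
  have h2 : Tendsto (fun n => hG.approxSeq n s (hG.approxSeq n t x - hG.semigroup t x)) atTop
      (𝓝 0) := by
    have h3 := (tendsto_sub_nhds_zero_iff.2 (hG.tendsto_semigroup t x)).norm
    rw [norm_zero] at h3
    exact squeeze_zero_norm (fun n => hG.approx_norm_le _ s.2 _) h3
  have h4 := h1.add h2
  rw [add_zero] at h4
  refine h4.congr fun n => ?_
  rw [map_sub, add_sub_cancel, NNReal.coe_add]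
  exact (hG.approx_add _ _ _ _).symm

theorem semigroup_sub_le (hG : MaxDissipative G) {x y : E} (h : (x, y) ∈ G) (t : ℝ≥0) :
    ‖hG.semigroup t x - x‖ ≤ ‖y‖ * t :=
  le_of_tendsto ((hG.tendsto_semigroup t x).sub_const x).norm
    (Eventually.of_forall fun _ => hG.approx_sub_le _ h t.2)

theorem semigroup_dist_le (hG : MaxDissipative G) {x y : E} (h : (x, y) ∈ G) (s t : ℝ≥0) :
    dist (hG.semigroup s x) (hG.semigroup t x) ≤ ‖y‖ * dist s t := by
  wlog hst : s ≤ t generalizing s t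
  · rw [dist_comm, dist_comm s t]
    exact this t s (le_of_not_ge hst)
  obtain ⟨r, rfl⟩ := exists_add_of_le hst
  rw [dist_comm, dist_comm s, semigroup_add, dist_eq_norm, ← map_sub, NNReal.dist_eq]
  refine (hG.semigroup_norm_le _ _).trans ((hG.semigroup_sub_le h r).trans_eq ?_)
  simp

/-- Orbits in the domain are Lipschitz in time, and the contraction bound makes their limits
continuous. -/
theorem continuous_semigroup (hG : MaxDissipative G) (x : E) :
    Continuous fun t => hG.semigroup t x := by
  have h1 : {x : E | ∃ y, (x, y) ∈ G} ⊆ {x | Continuous fun t => hG.semigroup t x} := by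
    rintro x ⟨y, hy⟩
    exact (LipschitzWith.of_dist_le_mul (K := ‖y‖₊) (hG.semigroup_dist_le hy)).continuous
  rw [Metric.continuous_iff]
  intro t ε hε
  obtain ⟨x', hx', hx⟩ := hG.dense.exists_dist_lt x (show (0 : ℝ) < ε / 4 by positivity)
  obtain ⟨δ, hδ, H⟩ := Metric.continuous_iff.1 (h1 hx') t (ε / 4) (by positivity)
  refine ⟨δ, hδ, fun s hs => ?_⟩
  have h2 := H s hs
  rw [dist_eq_norm] at hx
  have h3 : ∀ r, dist (hG.semigroup r x) (hG.semigroup r x') ≤ ‖x - x'‖ := fun r => by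
    rw [dist_eq_norm, ← map_sub]
    exact hG.semigroup_norm_le _ _
  have h4 := dist_triangle4 (hG.semigroup s x) (hG.semigroup s x') (hG.semigroup t x')
    (hG.semigroup t x)
  have h5 := h3 t
  rw [dist_comm] at h5
  have := h3 s
  linarith

/-- The derivative of the approximating orbit of `x` is the approximating semigroup applied to `l (l
- A)⁻¹ y`. Since `y` need not be in the domain, it is replaced by a domain element `y'`, whose orbit
moves at speed at most `‖z‖`. As `l → ∞` and `y' → y` the remainder becomes `o(t)`. -/
theorem approx_taylor_le (hG : MaxDissipative G) {l : ℝ} (hl : 0 < l) {x y y' z : E}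
    (h : (x, y) ∈ G) (h' : (y', z) ∈ G) {t : ℝ} (ht : 0 ≤ t) :
    ‖hG.approx hl t x - x - t • y‖
      ≤ (‖(l : ℂ) • hG.resolvent hl y - y‖ + 2 * ‖y - y'‖ + ‖z‖ * t) * t := by
  have h1 := norm_image_sub_le_of_norm_deriv_le_segment' (a := 0) (b := t)
    (C := ‖(l : ℂ) • hG.resolvent hl y - y‖ + 2 * ‖y - y'‖ + ‖z‖ * t)
    (f := fun s => hG.approx hl s x - s • y) (f' := fun s => hG.yosida hl (hG.approx hl s x) - y)
    (fun s _ => by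
      have := ((hG.hasDerivAt_approx hl s x).sub ((hasDerivAt_id s).smul_const y))
      simpa using! this.hasDerivWithinAt)
    (fun s hs => ?_) t ⟨ht, le_rfl⟩
  · have e : hG.approx hl t x - x - t • y
        = hG.approx hl t x - t • y - (hG.approx hl 0 x - (0 : ℝ) • y) := by
      rw [approx_zero, zero_smul]
      abel
    rw [e]
    simpa using h1
  rw [← approx_yosida, hG.yosida_eq hl h]
  have e : hG.approx hl s ((l : ℂ) • hG.resolvent hl y) - y
      = hG.approx hl s ((l : ℂ) • hG.resolvent hl y - y) + hG.approx hl s (y - y')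
        + (hG.approx hl s y' - y') - (y - y') := by
    simp only [map_sub]
    abel
  have h2 := hG.approx_norm_le hl hs.1 ((l : ℂ) • hG.resolvent hl y - y)
  have h3 := hG.approx_norm_le hl hs.1 (y - y')
  have h4 := hG.approx_sub_le hl h' hs.1
  have h5 : ‖z‖ * s ≤ ‖z‖ * t := by
    have := hs.2.le
    gcongr
  rw [e]
  refine (norm_sub_le _ _).trans ?_
  have h6 := norm_add_le (hG.approx hl s ((l : ℂ) • hG.resolvent hl y - y)
    + hG.approx hl s (y - y')) (hG.approx hl s y' - y')
  have h7 := norm_add_le (hG.approx hl s ((l : ℂ) • hG.resolvent hl y - y))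
    (hG.approx hl s (y - y'))
  linarith

theorem semigroup_taylor_le (hG : MaxDissipative G) {x y y' z : E}
    (h : (x, y) ∈ G) (h' : (y', z) ∈ G) (t : ℝ≥0) :
    ‖hG.semigroup t x - x - (t : ℝ) • y‖ ≤ (2 * ‖y - y'‖ + ‖z‖ * t) * t := by
  refine le_of_forall_pos_le_add fun ε hε => ?_
  obtain ⟨N, hN⟩ := hG.smul_resolvent_tendsto y (ε := ε / (t + 1)) (by positivity)
  refine le_of_tendsto (((hG.tendsto_semigroup t x).sub_const x).sub_const _).norm ?_
  obtain ⟨M, hM⟩ := exists_nat_ge N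
  filter_upwards [eventually_ge_atTop M] with n hn
  have h1 : N ≤ (n : ℝ) + 1 := by
    have : (M : ℝ) ≤ n := by exact_mod_cast hn
    linarith
  have h2 := hG.approx_taylor_le (l := (n : ℝ) + 1) (by positivity) h h' t.2
  have h3 := hN _ (by positivity) h1
  refine h2.trans ?_
  have h4 : ε / (t + 1) * (t : ℝ) ≤ ε := by
    rw [div_mul_eq_mul_div, div_le_iff₀ (by positivity)]
    nlinarith [t.2]
  have h5 := mul_le_mul_of_nonneg_right h3 t.2
  change _ ≤ (_ * t : ℝ) at h5
  have e : ((t : ℝ≥0).1 : ℝ) = (t : ℝ) := rfl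
  rw [e]
  change _ ≤ _ / _ * (t : ℝ) at h5
  nlinarith

theorem semigroup_hasGenerator (hG : MaxDissipative G) {x y : E} (h : (x, y) ∈ G) :
    Tendsto (fun h : ℝ≥0 => (((h : ℝ) : ℂ))⁻¹ • (hG.semigroup h x - x)) (𝓝[>] 0) (𝓝 y) := by
  rw [Metric.tendsto_nhdsWithin_nhds]
  intro ε hε
  obtain ⟨y', ⟨z, hz⟩, hy⟩ := hG.dense.exists_dist_lt y (show (0 : ℝ) < ε / 4 by positivity)
  rw [dist_eq_norm] at hy
  refine ⟨ε / (2 * (‖z‖ + 1)), by positivity, fun t ht hd => ?_⟩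
  have ht0 : (0 : ℝ) < t := ht
  have ht1 : (t : ℝ) < ε / (2 * (‖z‖ + 1)) := by
    simpa [NNReal.dist_eq] using hd
  have h1 := hG.semigroup_taylor_le h hz t
  have e : (((t : ℝ) : ℂ))⁻¹ • (hG.semigroup t x - x) - y
      = (((t : ℝ) : ℂ))⁻¹ • (hG.semigroup t x - x - (t : ℝ) • y) := by
    rw [smul_sub _ (hG.semigroup t x - x), ← Complex.coe_smul (t : ℝ) y, smul_smul,
      inv_mul_cancel₀ (by exact_mod_cast ht0.ne'), one_smul]
  rw [dist_eq_norm, e, norm_smul, norm_inv, Complex.norm_real, Real.norm_of_nonneg ht0.le,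
    inv_mul_eq_div, div_lt_iff₀ ht0]
  refine lt_of_le_of_lt h1 (mul_lt_mul_of_pos_right ?_ ht0)
  rw [lt_div_iff₀ (by positivity)] at ht1
  nlinarith [norm_nonneg z]

/-- Maximality excludes a larger generator. Solve `p.1 - p.2 = x - y` in the graph: the vector `z =
x - p.1` then has generator value `z` itself. Its orbit would start like `(1 + h) z`, which a
contraction allows only for `z = 0`. -/
theorem mem_of_hasGenerator (hG : MaxDissipative G) {x y : E}
    (h : Tendsto (fun h : ℝ≥0 => (((h : ℝ) : ℂ))⁻¹ • (hG.semigroup h x - x)) (𝓝[>] 0) (𝓝 y)) :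
    (x, y) ∈ G := by
  obtain ⟨p, hp, hpe⟩ := hG.surj 1 one_pos (x - y)
  have h1 := h.sub (hG.semigroup_hasGenerator (x := p.1) (y := p.2) hp)
  have hz : y - p.2 = x - p.1 := by
    rw [Complex.ofReal_one, one_smul] at hpe
    rw [sub_eq_iff_eq_add] at hpe
    rw [hpe]
    abel
  rw [hz] at h1
  set z := x - p.1 with hzdef
  have h2 : Tendsto (fun h : ℝ≥0 => ‖(((h : ℝ) : ℂ))⁻¹ • (hG.semigroup h z - z) - z‖) (𝓝[>] 0)
      (𝓝 0) := by
    have := (h1.sub_const z).norm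
    rw [sub_self, norm_zero] at this
    refine this.congr fun t => ?_
    rw [← smul_sub]
    congr 3
    rw [hzdef, map_sub]
    abel
  have h3 : ‖z‖ ≤ 0 := by
    refine ge_of_tendsto h2 (eventually_nhdsWithin_of_forall fun t ht => ?_)
    have ht0 : (0 : ℝ) < t := ht
    have e : (((t : ℝ) : ℂ))⁻¹ • (hG.semigroup t z - z) - z
        = (((t : ℝ) : ℂ))⁻¹ • (hG.semigroup t z - ((1 + t : ℝ) : ℂ) • z) := by
      have e1 : z = (((t : ℝ) : ℂ))⁻¹ • ((t : ℝ) : ℂ) • z := by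
        rw [smul_smul, inv_mul_cancel₀ (by exact_mod_cast ht0.ne'), one_smul]
      nth_rw 3 [e1]
      rw [← smul_sub]
      congr 1
      push_cast
      rw [add_smul, one_smul]
      abel
    rw [e, norm_smul, norm_inv, Complex.norm_real, Real.norm_of_nonneg ht0.le,
      inv_mul_eq_div, le_div_iff₀ ht0]
    have h4 := norm_sub_norm_le (((1 + t : ℝ) : ℂ) • z) (hG.semigroup t z)
    rw [norm_smul, Complex.norm_real, Real.norm_of_nonneg (by positivity),
      norm_sub_rev _ (hG.semigroup t z)] at h4
    have h5 := hG.semigroup_norm_le t z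
    linarith
  have h4 : z = 0 := norm_le_zero_iff.1 h3
  have h5 : x = p.1 := sub_eq_zero.1 h4
  have h6 : y = p.2 := by rw [h4] at hz; exact sub_eq_zero.1 hz
  rw [h5, h6]
  exact hp

/-- **Lumer–Phillips**: a maximal dissipative operator generates a contraction semigroup. -/
theorem isSemigroupGeneratedBy (hG : MaxDissipative G) :
    IsSemigroupGeneratedBy hG.semigroup fun x y => (x, y) ∈ G where
  map_zero := ContinuousLinearMap.ext hG.semigroup_zero
  map_add s t := ContinuousLinearMap.ext (hG.semigroup_add s t)
  continuous_orbit := hG.continuous_semigroup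
  generator _ _ := ⟨hG.mem_of_hasGenerator, hG.semigroup_hasGenerator⟩

end MaxDissipative

end

section

/-! ### Strongly continuous semigroups -/

namespace IsSemigroupGeneratedBy

theorem orbit_generator {E : Type*} [NormedAddCommGroup E] [NormedSpace ℂ E]
    {S : ℝ≥0 → E →L[ℂ] E} {G : E → E → Prop} (hS : IsSemigroupGeneratedBy S G) {x y : E}
    (h : G x y) (t : ℝ≥0) : G (S t x) (S t y) := by
  rw [← hS.generator] at h ⊢
  refine (((S t).continuous.tendsto y).comp h).congr fun s => ?_
  have e1 : S s (S t x) = S t (S s x) := by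
    rw [← ContinuousLinearMap.comp_apply, ← ContinuousLinearMap.comp_apply, ← hS.map_add,
      ← hS.map_add, add_comm]
  simp [e1]

/-- The generator is a limit as `h` decreases to `0`, so this gives right derivatives directly. They
suffice for the monotonicity arguments and for the fundamental theorem of calculus used below. -/
theorem hasDerivWithinAt {E : Type*} [NormedAddCommGroup E] [NormedSpace ℂ E]
    {S : ℝ≥0 → E →L[ℂ] E} {G : E → E → Prop} (hS : IsSemigroupGeneratedBy S G) {x y : E}
    (h : G x y) {t : ℝ} (ht : 0 ≤ t) :
    HasDerivWithinAt (fun t : ℝ => S t.toNNReal x) (S t.toNNReal y) (Ici t) t := by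
  rw [← hasDerivWithinAt_Ioi_iff_Ici, hasDerivWithinAt_iff_tendsto_slope' (by simp)]
  have h1 := (hS.generator _ _).2 (hS.orbit_generator h t.toNNReal)
  have h2 : Tendsto (fun r : ℝ => (r - t).toNNReal) (𝓝[>] t) (𝓝[>] 0) := by
    refine tendsto_nhdsWithin_iff.2 ⟨?_, ?_⟩
    · have : Continuous fun r : ℝ => (r - t).toNNReal := by fun_prop
      have h3 := (this.tendsto t).mono_left (nhdsWithin_le_nhds (s := Ioi t))
      simpa using h3
    · refine eventually_nhdsWithin_of_forall fun r hr => ?_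
      simpa using hr
  refine (h1.comp h2).congr' (eventually_nhdsWithin_of_forall fun r hr => ?_)
  have hr' : t < r := hr
  have e0 : (((r - t).toNNReal : ℝ≥0) : ℝ) = r - t := Real.coe_toNNReal _ (by linarith)
  have e1 : r.toNNReal = (r - t).toNNReal + t.toNNReal := by
    rw [← Real.toNNReal_add (by linarith) ht, sub_add_cancel]
  simp only [Function.comp, slope, vsub_eq_sub, e0]
  rw [e1, hS.map_add, ← Complex.ofReal_inv, Complex.coe_smul]
  rfl

theorem continuous_real {E : Type*} [NormedAddCommGroup E] [NormedSpace ℂ E]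
    {S : ℝ≥0 → E →L[ℂ] E} {G : E → E → Prop} (hS : IsSemigroupGeneratedBy S G) (x : E) :
    Continuous fun t : ℝ => S t.toNNReal x :=
  (hS.continuous_orbit x).comp continuous_real_toNNReal

/-- Multiplying a semigroup by `exp t` adds the identity to its generator. -/
theorem exp_smul {E : Type*} [NormedAddCommGroup E] [NormedSpace ℂ E]
    {S : ℝ≥0 → E →L[ℂ] E} {G : E → E → Prop} (hS : IsSemigroupGeneratedBy S G) :
    IsSemigroupGeneratedBy (fun t : ℝ≥0 => ((Real.exp t : ℝ) : ℂ) • S t)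
      fun x y => G x (y - x) where
  map_zero := by simp [hS.map_zero]
  map_add s t := by
    rw [hS.map_add, NNReal.coe_add, Real.exp_add]
    ext x
    simp [smul_smul, mul_comm]
  continuous_orbit x := by
    have h1 : Continuous fun t : ℝ≥0 => ((Real.exp t : ℝ) : ℂ) := by fun_prop
    exact h1.smul (hS.continuous_orbit x)
  generator x y := by
    rw [← hS.generator]
    have h1 : Tendsto (fun h : ℝ≥0 => ((((h : ℝ)⁻¹ * (Real.exp h - 1) : ℝ)) : ℂ) • S h x) (𝓝[>] 0)
        (𝓝 x) := by
      have h2 : Tendsto (fun h : ℝ≥0 => S h x) (𝓝[>] 0) (𝓝 x) := by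
        have := ((hS.continuous_orbit x).tendsto 0).mono_left (nhdsWithin_le_nhds (s := Ioi 0))
        simpa [hS.map_zero] using this
      have h3 : Tendsto (fun h : ℝ => h⁻¹ * (Real.exp h - 1)) (𝓝[>] 0) (𝓝 1) := by
        have h4 := (hasDerivWithinAt_iff_tendsto_slope' (s := Ioi (0 : ℝ)) (by simp)).1
          (Real.hasDerivAt_exp 0).hasDerivWithinAt
        simpa [slope_fun_def] using h4
      have h5 : Tendsto (fun h : ℝ≥0 => (h : ℝ)) (𝓝[>] 0) (𝓝[>] 0) := by
        refine tendsto_nhdsWithin_iff.2 ⟨?_, ?_⟩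
        · exact (NNReal.continuous_coe.tendsto 0).mono_left nhdsWithin_le_nhds
        · exact eventually_nhdsWithin_of_forall fun r hr => hr
      have h6 := ((Complex.continuous_ofReal.tendsto 1).comp (h3.comp h5)).smul h2
      simpa using! h6
    have e : ∀ h : ℝ≥0, ((h : ℝ) : ℂ)⁻¹ • ((((Real.exp h : ℝ) : ℂ) • S h) x - x)
        = ((h : ℝ) : ℂ)⁻¹ • (S h x - x) + ((((h : ℝ)⁻¹ * (Real.exp h - 1) : ℝ)) : ℂ) • S h x := by
      intro h
      push_cast
      rw [mul_smul, ← smul_add, sub_smul, one_smul, Pi.smul_apply]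
      congr 1
      abel
    simp only [e]
    constructor
    · intro h
      simpa using h.sub h1
    · intro h
      simpa using h.add h1

/-- Two semigroups with the same quasi-dissipative, densely defined generator agree. -/
theorem unique {E : Type*} [NormedAddCommGroup E] [InnerProductSpace ℂ E]
    {S S' : ℝ≥0 → E →L[ℂ] E} {G : E → E → Prop} (hS : IsSemigroupGeneratedBy S G)
    (hS' : IsSemigroupGeneratedBy S' G) (hdense : Dense {x | ∃ y, G x y})
    (hdiss : ∀ x y x' y', G x y → G x' y' → (inner ℂ (x - x') (y - y')).re ≤ ‖x - x'‖ ^ 2) :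
    S = S' := by
  funext t
  refine ContinuousLinearMap.ext fun x => ?_
  have h0 : (fun x => S t x) = fun x => S' t x := by
    refine Continuous.ext_on hdense (S t).continuous (S' t).continuous ?_
    rintro x ⟨y, hy⟩
    have hd : ∀ s : ℝ, 0 ≤ s → HasDerivWithinAt (fun s : ℝ => S s.toNNReal x - S' s.toNNReal x)
        (S s.toNNReal y - S' s.toNNReal y) (Ici s) s := fun s hs =>
      (hS.hasDerivWithinAt hy hs).sub (hS'.hasDerivWithinAt hy hs)
    -- Quasi-dissipativity lets the squared distance of two orbits grow at rate at most `2`. The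
    -- weight `exp (-2s)` makes it nonincreasing, and it starts at `0`.
    have hexp : ∀ s : ℝ, HasDerivWithinAt (fun s : ℝ => Real.exp (-2 * s))
        (-2 * Real.exp (-2 * s)) (Ici s) s := fun s => by
      have := ((hasDerivAt_id s).const_mul (-2)).exp.hasDerivWithinAt (s := Ici s)
      simpa [mul_comm] using! this
    have h1 := le_add_mul_of_deriv_right_le
      (f := fun s => Real.exp (-2 * s) * ‖S s.toNNReal x - S' s.toNNReal x‖ ^ 2) (C := 0)
      (b := (t : ℝ))
      (Continuous.continuousOn ((by fun_prop : Continuous fun s : ℝ => Real.exp (-2 * s)).mul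
        (((hS.continuous_real x).sub (hS'.continuous_real x)).norm.pow 2)))
      (fun s hs => (hexp s).mul (hasDerivWithinAt_norm_sq (hd s hs.1)))
      (fun s hs => ?_) (x := t) ⟨t.2, le_rfl⟩
    · simp only [Real.toNNReal_zero, hS.map_zero, hS'.map_zero, Real.toNNReal_coe] at h1
      simp only [sub_self, norm_zero, mul_zero, zero_mul, add_zero, ne_eq, OfNat.ofNat_ne_zero,
        not_false_eq_true, zero_pow] at h1
      have h2 : ‖S t x - S' t x‖ ^ 2 ≤ 0 := by
        by_contra hne
        exact absurd h1 (not_le.2 (mul_pos (Real.exp_pos _) (not_le.1 hne)))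
      have h3 : ‖S t x - S' t x‖ = 0 :=
        pow_eq_zero_iff two_ne_zero |>.1 (le_antisymm h2 (sq_nonneg _))
      exact sub_eq_zero.1 (norm_eq_zero.1 h3)
    · have h2 := hdiss _ _ _ _ (hS.orbit_generator hy s.toNNReal)
        (hS'.orbit_generator hy s.toNNReal)
      have h3 := Real.exp_pos (-2 * s)
      nlinarith
  exact congrFun h0 x

end IsSemigroupGeneratedBy

end

section

/-! ### Integrability of the damping -/

theorem intervalIntegrable_rpow_sub (β σ : ℝ) (hβ : -1 < β) :
    IntervalIntegrable (fun x => if x ≤ σ then 0 else (x - σ) ^ β) volume (-π) π := by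
  have h1 : IntervalIntegrable (fun x : ℝ => (x - σ) ^ β) volume (-π) π := by
    have := (intervalIntegral.intervalIntegrable_rpow' (a := -π - σ) (b := π - σ)
      hβ).comp_sub_right σ
    simpa using this
  rw [intervalIntegrable_iff] at h1 ⊢
  have h2 := h1.indicator (measurableSet_Ioi (a := σ))
  refine h2.congr (Eventually.of_forall fun x => ?_)
  by_cases h : x ≤ σ
  · simp [h]
  · simp [h, not_le.1 h]

/-- After translation by `θ` the profile is a function of `|x|`, and `β > -1` makes the one-sided
power singularity integrable. -/
theorem integrable_profile (β : ℝ) (hβ : -1 < β) (θ : S1) {σ : ℝ} (hσ : 0 < σ) :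
    Integrable (profile β θ σ) := by
  set f : ℝ → ℝ := fun r => if r ≤ σ then 0 else (r - σ) ^ β with hf
  have hfm : Measurable f := Measurable.ite measurableSet_Iic measurable_const (by fun_prop)
  have h1 : Integrable (fun z : S1 => f ‖z‖) := by
    have hm : AEStronglyMeasurable (fun z : S1 => f ‖z‖) volume :=
      (hfm.comp measurable_norm).aestronglyMeasurable
    have hmp := AddCircle.measurePreserving_mk (2 * π) (-π)
    rw [← hmp.integrable_comp hm, show -π + 2 * π = π by ring]
    have hi := intervalIntegrable_rpow_sub β σ hβ
    have hi' := (IntervalIntegrable.iff_comp_neg (a := -π) (b := π)).1 hi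
    rw [neg_neg] at hi'
    -- Since `σ > 0`, each one-sided profile vanishes on the opposite half-line, so the sum of the
    -- two is the even profile.
    have hsum := hi.add hi'.symm
    rw [intervalIntegrable_iff_integrableOn_Ioc_of_le (by linarith [Real.pi_pos])] at hsum
    refine hsum.congr ((ae_restrict_iff' measurableSet_Ioc).2 (Eventually.of_forall fun x hx => ?_))
    have hn : ‖(x : S1)‖ = |x| := by
      rw [AddCircle.norm_coe_eq_abs_iff (2 * π) Real.two_pi_pos.ne',
        abs_of_pos Real.two_pi_pos, mul_div_cancel_left₀ _ two_ne_zero, abs_le]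
      exact ⟨hx.1.le, hx.2⟩
    simp only [Function.comp, hn, hf]
    rcases le_total 0 x with h | h
    · rw [abs_of_nonneg h, if_pos (show -x ≤ σ by linarith), add_zero]
    · rw [abs_of_nonpos h, if_pos (show x ≤ σ by linarith), zero_add]
  exact h1.comp_sub_right θ

theorem integrable_of_isPolyControlled {β : ℝ} (hβ : -1 < β) {θ : S1} {f : S1 → ℝ}
    (h : IsPolyControlled β θ f) : Integrable f := by
  obtain ⟨hm, C, σ, hC, hσ, hb⟩ := h
  refine ((integrable_profile β hβ θ hσ).const_mul C).mono' hm.aestronglyMeasurable ?_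
  filter_upwards [hb] with z hz
  have h0 : 0 ≤ profile β θ σ z := by
    unfold profile
    split_ifs with h
    · exact le_rfl
    · exact Real.rpow_nonneg (by linarith [not_le.1 h]) _
  rw [Real.norm_of_nonneg (le_trans (by positivity) hz.1)]
  exact hz.2

/-! ### Almost everywhere statements on the circle -/

theorem ae_of_ae_coe {P : S1 → Prop}
    (h : ∀ᵐ x : ℝ ∂volume.restrict (Ioc 0 (2 * π)), P (x : S1)) : ∀ᵐ z : S1, P z := by
  have h0 : ∀ᵐ x : ℝ ∂volume.restrict (Ioc 0 (0 + 2 * π)), P (x : S1) := by rwa [zero_add]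
  rw [ae_restrict_iff_subtype measurableSet_Ioc] at h0
  have h1 :=
    (AddCircle.measurePreserving_equivIoc (T := 2 * π) (a := 0)).quasiMeasurePreserving.ae h0
  filter_upwards [h1] with z hz
  have : ((AddCircle.equivIoc (2 * π) 0 z : ℝ) : S1) = z :=
    (AddCircle.equivIoc (2 * π) 0).symm_apply_apply z
  rwa [this] at hz

theorem ae_norm_le (u : H1) : ∀ᵐ z : S1, ‖H1.toL2 u z‖ ≤ 4 * ‖u‖ := by
  obtain ⟨f, hf, -, hu⟩ := exists_isPrimitive u
  refine ae_of_ae_coe ?_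
  have h1 : ∀ᵐ x ∂volume.restrict (Ioc 0 (2 * π)), x ∈ Ioc 0 (2 * π) :=
    ae_restrict_mem measurableSet_Ioc
  filter_upwards [hu, h1] with x hx hm
  rw [hx]
  exact norm_le_of_isPrimitive u hf hu (Ioc_subset_Icc_self hm)

/-! ### The damping form -/

variable {W : S1 → ℝ}

theorem integrable_damping_mul (hW : Integrable W) (v : H1) :
    Integrable (fun z => (W z : ℂ) * H1.toL2 v z) :=
  hW.ofReal.mul_bdd (Lp.aestronglyMeasurable _) (ae_norm_le v)

theorem integrable_damping_form (hW : Integrable W) (v w : H1) :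
    Integrable (fun z => (W z : ℂ) * starRingEnd ℂ (H1.toL2 v z) * H1.toL2 w z) := by
  refine Integrable.mul_bdd (c := 4 * ‖w‖) ?_ (Lp.aestronglyMeasurable _) (ae_norm_le w)
  refine hW.ofReal.mul_bdd (c := 4 * ‖v‖)
    (Complex.continuous_conj.comp_aestronglyMeasurable (Lp.aestronglyMeasurable _)) ?_
  simpa using ae_norm_le v

theorem toL2_add (u v : H1) : H1.toL2 (u + v) = H1.toL2 u + H1.toL2 v := rfl

theorem toL2_smul (c : ℂ) (u : H1) : H1.toL2 (c • u) = c • H1.toL2 u := rfl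

/-- The inclusion of `H¹` in `L²` as a continuous linear map. -/
def toL2L : H1 →L[ℂ] L2 := (WithLp.fstL 2 ℂ L2 L2).comp H1.subtypeL

/-- The weak derivative as a continuous linear map. -/
def gradL : H1 →L[ℂ] L2 := (WithLp.sndL 2 ℂ L2 L2).comp H1.subtypeL

theorem toL2L_apply (u : H1) : toL2L u = H1.toL2 u := rfl

theorem gradL_apply (u : H1) : gradL u = H1.grad u := rfl

/-- The sesquilinear form `∫ W v̄ w` on `H¹`. -/
def dampingForm (hW : Integrable W) : H1 →L⋆[ℂ] H1 →L[ℂ] ℂ :=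
  LinearMap.mkContinuous₂
    (LinearMap.mk₂'ₛₗ (starRingEnd ℂ) (RingHom.id ℂ)
      (fun v w : H1 => ∫ z, (W z : ℂ) * starRingEnd ℂ (H1.toL2 v z) * H1.toL2 w z)
      (fun u v w => by
        rw [← integral_add (integrable_damping_form hW u w) (integrable_damping_form hW v w)]
        refine integral_congr_ae ?_
        filter_upwards [Lp.coeFn_add (H1.toL2 u) (H1.toL2 v)] with z hz
        rw [toL2_add, hz, Pi.add_apply, map_add]
        ring)
      (fun c u w => by
        rw [smul_eq_mul, ← integral_const_mul]
        refine integral_congr_ae ?_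
        filter_upwards [Lp.coeFn_smul c (H1.toL2 u)] with z hz
        rw [toL2_smul, hz, Pi.smul_apply, smul_eq_mul, map_mul]
        ring)
      (fun w u v => by
        rw [← integral_add (integrable_damping_form hW w u) (integrable_damping_form hW w v)]
        refine integral_congr_ae ?_
        filter_upwards [Lp.coeFn_add (H1.toL2 u) (H1.toL2 v)] with z hz
        rw [toL2_add, hz, Pi.add_apply]
        ring)
      (fun c w u => by
        rw [RingHom.id_apply, smul_eq_mul, ← integral_const_mul]
        refine integral_congr_ae ?_
        filter_upwards [Lp.coeFn_smul c (H1.toL2 u)] with z hz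
        rw [toL2_smul, hz, Pi.smul_apply, smul_eq_mul]
        ring))
    (16 * ∫ z, ‖W z‖) (fun v w => by
      have h1 : ∀ᵐ z, ‖(W z : ℂ) * starRingEnd ℂ (H1.toL2 v z) * H1.toL2 w z‖
          ≤ ‖W z‖ * (16 * ‖v‖ * ‖w‖) := by
        filter_upwards [ae_norm_le v, ae_norm_le w] with z h1 h2
        rw [norm_mul, norm_mul, Complex.norm_real, RCLike.norm_conj, mul_assoc]
        have : ‖H1.toL2 v z‖ * ‖H1.toL2 w z‖ ≤ (4 * ‖v‖) * (4 * ‖w‖) := by gcongr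
        refine mul_le_mul_of_nonneg_left (by linarith) (norm_nonneg _)
      refine (norm_integral_le_of_norm_le (hW.norm.mul_const _) h1).trans_eq ?_
      rw [integral_mul_const]
      ring)

theorem dampingForm_apply (hW : Integrable W) (v w : H1) :
    dampingForm hW v w = ∫ z, (W z : ℂ) * starRingEnd ℂ (H1.toL2 v z) * H1.toL2 w z := rfl

theorem dampingForm_self (hW : Integrable W) (v : H1) :
    dampingForm hW v v = ((∫ z, W z * ‖H1.toL2 v z‖ ^ 2 : ℝ) : ℂ) := by
  rw [dampingForm_apply, ← integral_complex_ofReal]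
  refine integral_congr_ae (Eventually.of_forall fun z => ?_)
  simp only
  rw [mul_assoc, RCLike.conj_mul]
  push_cast
  rfl

/-! ### Test functions in `H¹` -/

theorem IsTest.conj {φ : S1 → ℂ} (h : IsTest φ) : IsTest (fun z => starRingEnd ℂ (φ z)) :=
  Complex.conjCLE.contDiff.comp h

theorem circleDeriv_conj {φ : S1 → ℂ} (h : IsTest φ) (z : S1) :
    circleDeriv (fun z => starRingEnd ℂ (φ z)) z = starRingEnd ℂ (circleDeriv φ z) := by
  induction z using QuotientAddGroup.induction_on with
  | H x =>
    refine (circleDeriv_coe _ x).trans ?_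
    rw [show (QuotientAddGroup.mk x : S1) = (x : S1) from rfl, circleDeriv_coe]
    have h1 : HasDerivAt (fun y : ℝ => φ y) _ x :=
      (ContDiff.differentiable h (by simp) x).hasDerivAt
    exact (Complex.conjCLE.hasFDerivAt.comp_hasDerivAt x h1).deriv

theorem memLp_of_continuous {ψ : S1 → ℂ} (h : Continuous ψ) : MemLp ψ 2 := by
  obtain ⟨K, hK⟩ := (isCompact_range h.norm).bddAbove
  exact MemLp.of_bound h.aestronglyMeasurable K (Eventually.of_forall fun z => hK ⟨z, rfl⟩)

/-- A smooth function as an element of `H¹`. -/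
def IsTest.toH1 {φ : S1 → ℂ} (h : IsTest φ) : H1 :=
  ⟨WithLp.toLp 2 ((memLp_of_continuous h.continuous).toLp φ,
    (memLp_of_continuous h.continuous_circleDeriv).toLp (circleDeriv φ)), by
    intro ψ hψ
    have hpos := Real.two_pi_pos.le
    have h1 : ∫ z, ((memLp_of_continuous h.continuous).toLp φ : L2) z * circleDeriv ψ z
        = ∫ z, φ z * circleDeriv ψ z := by
      refine integral_congr_ae ?_
      filter_upwards [(memLp_of_continuous h.continuous).coeFn_toLp] with z hz
      rw [hz]
    have h2 : ∫ z, ((memLp_of_continuous h.continuous_circleDeriv).toLp (circleDeriv φ) : L2) z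
        * ψ z = ∫ z, circleDeriv φ z * ψ z := by
      refine integral_congr_ae ?_
      filter_upwards [(memLp_of_continuous h.continuous_circleDeriv).coeFn_toLp] with z hz
      rw [hz]
    have h3 := (h.isPrimitive.mul hψ.isPrimitive hpos).sub_eq (x := 0) (y := 2 * π)
      ⟨le_rfl, hpos⟩ ⟨hpos, le_rfl⟩
    rw [coe_two_pi, sub_self, intervalIntegral.integral_add] at h3
    · change ∫ z, ((memLp_of_continuous h.continuous).toLp φ : L2) z * circleDeriv ψ z
        = -∫ z, ((memLp_of_continuous h.continuous_circleDeriv).toLp (circleDeriv φ) : L2) z * ψ z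
      rw [h1, h2, integral_coe, integral_coe]
      linear_combination -h3
    · exact Continuous.intervalIntegrable ((h.continuous_circleDeriv.mul hψ.continuous).comp
        (AddCircle.continuous_mk' _)) _ _
    · exact Continuous.intervalIntegrable ((h.continuous.mul hψ.continuous_circleDeriv).comp
        (AddCircle.continuous_mk' _)) _ _⟩

theorem IsTest.coeFn_toH1 {φ : S1 → ℂ} (h : IsTest φ) : H1.toL2 h.toH1 =ᵐ[volume] φ :=
  (memLp_of_continuous h.continuous).coeFn_toLp

theorem IsTest.coeFn_grad_toH1 {φ : S1 → ℂ} (h : IsTest φ) :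
    H1.grad h.toH1 =ᵐ[volume] circleDeriv φ :=
  (memLp_of_continuous h.continuous_circleDeriv).coeFn_toLp

/-! ### The variational form of the damped wave operator -/

/-- Integration by parts against an element of `H¹`. -/
theorem integral_mul_conj_grad (p : L2) {k : S1 → ℂ} (hk : Integrable k)
    (h : ∀ φ : S1 → ℂ, IsTest φ → ∫ z, p z * circleDeriv φ z = -∫ z, k z * φ z) (w : H1) :
    ∫ z, p z * starRingEnd ℂ (H1.grad w z) = -∫ z, k z * starRingEnd ℂ (H1.toL2 w z) := by
  -- Both factors have periodic primitive representatives, so the product rule leaves no boundary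
  -- term. Only `k ∈ L¹` is available, since `k` will contain the damping term.
  obtain ⟨f, hf, hf0, hfp⟩ := exists_isPrimitive_of_weak p hk h
  obtain ⟨g, hg, hg0, hgw⟩ := exists_isPrimitive w
  have hpos := Real.two_pi_pos.le
  have h3 := (hf.mul hg.conj hpos).sub_eq (x := 0) (y := 2 * π) ⟨le_rfl, hpos⟩ ⟨hpos, le_rfl⟩
  have hcf := hf.continuousOn hpos
  have hcg := hg.conj.continuousOn hpos
  rw [hf0, hg0, sub_self, intervalIntegral.integral_add] at h3
  · rw [integral_coe, integral_coe]
    have e1 : ∫ x in 0..2 * π, p (x : S1) * starRingEnd ℂ (H1.grad w (x : S1))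
        = ∫ x in 0..2 * π, f x * starRingEnd ℂ (H1.grad w (x : S1)) :=
      intervalIntegral_congr_coe (hfp.mono fun x hx => by rw [hx])
    have e2 : ∫ x in 0..2 * π, k (x : S1) * starRingEnd ℂ (H1.toL2 w (x : S1))
        = ∫ x in 0..2 * π, k (x : S1) * starRingEnd ℂ (g x) :=
      intervalIntegral_congr_coe (hgw.mono fun x hx => by rw [hx])
    rw [e1, e2]
    linear_combination -h3
  · exact hf.integrable.mul_continuousOn (by rwa [uIcc_of_le hpos])
  · exact hg.conj.integrable.continuousOn_mul (by rwa [uIcc_of_le hpos])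

theorem inner_L2_def (f g : L2) : inner ℂ f g = ∫ z, g z * starRingEnd ℂ (f z) := by
  rw [MeasureTheory.L2.inner_def]
  rfl

/-- Membership in the domain puts the velocity in `H¹`, hence in `L^∞`, so the damping term is
integrable and `∂ₓu` acquires an `L¹` weak derivative. -/
theorem IsDampedWaveOp.weak (hW : Integrable W) {U F : State} (h : IsDampedWaveOp W U F) :
    Integrable (fun z => F.snd z + (W z : ℂ) * U.snd z) ∧
      ∀ φ : S1 → ℂ, IsTest φ → ∫ z, H1.grad U.fst z * circleDeriv φ z
        = -∫ z, (F.snd z + (W z : ℂ) * U.snd z) * φ z := by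
  have hi : Integrable (fun z => (W z : ℂ) * U.snd z) := by
    rw [h.1]
    exact integrable_damping_mul hW _
  refine ⟨(integrable_coeFn _).add hi, fun φ hφ => ?_⟩
  have h1 := h.2 φ hφ
  have h2 : Integrable (fun z => (W z : ℂ) * U.snd z * φ z) := by
    obtain ⟨K, hK⟩ := (isCompact_range hφ.continuous.norm).bddAbove
    exact hi.mul_bdd (c := K) hφ.continuous.aestronglyMeasurable
      (Eventually.of_forall fun z => hK ⟨z, rfl⟩)
  simp only [add_mul]
  rw [integral_add (integrable_mul_continuous _ hφ.continuous) h2]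
  linear_combination h1

/-- Integration by parts extends the tests from smooth functions to `H¹`, and conjugated test
functions give the converse. In the damping term the velocity is written as `F.fst`, which makes it
continuous for the `H¹` norm. Each condition is then a bounded linear relation between `U` and `F`,
which can be summed, scaled and integrated in time. -/
theorem isDampedWaveOp_iff (hW : Integrable W) (U F : State) :
    IsDampedWaveOp W U F ↔ U.snd = H1.toL2 F.fst ∧ ∀ w : H1,
      inner ℂ (H1.toL2 w) F.snd + inner ℂ (H1.grad w) (H1.grad U.fst)
        + dampingForm hW w F.fst = 0 := by
  constructor
  · intro h
    refine ⟨h.1, fun w => ?_⟩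
    obtain ⟨hi, hw⟩ := h.weak hW
    have h1 := integral_mul_conj_grad _ hi hw w
    rw [inner_L2_def, inner_L2_def, h1, dampingForm_apply]
    have hF : Integrable (fun z => F.snd z * starRingEnd ℂ (H1.toL2 w z)) := by
      refine (integrable_coeFn _).mul_bdd (c := 4 * ‖w‖)
        (Complex.continuous_conj.comp_aestronglyMeasurable (Lp.aestronglyMeasurable _)) ?_
      simpa using ae_norm_le w
    have e : ∫ z, (F.snd z + (W z : ℂ) * U.snd z) * starRingEnd ℂ (H1.toL2 w z)
        = (∫ z, F.snd z * starRingEnd ℂ (H1.toL2 w z))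
          + ∫ z, (W z : ℂ) * starRingEnd ℂ (H1.toL2 w z) * H1.toL2 F.fst z := by
      rw [← integral_add hF (integrable_damping_form hW w _)]
      refine integral_congr_ae (Eventually.of_forall fun z => ?_)
      simp only
      rw [h.1]
      ring
    rw [e]
    ring
  · rintro ⟨h1, h2⟩
    refine ⟨h1, fun φ hφ => ?_⟩
    have h3 := h2 hφ.conj.toH1
    rw [inner_L2_def, inner_L2_def, dampingForm_apply] at h3
    have e1 : ∫ z, F.snd z * starRingEnd ℂ (H1.toL2 hφ.conj.toH1 z) = ∫ z, F.snd z * φ z := by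
      refine integral_congr_ae ?_
      filter_upwards [hφ.conj.coeFn_toH1] with z hz
      rw [hz, Complex.conj_conj]
    have e2 : ∫ z, H1.grad U.fst z * starRingEnd ℂ (H1.grad hφ.conj.toH1 z)
        = ∫ z, H1.grad U.fst z * circleDeriv φ z := by
      refine integral_congr_ae ?_
      filter_upwards [hφ.conj.coeFn_grad_toH1] with z hz
      rw [hz, circleDeriv_conj hφ, Complex.conj_conj]
    have e3 : ∫ z, (W z : ℂ) * starRingEnd ℂ (H1.toL2 hφ.conj.toH1 z) * H1.toL2 F.fst z
        = ∫ z, (W z : ℂ) * U.snd z * φ z := by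
      refine integral_congr_ae ?_
      filter_upwards [hφ.conj.coeFn_toH1] with z hz
      rw [hz, Complex.conj_conj, h1]
      ring
    rw [e1, e2, e3] at h3
    linear_combination h3

end

section

/-! ### Generation of the damped wave semigroup -/

/-- Each test function imposes one continuous linear condition on the pair, namely an orthogonality
relation in `L² × L²`. -/
theorem isClosed_H1 : IsClosed (H1 : Set (WithLp 2 (L2 × L2))) := by
  have h : (H1 : Set (WithLp 2 (L2 × L2))) = ⋂ φ : {φ : S1 → ℂ // IsTest φ},
      {p | inner ℂ (H1.grad φ.2.conj.toH1) p.fst + inner ℂ (H1.toL2 φ.2.conj.toH1) p.snd = 0} := by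
    ext p
    simp only [mem_iInter, mem_ofPred_eq, Subtype.forall]
    refine forall₂_congr fun φ hφ => ?_
    have e1 : ∫ z, p.snd z * starRingEnd ℂ (H1.toL2 hφ.conj.toH1 z) = ∫ z, p.snd z * φ z := by
      refine integral_congr_ae ?_
      filter_upwards [hφ.conj.coeFn_toH1] with z hz
      rw [hz, Complex.conj_conj]
    have e2 : ∫ z, p.fst z * starRingEnd ℂ (H1.grad hφ.conj.toH1 z)
        = ∫ z, p.fst z * circleDeriv φ z := by
      refine integral_congr_ae ?_
      filter_upwards [hφ.conj.coeFn_grad_toH1] with z hz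
      rw [hz, circleDeriv_conj hφ, Complex.conj_conj]
    rw [inner_L2_def, inner_L2_def, e1, e2, eq_neg_iff_add_eq_zero]
  rw [h]
  refine isClosed_iInter fun φ => isClosed_eq ?_ continuous_const
  exact (continuous_const.inner (WithLp.fstL 2 ℂ L2 L2).continuous).add
    (continuous_const.inner (WithLp.sndL 2 ℂ L2 L2).continuous)

instance : CompleteSpace H1 := isClosed_H1.completeSpace_coe

theorem inner_H1 (u v : H1) :
    inner ℂ u v = inner ℂ (H1.toL2 u) (H1.toL2 v) + inner ℂ (H1.grad u) (H1.grad v) :=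
  WithLp.prod_inner_apply _ _

/-- An `L²` function orthogonal to all test functions vanishes. -/
theorem eq_zero_of_forall_test (g : L2) (h : ∀ φ : S1 → ℂ, IsTest φ → ∫ z, g z * φ z = 0) :
    g = 0 := by
  obtain ⟨c, hc⟩ := ae_eq_const_of_fourier (Lp.memLp g) fun n _ => h _ (isTest_fourier n)
  have h0 := h _ (isTest_fourier 0)
  have h1 : ∫ z, g z * fourier 0 z = ∫ _ : S1, c := by
    refine integral_congr_ae ?_
    filter_upwards [hc] with z hz
    rw [hz]
    simp
  rw [h1, integral_const, smul_eq_zero] at h0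
  have hc0 : c = 0 := by
    refine h0.resolve_left ?_
    rw [measureReal_def, AddCircle.measure_univ, ENNReal.toReal_ofReal Real.two_pi_pos.le]
    exact Real.two_pi_pos.ne'
  rw [Lp.eq_zero_iff_ae_eq_zero]
  filter_upwards [hc] with z hz
  rw [hz, hc0]
  rfl

theorem eq_zero_of_toL2_eq_zero {u : H1} (h : H1.toL2 u = 0) : u = 0 := by
  have h1 : H1.grad u = 0 := by
    refine eq_zero_of_forall_test _ fun φ hφ => ?_
    have h2 : ∫ z, H1.toL2 u z * circleDeriv φ z = -∫ z, H1.grad u z * φ z := u.2 φ hφ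
    have h3 : ∫ z, H1.toL2 u z * circleDeriv φ z = 0 := by
      rw [h]
      simp
    rw [h3] at h2
    exact neg_eq_zero.1 h2.symm
  have h2 := norm_sq_H1 u
  rw [h, h1] at h2
  simpa using h2

variable {W : S1 → ℝ}

/-- The graph of `𝒜 - 1`, for the damped wave operator `𝒜`. -/
def waveGraph (hW : Integrable W) : Submodule ℂ (State × State) where
  carrier := {p | IsDampedWaveOp W p.1 (p.2 + p.1)}
  zero_mem' := by
    refine (isDampedWaveOp_iff hW _ _).2 ⟨?_, fun w => ?_⟩
    · change (0 : L2) = H1.toL2 (0 + 0)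
      rw [add_zero]
      rfl
    · have e1 : ((0 : State × State).2 + (0 : State × State).1) = 0 := add_zero _
      rw [e1]
      change inner ℂ (H1.toL2 w) (0 : L2) + inner ℂ (H1.grad w) (0 : L2)
        + dampingForm hW w (0 : H1) = 0
      simp
  add_mem' := by
    rintro p q hp hq
    obtain ⟨h1, h2⟩ := (isDampedWaveOp_iff hW _ _).1 hp
    obtain ⟨h3, h4⟩ := (isDampedWaveOp_iff hW _ _).1 hq
    have e : (p + q).2 + (p + q).1 = (p.2 + p.1) + (q.2 + q.1) := by
      rw [Prod.fst_add, Prod.snd_add]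
      abel
    change IsDampedWaveOp W (p + q).1 ((p + q).2 + (p + q).1)
    rw [e, Prod.fst_add]
    refine (isDampedWaveOp_iff hW _ _).2 ⟨?_, fun w => ?_⟩
    · rw [WithLp.add_snd, WithLp.add_fst, toL2_add, h1, h3]
    · rw [WithLp.add_snd, WithLp.add_fst, WithLp.add_fst, ← gradL_apply (_ + _), map_add, map_add,
        inner_add_right, inner_add_right]
      simp only [gradL_apply]
      linear_combination h2 w + h4 w
  smul_mem' := by
    rintro c p hp
    obtain ⟨h1, h2⟩ := (isDampedWaveOp_iff hW _ _).1 hp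
    have e : (c • p).2 + (c • p).1 = c • (p.2 + p.1) := by
      rw [Prod.smul_fst, Prod.smul_snd, smul_add]
    change IsDampedWaveOp W (c • p).1 ((c • p).2 + (c • p).1)
    rw [e, Prod.smul_fst]
    refine (isDampedWaveOp_iff hW _ _).2 ⟨?_, fun w => ?_⟩
    · rw [WithLp.smul_snd, WithLp.smul_fst, toL2_smul, h1]
    · rw [WithLp.smul_snd, WithLp.smul_fst, WithLp.smul_fst, ← gradL_apply (_ • _), map_smul,
        map_smul, inner_smul_right, inner_smul_right, smul_eq_mul]
      simp only [gradL_apply]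
      linear_combination c * h2 w

theorem mem_waveGraph (hW : Integrable W) (p : State × State) :
    p ∈ waveGraph hW ↔ IsDampedWaveOp W p.1 (p.2 + p.1) := Iff.rfl

/-- The damping operator on `H¹` representing `∫ W v̄ w`. -/
def dampingOp (hW : Integrable W) : H1 →L[ℂ] H1 :=
  -- The Riesz representation places the operator on the conjugate-linear argument. The adjoint
  -- moves it to the linear one.
  (InnerProductSpace.continuousLinearMapOfBilin (dampingForm hW)).adjoint

theorem inner_dampingOp (hW : Integrable W) (v w : H1) :
    inner ℂ v (dampingOp hW w) = dampingForm hW v w := by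
  rw [dampingOp, ContinuousLinearMap.adjoint_inner_right,
    InnerProductSpace.continuousLinearMapOfBilin_apply]

/-- The operator `-Δ + μ² + μ W` in variational form. -/
def helmholtzOp (hW : Integrable W) (μ : ℝ) : H1 →L[ℂ] H1 :=
  gradL.adjoint ∘L gradL + ((μ : ℂ) ^ 2) • (toL2L.adjoint ∘L toL2L) + (μ : ℂ) • dampingOp hW

theorem inner_helmholtzOp (hW : Integrable W) (μ : ℝ) (w u : H1) :
    inner ℂ w (helmholtzOp hW μ u) = inner ℂ (H1.grad w) (H1.grad u)
      + (μ : ℂ) ^ 2 * inner ℂ (H1.toL2 w) (H1.toL2 u) + μ * dampingForm hW w u := by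
  change inner ℂ w (gradL.adjoint (gradL u) + ((μ : ℂ) ^ 2) • toL2L.adjoint (toL2L u)
    + (μ : ℂ) • dampingOp hW u) = _
  have e1 : inner ℂ w (gradL.adjoint (gradL u)) = inner ℂ (H1.grad w) (H1.grad u) :=
    ContinuousLinearMap.adjoint_inner_right _ _ _
  have e2 : inner ℂ w (((μ : ℂ) ^ 2) • toL2L.adjoint (toL2L u))
      = (μ : ℂ) ^ 2 * inner ℂ (H1.toL2 w) (H1.toL2 u) :=
    (inner_smul_right _ _ _).trans
      (congrArg (fun c => (μ : ℂ) ^ 2 * c) (ContinuousLinearMap.adjoint_inner_right _ _ _))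
  have e3 : inner ℂ w ((μ : ℂ) • dampingOp hW u) = μ * dampingForm hW w u := by
    have := inner_smul_right (𝕜 := ℂ) w (dampingOp hW u) (μ : ℂ)
    rwa [inner_dampingOp] at this
  rw [inner_add_right, inner_add_right, e1, e2, e3]

theorem dissipation_nonneg (h0 : ∀ᵐ z : S1, 0 ≤ W z) (v : L2) :
    0 ≤ ∫ z, W z * ‖v z‖ ^ 2 := by
  refine integral_nonneg_of_ae ?_
  filter_upwards [h0] with z hz
  exact mul_nonneg hz (sq_nonneg _)

/-- Lax–Milgram: the damping contributes nonnegatively to the quadratic form, and `μ ≥ 1` makes the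
remaining terms dominate the `H¹` norm with constant `1`. -/
theorem isUnit_helmholtzOp (hW : Integrable W) (h0 : ∀ᵐ z : S1, 0 ≤ W z) {μ : ℝ} (hμ : 1 ≤ μ) :
    IsUnit (helmholtzOp hW μ) := by
  refine ContinuousLinearMap.isUnit_of_forall_le_norm_inner_map _ (c := 1) one_pos fun u => ?_
  rw [← inner_conj_symm, RCLike.norm_conj, inner_helmholtzOp, dampingForm_self,
    inner_self_eq_norm_sq_to_K, inner_self_eq_norm_sq_to_K, norm_sq_H1]
  have h1 := dissipation_nonneg h0 (H1.toL2 u)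
  set D := ∫ z, W z * ‖H1.toL2 u z‖ ^ 2
  have e : ((‖H1.grad u‖ : ℝ) : ℂ) ^ 2 + (μ : ℂ) ^ 2 * ((‖H1.toL2 u‖ : ℝ) : ℂ) ^ 2 + μ * (D : ℂ)
      = ((‖H1.grad u‖ ^ 2 + μ ^ 2 * ‖H1.toL2 u‖ ^ 2 + μ * D : ℝ) : ℂ) := by push_cast; ring
  simp only [Complex.coe_algebraMap]
  rw [e, Complex.norm_real]
  refine le_trans ?_ (Real.le_norm_self _)
  have h2 : 0 ≤ μ * D := mul_nonneg (by linarith) h1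
  have h3 : ‖H1.toL2 u‖ ^ 2 ≤ μ ^ 2 * ‖H1.toL2 u‖ ^ 2 :=
    le_mul_of_one_le_left (sq_nonneg _) (one_le_pow₀ hμ)
  simp only [NNReal.coe_one, mul_one]
  linarith

/-- The dissipation identity. -/
theorem IsDampedWaveOp.re_inner (hW : Integrable W) {U F : State} (h : IsDampedWaveOp W U F) :
    (inner ℂ (H1.grad U.fst) (H1.grad F.fst)).re + (inner ℂ U.snd F.snd).re
      = -∫ z, W z * ‖U.snd z‖ ^ 2 := by
  obtain ⟨h1, h2⟩ := (isDampedWaveOp_iff hW _ _).1 h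
  have h3 := congrArg Complex.re (h2 F.fst)
  rw [dampingForm_self, ← h1] at h3
  simp only [Complex.add_re, Complex.ofReal_re, Complex.zero_re] at h3
  have h4 : (inner ℂ (H1.grad F.fst) (H1.grad U.fst)).re
      = (inner ℂ (H1.grad U.fst) (H1.grad F.fst)).re := by
    rw [← inner_conj_symm, Complex.conj_re]
  linarith

theorem norm_sq_state (U : State) :
    ‖U‖ ^ 2 = ‖H1.toL2 U.fst‖ ^ 2 + ‖H1.grad U.fst‖ ^ 2 + ‖U.snd‖ ^ 2 := by
  rw [WithLp.prod_norm_sq_eq_of_L2, norm_sq_H1]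

/-- The energy part of the pairing is nonpositive. What remains is `Re ⟪u, v⟫`, coming from the
zeroth-order part of the `H¹` norm, and this is why the generator is shifted by `1`. -/
theorem IsDampedWaveOp.re_inner_le (hW : Integrable W) (h0 : ∀ᵐ z : S1, 0 ≤ W z) {U F : State}
    (h : IsDampedWaveOp W U F) :
    (@inner ℂ State InnerProductSpace.toInner U F).re ≤ ‖U‖ ^ 2 := by
  have h1 := h.re_inner hW
  have h2 := dissipation_nonneg h0 U.snd
  have h3 : (@inner ℂ State InnerProductSpace.toInner U F).re = (inner ℂ (H1.toL2 U.fst) U.snd).re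
      + ((inner ℂ (H1.grad U.fst) (H1.grad F.fst)).re + (inner ℂ U.snd F.snd).re) := by
    rw [WithLp.prod_inner_apply]
    change (inner ℂ U.fst F.fst + inner ℂ U.snd F.snd).re = _
    rw [inner_H1, h.1]
    simp only [Complex.add_re]
    ring
  have h4 : (inner ℂ (H1.toL2 U.fst) U.snd).re ≤ ‖H1.toL2 U.fst‖ * ‖U.snd‖ :=
    re_inner_le_norm (𝕜 := ℂ) _ _
  rw [norm_sq_state]
  nlinarith [sq_nonneg (‖H1.toL2 U.fst‖ - ‖U.snd‖), sq_nonneg ‖H1.grad U.fst‖,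
    sq_nonneg ‖H1.toL2 U.fst‖, sq_nonneg ‖U.snd‖]

theorem maxDissipative_waveGraph (hW : Integrable W) (h0 : ∀ᵐ z : S1, 0 ≤ W z) :
    MaxDissipative (waveGraph hW) where
  single y hy := by
    rw [mem_waveGraph] at hy
    simp only [add_zero] at hy
    have h1 : y.fst = 0 := eq_zero_of_toL2_eq_zero hy.1.symm
    have h2 : y.snd = 0 := by
      refine eq_zero_of_forall_test _ fun φ hφ => ?_
      rw [hy.2 φ hφ]
      have e1 : ∫ z, H1.grad (0 : State).fst z * circleDeriv φ z = 0 := by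
        change ∫ z, (0 : L2) z * circleDeriv φ z = 0
        simp
      have e2 : ∫ z, (W z : ℂ) * (0 : State).snd z * φ z = 0 := by
        change ∫ z, (W z : ℂ) * (0 : L2) z * φ z = 0
        have : ∀ᵐ z : S1, (W z : ℂ) * (0 : L2) z * φ z = 0 := by
          filter_upwards [Lp.coeFn_zero ℂ 2 (volume : Measure S1)] with z hz
          rw [hz]
          simp
        rw [integral_congr_ae this, integral_zero]
      rw [e1, e2]
      simp
    have h3 : ‖y‖ ^ 2 = 0 := by
      rw [WithLp.prod_norm_sq_eq_of_L2, h1, h2]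
      simp
    exact norm_eq_zero.1 (pow_eq_zero_iff two_ne_zero |>.1 h3)
  dissip p hp := by
    have h1 := IsDampedWaveOp.re_inner_le hW h0 hp
    rw [inner_add_right, inner_self_eq_norm_sq_to_K] at h1
    simp only [Complex.coe_algebraMap, ← Complex.ofReal_pow, Complex.add_re,
      Complex.ofReal_re] at h1
    linarith
  surj l hl F := by
    -- The equation for `𝒜 - 1` at `l` is the one for `𝒜` at `μ = l + 1 > 1`. With `F = (f, g)`,
    -- substituting `v = μ u - f` leaves `(-Δ + μ² + μ W) u = μ f + g + W f`.
    set μ : ℝ := l + 1 with hμ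
    obtain ⟨e, he⟩ := isUnit_helmholtzOp hW h0 (μ := μ) (by linarith)
    set r : H1 := toL2L.adjoint ((μ : ℂ) • H1.toL2 F.fst + F.snd) + dampingOp hW F.fst with hr
    set u : H1 := (↑e⁻¹ : H1 →L[ℂ] H1) r with hu
    have hTu : helmholtzOp hW μ u = r := by
      rw [← he, hu, ← mul_apply_eq_comp, Units.mul_inv]
      rfl
    set U : State := WithLp.toLp 2 (u, H1.toL2 ((μ : ℂ) • u - F.fst)) with hU
    refine ⟨(U, (l : ℂ) • U - F), ?_, by simp⟩
    rw [mem_waveGraph]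
    have e1 : (U, (l : ℂ) • U - F).2 + (U, (l : ℂ) • U - F).1 = (μ : ℂ) • U - F := by
      simp only [hμ]
      push_cast
      rw [add_smul, one_smul]
      abel
    rw [e1, isDampedWaveOp_iff hW]
    have e2 : ((μ : ℂ) • U - F).fst = (μ : ℂ) • u - F.fst := rfl
    have e3 : ((μ : ℂ) • U - F).snd = (μ : ℂ) • H1.toL2 ((μ : ℂ) • u - F.fst) - F.snd := rfl
    refine ⟨rfl, fun w => ?_⟩
    have h1 := inner_helmholtzOp hW μ w u
    rw [hTu, hr, inner_add_right, ContinuousLinearMap.adjoint_inner_right, inner_dampingOp,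
      toL2L_apply, inner_add_right, inner_smul_right] at h1
    rw [e2, e3]
    change inner ℂ (H1.toL2 w) ((μ : ℂ) • toL2L ((μ : ℂ) • u - F.fst) - F.snd)
      + inner ℂ (H1.grad w) (H1.grad u) + dampingForm hW w ((μ : ℂ) • u - F.fst) = 0
    rw [map_sub, map_sub, map_smul, map_smul, inner_sub_right, inner_smul_right, inner_sub_right,
      inner_smul_right, toL2L_apply, toL2L_apply, smul_eq_mul]
    linear_combination -h1

theorem isDampedWaveOp_iff_mem (hW : Integrable W) (x y : State) :
    IsDampedWaveOp W x y ↔ (x, y - x) ∈ waveGraph hW := by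
  rw [mem_waveGraph]
  simp

theorem existsUnique_semigroup (hW : Integrable W) (h0 : ∀ᵐ z : S1, 0 ≤ W z) :
    ∃! S : ℝ≥0 → State →L[ℂ] State, IsSemigroupGeneratedBy S (IsDampedWaveOp W) := by
  have hG := maxDissipative_waveGraph hW h0
  have h1 := hG.isSemigroupGeneratedBy.exp_smul
  have e : (fun x y => (x, y - x) ∈ waveGraph hW) = IsDampedWaveOp W := by
    funext x y
    exact propext (isDampedWaveOp_iff_mem hW x y).symm
  rw [e] at h1
  refine ⟨_, h1, fun S hS => hS.unique h1 ?_ fun x y x' y' hx hx' => ?_⟩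
  · refine hG.dense.mono ?_
    rintro x ⟨y, hy⟩
    exact ⟨y + x, hy⟩
  · have h2 := (waveGraph hW).sub_mem ((isDampedWaveOp_iff_mem hW x y).1 hx)
      ((isDampedWaveOp_iff_mem hW x' y').1 hx')
    have h3 : IsDampedWaveOp W (x - x') (y - y') := by
      rw [isDampedWaveOp_iff_mem hW]
      convert! h2 using 1
      ext1
      · rfl
      · simp only [Prod.snd_sub]
        abel
    exact h3.re_inner_le hW h0

end

section

/-! ### A lower bound for damped plane waves -/

/-- The wave `exp (iτx)`. -/
def wave (τ x : ℝ) : ℂ := Complex.exp (Complex.I * τ * x)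

theorem norm_wave (τ x : ℝ) : ‖wave τ x‖ = 1 := by
  rw [wave, Complex.norm_exp]
  simp

theorem continuous_wave : Continuous fun p : ℝ × ℝ => wave p.1 p.2 := by
  unfold wave
  fun_prop

theorem continuous_wave_right (τ : ℝ) : Continuous (wave τ) := by
  unfold wave
  fun_prop

theorem norm_sq_wave_add (τ x : ℝ) (α β : ℂ) :
    ‖α * wave τ x + β * wave (-τ) x‖ ^ 2
      = ‖α‖ ^ 2 + ‖β‖ ^ 2 + 2 * (α * starRingEnd ℂ β * wave (2 * τ) x).re := by
  have h1 : wave (2 * τ) x = wave τ x * starRingEnd ℂ (wave (-τ) x) := by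
    rw [wave, wave, wave, ← Complex.exp_conj, ← Complex.exp_add]
    congr 1
    simp
    ring
  have h2 := Complex.normSq_add (α * wave τ x) (β * wave (-τ) x)
  rw [Complex.normSq_eq_norm_sq, Complex.normSq_eq_norm_sq, Complex.normSq_eq_norm_sq,
    norm_mul, norm_mul, norm_wave, norm_wave, mul_one, mul_one] at h2
  rw [h2, h1, map_mul]
  congr 3
  ring

/-- A zero forces `α exp (2iτx) = -β` with `α ≠ 0`, so any two zeros differ by an integer multiple
of `π / τ`. -/
theorem countable_wave_zeros {τ : ℝ} (hτ : τ ≠ 0) {α β : ℂ} (h : α ≠ 0 ∨ β ≠ 0) :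
    {x : ℝ | α * wave τ x + β * wave (-τ) x = 0}.Countable := by
  by_cases hne : ∃ x₀, α * wave τ x₀ + β * wave (-τ) x₀ = 0
  swap
  · refine (countable_empty (α := ℝ)).mono fun x hx => hne ⟨x, hx⟩
  obtain ⟨x₀, hx₀⟩ := hne
  have key : ∀ x, α * wave τ x + β * wave (-τ) x = 0 → α * wave (2 * τ) x = -β := by
    intro x hx
    have h1 : wave (2 * τ) x = wave τ x * wave τ x := by
      rw [wave, wave, ← Complex.exp_add]
      congr 1
      push_cast
      ring
    have h2 : wave τ x * wave (-τ) x = 1 := by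
      rw [wave, wave, ← Complex.exp_add]
      simp
    rw [h1]
    linear_combination wave τ x * hx - β * h2
  have hα : α ≠ 0 := by
    rintro rfl
    have := key x₀ hx₀
    rw [zero_mul] at this
    simp [neg_eq_zero.1 this.symm] at h
  refine (countable_range fun n : ℤ => x₀ + n * π / τ).mono fun x hx => ?_
  have h1 := (key x hx).trans (key x₀ hx₀).symm
  have h2 := mul_left_cancel₀ hα h1
  rw [wave, wave, Complex.exp_eq_exp_iff_exists_int] at h2
  obtain ⟨n, hn⟩ := h2
  refine ⟨n, ?_⟩
  have h3 := congrArg Complex.im hn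
  simp at h3
  simp only
  field_simp
  linarith

variable {w : ℝ → ℝ} {L : ℝ}

/-- The Fourier transform of the damping on `[0, L]`. -/
def dampingFourier (w : ℝ → ℝ) (L τ : ℝ) : ℂ := ∫ x in 0..L, (w x : ℂ) * wave (2 * τ) x

theorem intervalIntegrable_mul_wave (hw : IntervalIntegrable w volume 0 L) (τ : ℝ) :
    IntervalIntegrable (fun x => (w x : ℂ) * wave τ x) volume 0 L := by
  have h1 : IntervalIntegrable (fun x => (w x : ℂ)) volume 0 L := by
    rw [intervalIntegrable_iff] at hw ⊢
    exact hw.ofReal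
  exact h1.mul_continuousOn (continuous_wave_right τ).continuousOn

theorem continuous_dampingFourier (hw : IntervalIntegrable w volume 0 L) :
    Continuous (dampingFourier w L) := by
  refine intervalIntegral.continuous_of_dominated_interval (bound := fun x => ‖w x‖)
    (fun τ => ?_) (fun τ => ?_) hw.norm ?_
  · exact (intervalIntegrable_iff.1 (intervalIntegrable_mul_wave hw (2 * τ))).aestronglyMeasurable
  · refine Eventually.of_forall fun x _ => ?_
    rw [norm_mul, norm_wave, mul_one, Complex.norm_real]
  · refine Eventually.of_forall fun x _ => ?_
    have : Continuous fun τ : ℝ => wave (2 * τ) x :=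
      continuous_wave.comp (by fun_prop : Continuous fun τ : ℝ => (2 * τ, x))
    exact continuous_const.mul this

/-- The Riemann–Lebesgue lemma, after rescaling the frequency by `-1/π` to match the convention `exp
(-2πi x ξ)`. -/
theorem tendsto_dampingFourier (hL : 0 ≤ L) :
    Tendsto (dampingFourier w L) (cocompact ℝ) (𝓝 0) := by
  have h1 := Real.tendsto_integral_exp_smul_cocompact
    ((Ioc 0 L).indicator fun x => (w x : ℂ))
  have h2 : Tendsto (fun τ : ℝ => -τ / π) (cocompact ℝ) (cocompact ℝ) := by
    have := (Homeomorph.mulRight₀ (-π⁻¹) (by simp [Real.pi_ne_zero])).isClosedEmbedding.tendsto_cocompact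
    refine this.congr fun τ => ?_
    simp [div_eq_mul_inv]
  refine (h1.comp h2).congr fun τ => ?_
  simp only [Function.comp]
  rw [dampingFourier, intervalIntegral.integral_of_le hL, ← integral_indicator measurableSet_Ioc]
  refine integral_congr_ae (Eventually.of_forall fun x => ?_)
  by_cases hx : x ∈ Ioc 0 L
  · simp only [indicator_of_mem hx]
    rw [Circle.smul_def, Real.fourierChar_apply, smul_eq_mul, mul_comm, wave]
    congr 2
    have : (π : ℂ) ≠ 0 := by exact_mod_cast Real.pi_ne_zero
    push_cast
    field_simp
  · simp [indicator_of_notMem hx]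

theorem integral_damping_wave (hw : IntervalIntegrable w volume 0 L) (τ : ℝ) (α β : ℂ) :
    ∫ x in 0..L, w x * ‖α * wave τ x + β * wave (-τ) x‖ ^ 2
      = (∫ x in 0..L, w x) * (‖α‖ ^ 2 + ‖β‖ ^ 2)
        + 2 * (α * starRingEnd ℂ β * dampingFourier w L τ).re := by
  have h1 : ∀ x, w x * ‖α * wave τ x + β * wave (-τ) x‖ ^ 2 = w x * (‖α‖ ^ 2 + ‖β‖ ^ 2)
      + 2 * Complex.reCLM (α * starRingEnd ℂ β * ((w x : ℂ) * wave (2 * τ) x)) := by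
    intro x
    rw [norm_sq_wave_add, Complex.reCLM_apply,
      show α * starRingEnd ℂ β * ((w x : ℂ) * wave (2 * τ) x)
        = (w x : ℂ) * (α * starRingEnd ℂ β * wave (2 * τ) x) by ring, Complex.re_ofReal_mul]
    ring
  have hi := (intervalIntegrable_mul_wave hw (2 * τ)).const_mul (α * starRingEnd ℂ β)
  simp only [h1]
  rw [intervalIntegral.integral_add (hw.mul_const _), intervalIntegral.integral_mul_const,
    intervalIntegral.integral_const_mul, ContinuousLinearMap.intervalIntegral_comp_comm _ hi,
    intervalIntegral.integral_const_mul]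
  · rfl
  · refine IntervalIntegrable.const_mul ?_ _
    rw [intervalIntegrable_iff] at hi ⊢
    exact Complex.reCLM.integrable_comp hi

/-- The integral of `exp (iτx)` over `[0, L]`. -/
def waveIntegral (L τ : ℝ) : ℂ := ∫ x in 0..L, wave τ x

theorem continuous_waveIntegral : Continuous (waveIntegral L) :=
  intervalIntegral.continuous_parametric_intervalIntegral_of_continuous' (f := wave)
    continuous_wave _ _

/-- The form bounding the amplitudes of damped plane waves. -/
def waveForm (w : ℝ → ℝ) (L τ : ℝ) (α β : ℂ) : ℝ :=
  (∫ x in 0..L, w x) * (‖α‖ ^ 2 + ‖β‖ ^ 2) + 2 * (α * starRingEnd ℂ β * dampingFourier w L τ).re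
    + ‖α * waveIntegral L τ - β * waveIntegral L (-τ)‖ ^ 2

/-- For `τ ≠ 0` the weighted integral already suffices: if it vanished, the wave would vanish almost
everywhere on `{w > 0}`, but its zeros are countable. For `τ = 0` that integral sees only `α + β`,
and the last term of the form supplies `α - β`. -/
theorem waveForm_pos (hL : 0 < L) (hw : IntervalIntegrable w volume 0 L)
    (h0 : ∀ᵐ x ∂volume.restrict (Ioc 0 L), 0 ≤ w x) (hpos : 0 < ∫ x in 0..L, w x)
    (τ : ℝ) {α β : ℂ} (h : α ≠ 0 ∨ β ≠ 0) : 0 < waveForm w L τ α β := by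
  have hnn : 0 ≤ ∫ x in 0..L, w x * ‖α * wave τ x + β * wave (-τ) x‖ ^ 2 := by
    refine intervalIntegral.integral_nonneg_of_ae_restrict hL.le ?_
    rw [← restrict_Ioc_eq_restrict_Icc]
    filter_upwards [h0] with x hx
    exact mul_nonneg hx (sq_nonneg _)
  have hnn' := sq_nonneg ‖α * waveIntegral L τ - β * waveIntegral L (-τ)‖
  by_contra hle
  rw [waveForm, ← integral_damping_wave hw] at hle
  have e1 : ∫ x in 0..L, w x * ‖α * wave τ x + β * wave (-τ) x‖ ^ 2 = 0 := by linarith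
  have e2 : ‖α * waveIntegral L τ - β * waveIntegral L (-τ)‖ ^ 2 = 0 := by linarith
  rcases eq_or_ne τ 0 with rfl | hτ
  · have hw0 : ∀ x, wave 0 x = 1 := fun x => by simp [wave]
    have hm0 : waveIntegral L 0 = L := by simp [waveIntegral, hw0]
    simp only [neg_zero, hw0, mul_one, hm0] at e1 e2
    rw [intervalIntegral.integral_mul_const, mul_eq_zero] at e1
    have e3 := norm_eq_zero.1 (pow_eq_zero_iff two_ne_zero |>.1 (e1.resolve_left hpos.ne'))
    have e4 := norm_eq_zero.1 (pow_eq_zero_iff two_ne_zero |>.1 e2)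
    rw [← sub_mul, mul_eq_zero] at e4
    have e5 := e4.resolve_right (by exact_mod_cast hL.ne')
    have hα : α = 0 := by linear_combination (e3 + e5) / 2
    have hβ : β = 0 := by linear_combination (e3 - e5) / 2
    simp [hα, hβ] at h
  · have hcont : Continuous fun x => ‖α * wave τ x + β * wave (-τ) x‖ ^ 2 := by
      have := continuous_wave_right τ
      have := continuous_wave_right (-τ)
      fun_prop
    have hi : IntervalIntegrable (fun x => w x * ‖α * wave τ x + β * wave (-τ) x‖ ^ 2)
        volume 0 L := hw.mul_continuousOn hcont.continuousOn
    rw [intervalIntegral.integral_eq_zero_iff_of_le_of_nonneg_ae hL.le (by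
      filter_upwards [h0] with x hx
      exact mul_nonneg hx (sq_nonneg _)) hi] at e1
    have hz : ∀ᵐ x ∂volume.restrict (Ioc 0 L), α * wave τ x + β * wave (-τ) x ≠ 0 :=
      ae_restrict_of_ae ((countable_wave_zeros hτ h).ae_notMem volume)
    have : ∫ x in 0..L, w x = 0 := by
      refine intervalIntegral.integral_zero_ae ?_
      rw [uIoc_of_le hL.le, ← ae_restrict_iff' measurableSet_Ioc]
      filter_upwards [e1, hz] with x h1 h2
      simpa [h2] using h1
    exact hpos.ne' this

/-- Outside a compact set of frequencies the cross term is at most half of the diagonal term, by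
Riemann–Lebesgue. On the compact set the form is continuous and positive on the unit sphere of
amplitudes, and it is homogeneous of degree two. -/
theorem exists_waveForm_lower_bound (hL : 0 < L) (hw : IntervalIntegrable w volume 0 L)
    (h0 : ∀ᵐ x ∂volume.restrict (Ioc 0 L), 0 ≤ w x) (hpos : 0 < ∫ x in 0..L, w x) :
    ∃ c, 0 < c ∧ ∀ (τ : ℝ) (α β : ℂ), c * (‖α‖ ^ 2 + ‖β‖ ^ 2) ≤ waveForm w L τ α β := by
  set M := ∫ x in 0..L, w x with hM
  have h1 := (tendsto_dampingFourier (w := w) hL.le).norm.eventually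
    (gt_mem_nhds (show ‖(0 : ℂ)‖ < M / 2 by rw [norm_zero]; linarith))
  obtain ⟨K, hK, hKc⟩ := (mem_cocompact).1 h1
  set s : Set (ℝ × ℂ × ℂ) := K ×ˢ {p : ℂ × ℂ | ‖p.1‖ ^ 2 + ‖p.2‖ ^ 2 = 1} with hs
  have hcomp : IsCompact s := by
    refine hK.prod ?_
    refine Metric.isCompact_of_isClosed_isBounded
      (isClosed_eq (by fun_prop) continuous_const) ?_
    refine (Metric.isBounded_closedBall (x := (0 : ℂ × ℂ)) (r := 1)).subset fun p hp => ?_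
    have hp' : ‖p.1‖ ^ 2 + ‖p.2‖ ^ 2 = 1 := hp
    rw [mem_closedBall_zero_iff, Prod.norm_def, max_le_iff]
    constructor
    · nlinarith [norm_nonneg p.1, sq_nonneg ‖p.2‖]
    · nlinarith [norm_nonneg p.2, sq_nonneg ‖p.1‖]
  have hcont : Continuous fun p : ℝ × ℂ × ℂ => waveForm w L p.1 p.2.1 p.2.2 := by
    unfold waveForm
    have c1 : Continuous fun p : ℝ × ℂ × ℂ => dampingFourier w L p.1 :=
      (continuous_dampingFourier hw).comp continuous_fst
    have c2 : Continuous fun p : ℝ × ℂ × ℂ => waveIntegral L p.1 :=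
      continuous_waveIntegral.comp continuous_fst
    have c3 : Continuous fun p : ℝ × ℂ × ℂ => waveIntegral L (-p.1) :=
      continuous_waveIntegral.comp continuous_fst.neg
    have c4 : Continuous fun p : ℝ × ℂ × ℂ => starRingEnd ℂ p.2.2 :=
      Complex.continuous_conj.comp (by fun_prop)
    have c5 : Continuous fun p : ℝ × ℂ × ℂ =>
        (p.2.1 * starRingEnd ℂ p.2.2 * dampingFourier w L p.1).re :=
      Complex.continuous_re.comp (((by fun_prop : Continuous fun p : ℝ × ℂ × ℂ => p.2.1).mul c4).mul
        c1)
    fun_prop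
  have hlow : ∃ c₀, 0 < c₀ ∧ ∀ p ∈ s, c₀ ≤ waveForm w L p.1 p.2.1 p.2.2 := by
    rcases s.eq_empty_or_nonempty with he | hne
    · exact ⟨1, one_pos, by simp [he]⟩
    · obtain ⟨q, hq, hmin⟩ := hcomp.exists_isMinOn hne hcont.continuousOn
      refine ⟨_, waveForm_pos hL hw h0 hpos q.1 (α := q.2.1) (β := q.2.2) ?_, hmin⟩
      by_contra hcon
      rw [not_or, not_not, not_not] at hcon
      have : ‖q.2.1‖ ^ 2 + ‖q.2.2‖ ^ 2 = 1 := hq.2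
      rw [hcon.1, hcon.2] at this
      simp at this
  obtain ⟨c₀, hc₀, hlow⟩ := hlow
  refine ⟨min c₀ (M / 2), by positivity, fun τ α β => ?_⟩
  set N := ‖α‖ ^ 2 + ‖β‖ ^ 2 with hN
  have hN0 : 0 ≤ N := by positivity
  by_cases hτ : τ ∈ K
  · refine (mul_le_mul_of_nonneg_right (min_le_left _ _) hN0).trans ?_
    rcases hN0.eq_or_lt with hz | hNpos
    · rw [← hz, mul_zero]
      by_cases h : α ≠ 0 ∨ β ≠ 0
      · exact (waveForm_pos hL hw h0 hpos τ h).le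
      · rw [not_or, not_not, not_not] at h
        simp [waveForm, h.1, h.2]
    · have hr : 0 < √N := Real.sqrt_pos.2 hNpos
      have hr2 : √N ^ 2 = N := Real.sq_sqrt hN0
      set r := √N
      have h2 := hlow (τ, ((r⁻¹ : ℝ) : ℂ) * α, ((r⁻¹ : ℝ) : ℂ) * β) ⟨hτ, by
        change ‖((r⁻¹ : ℝ) : ℂ) * α‖ ^ 2 + ‖((r⁻¹ : ℝ) : ℂ) * β‖ ^ 2 = 1
        rw [norm_mul, norm_mul, Complex.norm_real, Real.norm_of_nonneg (inv_pos.2 hr).le, mul_pow,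
          mul_pow, ← mul_add, ← hN, inv_pow, hr2, inv_mul_cancel₀ hNpos.ne']⟩
      have h3 : waveForm w L τ (((r⁻¹ : ℝ) : ℂ) * α) (((r⁻¹ : ℝ) : ℂ) * β)
          = N⁻¹ * waveForm w L τ α β := by
        have e1 : ((r⁻¹ : ℝ) : ℂ) * α * starRingEnd ℂ (((r⁻¹ : ℝ) : ℂ) * β) * dampingFourier w L τ
            = ((r⁻¹ ^ 2 : ℝ) : ℂ) * (α * starRingEnd ℂ β * dampingFourier w L τ) := by
          rw [map_mul, Complex.conj_ofReal]
          push_cast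
          ring
        have e2 : ((r⁻¹ : ℝ) : ℂ) * α * waveIntegral L τ
              - ((r⁻¹ : ℝ) : ℂ) * β * waveIntegral L (-τ)
            = ((r⁻¹ : ℝ) : ℂ) * (α * waveIntegral L τ - β * waveIntegral L (-τ)) := by ring
        rw [waveForm, waveForm, e1, e2, Complex.re_ofReal_mul, norm_mul, norm_mul, norm_mul,
          Complex.norm_real, Real.norm_of_nonneg (inv_pos.2 hr).le, ← hr2, inv_pow]
        ring
      change c₀ ≤ waveForm w L τ (((r⁻¹ : ℝ) : ℂ) * α) (((r⁻¹ : ℝ) : ℂ) * β) at h2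
      rw [h3, inv_mul_eq_div, le_div_iff₀ hNpos] at h2
      exact h2
  · refine (mul_le_mul_of_nonneg_right (min_le_right _ _) hN0).trans ?_
    have h2 : ‖dampingFourier w L τ‖ < M / 2 := hKc hτ
    have h3 : -(α * starRingEnd ℂ β * dampingFourier w L τ).re ≤ ‖α‖ * ‖β‖ * (M / 2) := by
      refine (neg_le_abs _).trans ((Complex.abs_re_le_norm _).trans ?_)
      rw [norm_mul, norm_mul, RCLike.norm_conj]
      gcongr
    have h4 := sq_nonneg ‖α * waveIntegral L τ - β * waveIntegral L (-τ)‖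
    rw [waveForm, ← hM, ← hN]
    have h5 : 2 * (‖α‖ * ‖β‖) ≤ N := by nlinarith [sq_nonneg (‖α‖ - ‖β‖)]
    nlinarith

end

section

/-! ### The stationary estimate -/

/-- Twice the energy. -/
def energySq (U : State) : ℝ := ‖H1.grad U.fst‖ ^ 2 + ‖U.snd‖ ^ 2

theorem energySq_nonneg (U : State) : 0 ≤ energySq U := by
  unfold energySq
  positivity

theorem integral_norm_sq (u : L2) : ∫ z, ‖u z‖ ^ 2 = ‖u‖ ^ 2 := by
  rw [integral_coe (fun z => ‖u z‖ ^ 2), intervalIntegral_norm_sq]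

theorem energy_eq (U : State) : energy U = energySq U / 2 := by
  rw [energy, energySq, integral_add (integrable_norm_sq _) (integrable_norm_sq _),
    integral_norm_sq, integral_norm_sq]
  ring

variable {W : S1 → ℝ}

theorem integrable_dissipation (hW : Integrable W) (v : H1) :
    Integrable (fun z => W z * ‖H1.toL2 v z‖ ^ 2) := by
  refine hW.mul_bdd (c := (4 * ‖v‖) ^ 2) ((Lp.aestronglyMeasurable _).norm.pow 2) ?_
  filter_upwards [ae_norm_le v] with z hz
  rw [norm_pow, norm_norm]
  gcongr

/-- Cauchy–Schwarz for the weight `W`. -/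
theorem sq_integral_damping_le (hW : Integrable W) (h0 : ∀ᵐ z : S1, 0 ≤ W z)
    (hpos : 0 < ∫ z, W z) (v : H1) :
    (∫ z, ‖(W z : ℂ) * H1.toL2 v z‖) ^ 2 ≤ (∫ z, W z) * ∫ z, W z * ‖H1.toL2 v z‖ ^ 2 := by
  set M := ∫ z, W z with hM
  have e : ∫ z, ‖(W z : ℂ) * H1.toL2 v z‖ = ∫ z, W z * ‖H1.toL2 v z‖ := by
    refine integral_congr_ae ?_
    filter_upwards [h0] with z hz
    rw [norm_mul, Complex.norm_real, Real.norm_of_nonneg hz]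
  have hi : Integrable (fun z => W z * ‖H1.toL2 v z‖) := by
    refine hW.mul_bdd (c := 4 * ‖v‖) (Lp.aestronglyMeasurable _).norm ?_
    simpa using ae_norm_le v
  rw [e]
  set s := ∫ z, W z * ‖H1.toL2 v z‖ with hs
  -- Expand the `W`-weighted variance of `‖v‖` about its weighted mean `s / M`.
  have h1 : 0 ≤ ∫ z, W z * (‖H1.toL2 v z‖ - s / M) ^ 2 := by
    refine integral_nonneg_of_ae ?_
    filter_upwards [h0] with z hz
    exact mul_nonneg hz (sq_nonneg _)
  have h2 : ∫ z, W z * (‖H1.toL2 v z‖ - s / M) ^ 2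
      = (∫ z, W z * ‖H1.toL2 v z‖ ^ 2) - s ^ 2 / M := by
    have : ∀ z, W z * (‖H1.toL2 v z‖ - s / M) ^ 2 = W z * ‖H1.toL2 v z‖ ^ 2
        - (2 * (s / M)) * (W z * ‖H1.toL2 v z‖) + (s / M) ^ 2 * W z := fun z => by ring
    simp only [this]
    have hi' : Integrable (fun z => W z * ‖H1.toL2 v z‖ ^ 2
        - (2 * (s / M)) * (W z * ‖H1.toL2 v z‖)) :=
      (integrable_dissipation hW v).sub (hi.const_mul _)
    rw [integral_add hi' (hW.const_mul _), integral_sub (integrable_dissipation hW v) (hi.const_mul _), integral_const_mul,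
      integral_const_mul, ← hs, ← hM]
    field_simp
    ring
  rw [h2, sub_nonneg, div_le_iff₀ hpos] at h1
  linarith

theorem norm_sq_add_le {E : Type*} [NormedAddCommGroup E] (a b : E) :
    ‖a + b‖ ^ 2 ≤ 2 * ‖a‖ ^ 2 + 2 * ‖b‖ ^ 2 := by
  have h1 := norm_add_le a b
  nlinarith [norm_nonneg (a + b), norm_nonneg a, norm_nonneg b, sq_nonneg (‖a‖ - ‖b‖)]

theorem integral_grad (u : H1) : ∫ x in 0..2 * π, H1.grad u (x : S1) = 0 := by
  obtain ⟨f, hf, hf0, -⟩ := exists_isPrimitive u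
  have hpos := Real.two_pi_pos.le
  rw [← hf.sub_eq (x := 0) (y := 2 * π) ⟨le_rfl, hpos⟩ ⟨hpos, le_rfl⟩, hf0, sub_self]

/-- Plane wave structure of approximate eigenfunctions. -/
theorem exists_amplitudes (hW : Integrable W) (τ : ℝ) {U F : State}
    (h : IsDampedWaveOp W U (((Complex.I * τ : ℂ)) • U - F)) :
    ∃ (V P : ℝ → ℂ) (α β : ℂ), ContinuousOn V (Icc 0 (2 * π)) ∧ ContinuousOn P (Icc 0 (2 * π)) ∧
      (∀ᵐ x : ℝ ∂volume.restrict (Ioc 0 (2 * π)), U.snd (x : S1) = V x) ∧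
      (∀ᵐ x : ℝ ∂volume.restrict (Ioc 0 (2 * π)), H1.grad U.fst (x : S1) = P x) ∧
      ∀ x ∈ Icc 0 (2 * π),
        ‖V x + P x - α * wave τ x‖ ≤ (∫ z, ‖(W z : ℂ) * U.snd z‖) + (∫ z, ‖F.snd z‖)
            + ∫ z, ‖H1.grad F.fst z‖ ∧
        ‖V x - P x - β * wave (-τ) x‖ ≤ (∫ z, ‖(W z : ℂ) * U.snd z‖) + (∫ z, ‖F.snd z‖)
            + ∫ z, ‖H1.grad F.fst z‖ := by
  have hpos := Real.two_pi_pos.le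
  -- With `U = (u, v)` and `F = (f, g)` the equation reads `v = iτ u - f` and `u'' = iτ v - g + W v`
  -- in the weak sense. `V` and `P` are the continuous representatives of `v` and `u'`.
  set A : State := ((Complex.I * τ : ℂ)) • U - F with hA
  obtain ⟨hk, hweak⟩ := h.weak hW
  obtain ⟨P, hP, -, hPu⟩ := exists_isPrimitive_of_weak _ hk hweak
  obtain ⟨V, hV, -, hVu⟩ := exists_isPrimitive A.fst
  rw [← h.1] at hVu
  have hAs : ∀ᵐ z : S1, A.snd z = Complex.I * τ * U.snd z - F.snd z := by
    have e : A.snd = (Complex.I * τ : ℂ) • U.snd - F.snd := rfl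
    rw [e]
    filter_upwards [Lp.coeFn_sub ((Complex.I * τ : ℂ) • U.snd) F.snd,
      Lp.coeFn_smul (Complex.I * τ : ℂ) U.snd] with z h1 h2
    rw [h1, Pi.sub_apply, h2, Pi.smul_apply, smul_eq_mul]
  have hAg : ∀ᵐ z : S1, H1.grad A.fst z = Complex.I * τ * H1.grad U.fst z - H1.grad F.fst z := by
    have e : H1.grad A.fst = (Complex.I * τ : ℂ) • H1.grad U.fst - H1.grad F.fst := rfl
    rw [e]
    filter_upwards [Lp.coeFn_sub ((Complex.I * τ : ℂ) • H1.grad U.fst) (H1.grad F.fst),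
      Lp.coeFn_smul (Complex.I * τ : ℂ) (H1.grad U.fst)] with z h1 h2
    rw [h1, Pi.sub_apply, h2, Pi.smul_apply, smul_eq_mul]
  have hWi : Integrable (fun z => (W z : ℂ) * U.snd z) := by
    rw [h.1]
    exact integrable_damping_mul hW _
  have hi1 : Integrable (fun z => ‖(W z : ℂ) * U.snd z‖ + ‖F.snd z‖) :=
    hWi.norm.add (integrable_coeFn F.snd).norm
  have hi2 : Integrable (fun z => ‖(W z : ℂ) * U.snd z‖ + ‖F.snd z‖ + ‖H1.grad F.fst z‖) :=
    hi1.add (integrable_coeFn (H1.grad F.fst)).norm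
  have hkn : ∀ k : S1 → ℂ, Integrable k →
      (∀ z, ‖k z‖ ≤ ‖(W z : ℂ) * U.snd z‖ + ‖F.snd z‖ + ‖H1.grad F.fst z‖) →
      ∫ x in 0..2 * π, ‖k (x : S1)‖ ≤ (∫ z, ‖(W z : ℂ) * U.snd z‖) + (∫ z, ‖F.snd z‖)
        + ∫ z, ‖H1.grad F.fst z‖ := by
    intro k hki hb
    rw [← integral_coe (fun z => ‖k z‖),
      ← integral_add hWi.norm (integrable_coeFn F.snd).norm,
      ← integral_add hi1 (integrable_coeFn (H1.grad F.fst)).norm]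
    exact integral_mono hki.norm hi2 hb
  set k : S1 → ℂ := fun z => (W z : ℂ) * U.snd z - F.snd z - H1.grad F.fst z with hkdef
  set l : S1 → ℂ := fun z => F.snd z - (W z : ℂ) * U.snd z - H1.grad F.fst z with hldef
  have hk1 := hkn k ((hWi.sub (integrable_coeFn _)).sub (integrable_coeFn _)) fun z =>
    (norm_sub_le _ _).trans (by gcongr; exact norm_sub_le _ _)
  have hl1 := hkn l (((integrable_coeFn _).sub hWi).sub (integrable_coeFn _)) fun z =>
    (norm_sub_le _ _).trans (by
      gcongr
      rw [add_comm]
      exact norm_sub_le _ _)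
  -- Sum and difference diagonalize the first-order system for `(v, u')`: one rotates with frequency
  -- `τ`, the other with `-τ`. Only `L¹` sources remain.
  have ha : IsPrimitive (2 * π) (fun x => V x + P x)
      (fun x => Complex.I * τ * (V x + P x) + k (x : S1)) := by
    refine (hV.add hP).congr ?_ hpos
    filter_upwards [hVu, hPu, ae_coe hAs, ae_coe hAg] with x h1 h2 h3 h4
    rw [h3, h4, ← h1, ← h2]
    simp only [hkdef]
    ring
  have hb : IsPrimitive (2 * π) (fun x => V x - P x)
      (fun x => Complex.I * ((-τ : ℝ) : ℂ) * (V x - P x) + l (x : S1)) := by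
    have := hV.sub hP
    refine this.congr ?_ hpos
    filter_upwards [hVu, hPu, ae_coe hAs, ae_coe hAg] with x h1 h2 h3 h4
    rw [h3, h4, ← h1, ← h2]
    simp only [hldef]
    push_cast
    ring
  refine ⟨V, P, V 0 + P 0, V 0 - P 0, hV.continuousOn hpos, hP.continuousOn hpos, hVu, hPu,
    fun x hx => ⟨(ha.norm_sub_exp_le hpos hx).trans hk1, (hb.norm_sub_exp_le hpos hx).trans hl1⟩⟩

theorem intervalIntegrable_of_continuousOn {E : Type*} [NormedAddCommGroup E] {f : ℝ → E}
    (h : ContinuousOn f (Icc 0 (2 * π))) : IntervalIntegrable f volume 0 (2 * π) := by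
  rw [← uIcc_of_le Real.two_pi_pos.le] at h
  exact h.intervalIntegrable

/-- Observability: the energy of an approximate eigenfunction is controlled by its dissipation,
uniformly in the frequency. -/
theorem exists_observability (hW : Integrable W) (h0 : ∀ᵐ z : S1, 0 ≤ W z)
    (hpos : 0 < ∫ z, W z) :
    ∃ K : ℝ, 0 < K ∧ ∀ (τ : ℝ) (U F : State),
      IsDampedWaveOp W U (((Complex.I * τ : ℂ)) • U - F) →
      energySq U ≤ K * ((∫ z, W z * ‖U.snd z‖ ^ 2) + energySq F) := by
  have hL := Real.two_pi_pos
  have hwi := intervalIntegrable_coe hW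
  have hw0 := ae_coe h0
  set M := ∫ z, W z with hM
  have hMi : ∫ x in 0..2 * π, W (x : S1) = M := (integral_coe W).symm
  obtain ⟨c, hc, hlow⟩ := exists_waveForm_lower_bound hL hwi hw0 (by rw [hMi]; exact hpos)
  -- `R` collects the coefficients of `ε²`: `8 M` from the weighted integral, `16 π² = (4π)²` from
  -- the mean condition, and `2` from returning to the energy. The factor `3 (M + 2π)` then bounds
  -- `ε²` by dissipation plus source energy.
  set R : ℝ := c⁻¹ * (8 * M + 16 * π ^ 2) + 2 with hR
  refine ⟨2 * π * (c⁻¹ * 8 + R * (3 * (M + 2 * π))), by positivity, fun τ U F h => ?_⟩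
  obtain ⟨V, P, α, β, hVc, hPc, hV, hP, hVP⟩ := exists_amplitudes hW τ h
  set ε := (∫ z, ‖(W z : ℂ) * U.snd z‖) + (∫ z, ‖F.snd z‖) + ∫ z, ‖H1.grad F.fst z‖ with hε
  set D := ∫ z, W z * ‖U.snd z‖ ^ 2 with hD
  have hD0 : 0 ≤ D := dissipation_nonneg h0 _
  have hF0 := energySq_nonneg F
  have hε2 : ε ^ 2 ≤ 3 * (M * D + 2 * π * energySq F) := by
    have h1 := sq_integral_damping_le hW h0 hpos (((Complex.I * τ : ℂ)) • U - F).fst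
    rw [← h.1] at h1
    have h2 := sq_intervalIntegral_norm_le F.snd
    have h3 := sq_intervalIntegral_norm_le (H1.grad F.fst)
    rw [← integral_coe (fun z => ‖F.snd z‖)] at h2
    rw [← integral_coe (fun z => ‖H1.grad F.fst z‖)] at h3
    rw [hε, energySq]
    set a := ∫ z, ‖(W z : ℂ) * U.snd z‖
    set b := ∫ z, ‖F.snd z‖
    set d := ∫ z, ‖H1.grad F.fst z‖
    nlinarith [sq_nonneg (a - b), sq_nonneg (a - d), sq_nonneg (b - d)]
  have hε0 : 0 ≤ ε := by positivity
  -- the amplitudes are controlled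
  have hint : ∀ {f : ℝ → ℂ}, ContinuousOn f (Icc 0 (2 * π)) →
      IntervalIntegrable (fun x => ‖f x‖ ^ 2) volume 0 (2 * π) := fun hf =>
    intervalIntegrable_of_continuousOn (hf.norm.pow 2)
  have hDi : ∫ x in 0..2 * π, W (x : S1) * ‖V x‖ ^ 2 = D := by
    rw [hD, integral_coe (fun z => W z * ‖U.snd z‖ ^ 2)]
    exact intervalIntegral_congr_coe (hV.mono fun x hx => by rw [hx])
  have hwc : Continuous fun x => α * wave τ x + β * wave (-τ) x :=
    (continuous_const.mul (continuous_wave_right τ)).add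
      (continuous_const.mul (continuous_wave_right (-τ)))
  have h1 : ∫ x in 0..2 * π, W (x : S1) * ‖α * wave τ x + β * wave (-τ) x‖ ^ 2
      ≤ 8 * D + 8 * ε ^ 2 * M := by
    have hi1 : IntervalIntegrable (fun x : ℝ => W (x : S1) * ‖V x‖ ^ 2) volume 0 (2 * π) :=
      hwi.mul_continuousOn (by rw [uIcc_of_le hL.le]; exact hVc.norm.pow 2)
    rw [← hDi, ← hMi, ← intervalIntegral.integral_const_mul, ← intervalIntegral.integral_const_mul,
      ← intervalIntegral.integral_add (hi1.const_mul _) (hwi.const_mul _)]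
    refine intervalIntegral.integral_mono_ae_restrict hL.le
      (hwi.mul_continuousOn (hwc.norm.pow 2).continuousOn)
      ((hi1.const_mul _).add (hwi.const_mul _)) ?_
    rw [← restrict_Ioc_eq_restrict_Icc]
    filter_upwards [hw0, ae_restrict_mem measurableSet_Ioc] with x hx hmem
    obtain ⟨h3, h4⟩ := hVP x (Ioc_subset_Icc_self hmem)
    have e : α * wave τ x + β * wave (-τ) x = 2 * V x
        + -((V x + P x - α * wave τ x) + (V x - P x - β * wave (-τ) x)) := by ring
    have h5 := norm_sq_add_le (2 * V x)
      (-((V x + P x - α * wave τ x) + (V x - P x - β * wave (-τ) x)))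
    have h6 := pow_le_pow_left₀ (norm_nonneg _) ((norm_add_le (V x + P x - α * wave τ x)
      (V x - P x - β * wave (-τ) x)).trans (add_le_add h3 h4)) 2
    rw [← e, norm_neg, norm_mul, Complex.norm_ofNat] at h5
    have h7 : ‖α * wave τ x + β * wave (-τ) x‖ ^ 2 ≤ 8 * ‖V x‖ ^ 2 + 8 * ε ^ 2 := by
      nlinarith
    have h8 := mul_le_mul_of_nonneg_left h7 hx
    linarith
  -- The difference of the two waves is within `2 ε` of `2 u'`, whose integral over the circle is
  -- zero by periodicity.
  have h2 : ‖α * waveIntegral (2 * π) τ - β * waveIntegral (2 * π) (-τ)‖ ≤ 2 * π * (2 * ε) := by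
    have e0 : ∫ x in 0..2 * π, P x = 0 := by
      rw [← integral_grad U.fst]
      exact (intervalIntegral_congr_coe hP).symm
    have i1 : IntervalIntegrable (fun x => α * wave τ x) volume 0 (2 * π) :=
      (continuous_const.mul (continuous_wave_right τ)).intervalIntegrable _ _
    have i2 : IntervalIntegrable (fun x => β * wave (-τ) x) volume 0 (2 * π) :=
      (continuous_const.mul (continuous_wave_right (-τ))).intervalIntegrable _ _
    have e1 : α * waveIntegral (2 * π) τ - β * waveIntegral (2 * π) (-τ)
        = ∫ x in 0..2 * π, (α * wave τ x - β * wave (-τ) x - 2 * P x) := by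
      rw [intervalIntegral.integral_sub (i1.sub i2)
        ((intervalIntegrable_of_continuousOn hPc).const_mul _),
        intervalIntegral.integral_sub i1 i2, intervalIntegral.integral_const_mul,
        intervalIntegral.integral_const_mul, intervalIntegral.integral_const_mul, e0, mul_zero,
        sub_zero]
      rfl
    rw [e1]
    refine (intervalIntegral.norm_integral_le_of_norm_le_const (C := 2 * ε) fun x hx => ?_).trans_eq
      (by rw [sub_zero, abs_of_pos hL]; ring)
    rw [uIoc_of_le hL.le] at hx
    obtain ⟨h3, h4⟩ := hVP x (Ioc_subset_Icc_self hx)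
    have e2 : α * wave τ x - β * wave (-τ) x - 2 * P x
        = (V x - P x - β * wave (-τ) x) - (V x + P x - α * wave τ x) := by ring
    rw [e2]
    exact (norm_sub_le _ _).trans (by linarith)
  have h3 : ‖α‖ ^ 2 + ‖β‖ ^ 2 ≤ c⁻¹ * (8 * D + (8 * M + 16 * π ^ 2) * ε ^ 2) := by
    have h4 := hlow τ α β
    rw [waveForm, ← integral_damping_wave hwi] at h4
    rw [inv_mul_eq_div, le_div_iff₀ hc]
    have h5 := pow_le_pow_left₀ (norm_nonneg _) h2 2
    nlinarith
  have h4 : energySq U ≤ 2 * π * (‖α‖ ^ 2 + ‖β‖ ^ 2 + 2 * ε ^ 2) := by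
    have e1 : energySq U = ∫ x in 0..2 * π, (‖P x‖ ^ 2 + ‖V x‖ ^ 2) := by
      rw [energySq, ← intervalIntegral_norm_sq, ← intervalIntegral_norm_sq,
        intervalIntegral.integral_add (hint hPc) (hint hVc)]
      congr 1
      · exact intervalIntegral_congr_coe (hP.mono fun x hx => by rw [hx])
      · exact intervalIntegral_congr_coe (hV.mono fun x hx => by rw [hx])
    have e2 : ∫ _ in 0..2 * π, (‖α‖ ^ 2 + ‖β‖ ^ 2 + 2 * ε ^ 2)
        = 2 * π * (‖α‖ ^ 2 + ‖β‖ ^ 2 + 2 * ε ^ 2) := by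
      rw [intervalIntegral.integral_const, sub_zero, smul_eq_mul]
    rw [e1, ← e2]
    refine intervalIntegral.integral_mono_on hL.le ((hint hPc).add (hint hVc)) (by simp)
      fun x hx => ?_
    obtain ⟨h5, h6⟩ := hVP x hx
    have h7 := norm_sq_add_le (V x + P x - α * wave τ x) (α * wave τ x)
    have h8 := norm_sq_add_le (V x - P x - β * wave (-τ) x) (β * wave (-τ) x)
    rw [sub_add_cancel, norm_mul, norm_wave, mul_one] at h7 h8
    have h9 := pow_le_pow_left₀ (norm_nonneg _) h5 2
    have h10 := pow_le_pow_left₀ (norm_nonneg _) h6 2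
    have h11 := parallelogram_law_with_norm ℂ (V x) (P x)
    nlinarith
  have hcinv : 0 ≤ c⁻¹ := by positivity
  calc energySq U ≤ 2 * π * (‖α‖ ^ 2 + ‖β‖ ^ 2 + 2 * ε ^ 2) := h4
    _ ≤ 2 * π * (c⁻¹ * (8 * D + (8 * M + 16 * π ^ 2) * ε ^ 2) + 2 * ε ^ 2) := by gcongr
    _ = 2 * π * (c⁻¹ * 8 * D + R * ε ^ 2) := by rw [hR]; ring
    _ ≤ 2 * π * (c⁻¹ * 8 * D + R * (3 * (M * D + 2 * π * energySq F))) := by gcongr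
    _ ≤ 2 * π * (c⁻¹ * 8 + R * (3 * (M + 2 * π))) * (D + energySq F) := by
      have hR0 : 0 ≤ R := by positivity
      rw [mul_assoc (2 * π)]
      refine mul_le_mul_of_nonneg_left ?_ hL.le
      have h5 : 0 ≤ c⁻¹ * 8 * energySq F := by positivity
      have h6 : M * D + 2 * π * energySq F ≤ (M + 2 * π) * (D + energySq F) := by
        linarith [mul_nonneg hpos.le hF0, mul_nonneg hL.le hD0]
      have h7 := mul_le_mul_of_nonneg_left h6 hR0
      linarith

/-- Uniform resolvent bound on the imaginary axis, in the energy seminorm. -/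
theorem exists_resolvent_bound (hW : Integrable W) (h0 : ∀ᵐ z : S1, 0 ≤ W z)
    (hpos : 0 < ∫ z, W z) :
    ∃ K : ℝ, 0 < K ∧ ∀ (τ : ℝ) (U F : State),
      IsDampedWaveOp W U (((Complex.I * τ : ℂ)) • U - F) → energySq U ≤ K * energySq F := by
  obtain ⟨K, hK, hobs⟩ := exists_observability hW h0 hpos
  -- Observability gives `E(U) ≤ K (D + E(F))`, where `E` is `energySq`. The dissipation identity
  -- and Young's inequality give `2 K D ≤ E(U) + K² E(F)`. Doubling the first and absorbing `E(U)`
  -- leaves `2 K + K²`.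
  refine ⟨2 * K + K ^ 2, by positivity, fun τ U F h => ?_⟩
  have h1 := hobs τ U F h
  have h2 := h.re_inner hW
  set D := ∫ z, W z * ‖U.snd z‖ ^ 2
  have e1 : H1.grad (((Complex.I * τ : ℂ)) • U - F).fst
      = (Complex.I * τ : ℂ) • H1.grad U.fst - H1.grad F.fst := rfl
  have e2 : (((Complex.I * τ : ℂ)) • U - F).snd = (Complex.I * τ : ℂ) • U.snd - F.snd := rfl
  have e3 : ∀ u f : L2, (inner ℂ u ((Complex.I * τ : ℂ) • u - f)).re = -(inner ℂ u f).re := by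
    intro u f
    rw [inner_sub_right, inner_smul_right, inner_self_eq_norm_sq_to_K]
    simp [← Complex.ofReal_pow]
  rw [e1, e2, e3, e3] at h2
  have h3 : (inner ℂ (H1.grad U.fst) (H1.grad F.fst)).re
      ≤ ‖H1.grad U.fst‖ * ‖H1.grad F.fst‖ := re_inner_le_norm (𝕜 := ℂ) _ _
  have h4 : (inner ℂ U.snd F.snd).re ≤ ‖U.snd‖ * ‖F.snd‖ := re_inner_le_norm (𝕜 := ℂ) _ _
  have h5 : 2 * K * D ≤ energySq U + K ^ 2 * energySq F := by
    unfold energySq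
    nlinarith [sq_nonneg (‖H1.grad U.fst‖ - K * ‖H1.grad F.fst‖),
      sq_nonneg (‖U.snd‖ - K * ‖F.snd‖)]
  nlinarith

end

section

/-! ### Fourier series in time -/

section TimeFourier

variable {E F : Type*} [NormedAddCommGroup E] [NormedSpace ℂ E]
  [NormedAddCommGroup F] [NormedSpace ℂ F]

/-- The `k`-th Fourier coefficient (unnormalized) of `f` on `[0, T]`. -/
def timeFourier (T : ℝ) (k : ℤ) (f : ℝ → E) : E :=
  ∫ t in 0..T, Complex.exp (-(Complex.I * (2 * π * k / T : ℝ) * t)) • f t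

theorem hasDerivWithinAt_clm (L : E →L[ℂ] F) {f : ℝ → E} {f' : E} {s : Set ℝ} {t : ℝ}
    (h : HasDerivWithinAt f f' s t) : HasDerivWithinAt (fun t => L (f t)) (L f') s t :=
  (L.restrictScalars ℝ).hasFDerivAt.comp_hasDerivWithinAt t h

theorem clm_timeFourier [CompleteSpace E] [CompleteSpace F] (L : E →L[ℂ] F) (T : ℝ) (k : ℤ)
    {f : ℝ → E} (hf : Continuous f) : L (timeFourier T k f) = timeFourier T k fun t => L (f t) := by
  unfold timeFourier
  rw [← ContinuousLinearMap.intervalIntegral_comp_comm]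
  · simp only [map_smul]
  · exact Continuous.intervalIntegrable (by fun_prop) _ _

/-- Transforming the evolution equation, cut off by `sin (πt/T)`, into a stationary equation. -/
theorem IsSemigroupGeneratedBy.timeFourier_eq [CompleteSpace E] {S : ℝ≥0 → E →L[ℂ] E}
    {G : E → E → Prop} (hS : IsSemigroupGeneratedBy S G) {x y : E} (h : G x y) {T : ℝ}
    (hT : 0 < T) (k : ℤ) :
    timeFourier T k (fun t => (Real.sin (π * t / T) : ℂ) • S t.toNNReal y)
      = (Complex.I * (2 * π * k / T : ℝ)) •
          timeFourier T k (fun t => (Real.sin (π * t / T) : ℂ) • S t.toNNReal x)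
        - timeFourier T k (fun t => ((π / T * Real.cos (π * t / T) : ℝ) : ℂ) • S t.toNNReal x) := by
  set τ : ℝ := 2 * π * k / T with hτ
  have cx := hS.continuous_real x
  have cy := hS.continuous_real y
  have cexp : Continuous fun t : ℝ => Complex.exp (-(Complex.I * τ * t)) := by fun_prop
  have csin : Continuous fun t : ℝ => (Real.sin (π * t / T) : ℂ) := by fun_prop
  have ccos : Continuous fun t : ℝ => ((π / T * Real.cos (π * t / T) : ℝ) : ℂ) := by fun_prop
  have hder : ∀ t ∈ Ioo (min 0 T) (max 0 T), HasDerivWithinAt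
      (fun t : ℝ => Complex.exp (-(Complex.I * τ * t)) • (Real.sin (π * t / T) : ℂ)
        • S t.toNNReal x)
      (Complex.exp (-(Complex.I * τ * t)) • (Real.sin (π * t / T) : ℂ) • S t.toNNReal y
        + (Complex.exp (-(Complex.I * τ * t)) •
            ((π / T * Real.cos (π * t / T) : ℝ) : ℂ) • S t.toNNReal x
          - (Complex.I * τ) • Complex.exp (-(Complex.I * τ * t)) •
            (Real.sin (π * t / T) : ℂ) • S t.toNNReal x)) (Ioi t) t := by
    intro t ht
    rw [min_eq_left hT.le, max_eq_right hT.le] at ht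
    have h1 := (hS.hasDerivWithinAt h ht.1.le).Ioi_of_Ici
    have h2 : HasDerivAt (fun t : ℝ => (Real.sin (π * t / T) : ℂ))
        ((π / T * Real.cos (π * t / T) : ℝ) : ℂ) t := by
      have h3 : HasDerivAt (fun t : ℝ => π * t / T) (π / T) t := by
        simpa using ((hasDerivAt_id t).const_mul π).div_const T
      exact (h3.sin.congr_deriv (mul_comm _ _)).ofReal_comp
    have h4 : HasDerivAt (fun t : ℝ => Complex.exp (-(Complex.I * τ * t)))
        (-(Complex.I * τ) * Complex.exp (-(Complex.I * τ * t))) t := by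
      have h5 : HasDerivAt (fun x : ℝ => -(Complex.I * τ * (x : ℂ))) (-(Complex.I * τ)) t :=
        ((Complex.ofRealCLM.hasDerivAt (x := t)).const_mul (Complex.I * τ)).neg.congr_deriv
          (by simp)
      exact h5.cexp.congr_deriv (mul_comm _ _)
    refine (h4.hasDerivWithinAt.smul (h2.hasDerivWithinAt.smul h1)).congr_deriv ?_
    rw [smul_add, neg_mul, neg_smul, mul_smul, ← sub_eq_add_neg, add_sub_assoc]
    rfl
  have c1 : Continuous fun t : ℝ => Complex.exp (-(Complex.I * τ * t)) •
      (Real.sin (π * t / T) : ℂ) • S t.toNNReal x := cexp.smul (csin.smul cx)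
  have c2 : Continuous fun t : ℝ => Complex.exp (-(Complex.I * τ * t)) •
      (Real.sin (π * t / T) : ℂ) • S t.toNNReal y := cexp.smul (csin.smul cy)
  have c3 : Continuous fun t : ℝ => Complex.exp (-(Complex.I * τ * t)) •
      ((π / T * Real.cos (π * t / T) : ℝ) : ℂ) • S t.toNNReal x := cexp.smul (ccos.smul cx)
  have c4 : Continuous fun t : ℝ => (Complex.I * τ) • Complex.exp (-(Complex.I * τ * t)) •
      (Real.sin (π * t / T) : ℂ) • S t.toNNReal x := c1.const_smul _
  have c5 : Continuous fun t : ℝ => Complex.exp (-(Complex.I * τ * t)) •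
      ((π / T * Real.cos (π * t / T) : ℝ) : ℂ) • S t.toNNReal x
        - (Complex.I * τ) • Complex.exp (-(Complex.I * τ * t)) •
      (Real.sin (π * t / T) : ℂ) • S t.toNNReal x := c3.sub c4
  -- The sine vanishes at both ends of `[0, T]`, so there are no boundary terms.
  have hint := intervalIntegral.integral_eq_sub_of_hasDeriv_right c1.continuousOn hder
    (Continuous.intervalIntegrable (c2.add c5) _ _)
  rw [intervalIntegral.integral_add (c2.intervalIntegrable _ _) (c5.intervalIntegrable _ _),
    intervalIntegral.integral_sub (c3.intervalIntegrable _ _) (c4.intervalIntegrable _ _),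
    intervalIntegral.integral_smul, mul_div_assoc, div_self hT.ne'] at hint
  simp only [mul_one, Real.sin_pi, mul_zero, zero_div, Real.sin_zero, Complex.ofReal_zero,
    zero_smul, smul_zero, sub_self] at hint
  unfold timeFourier
  rw [← sub_eq_zero, ← hint]
  abel

/-- Bounded operators commute with the time integral, so a bounded linear relation valid along the
orbit passes to its Fourier coefficients. -/
theorem IsSemigroupGeneratedBy.timeFourier_graph [CompleteSpace E] [CompleteSpace F]
    {S : ℝ≥0 → E →L[ℂ] E} {G : E → E → Prop} (hS : IsSemigroupGeneratedBy S G) {x y : E}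
    (h : G x y) {T : ℝ} (hT : 0 < T) (k : ℤ) (A B : E →L[ℂ] F)
    (hAB : ∀ x y, G x y → A x + B y = 0) :
    A (timeFourier T k fun t => (Real.sin (π * t / T) : ℂ) • S t.toNNReal x)
      + B ((Complex.I * (2 * π * k / T : ℝ)) •
          timeFourier T k (fun t => (Real.sin (π * t / T) : ℂ) • S t.toNNReal x)
        - timeFourier T k (fun t => ((π / T * Real.cos (π * t / T) : ℝ) : ℂ) • S t.toNNReal x))
      = 0 := by
  have cx := hS.continuous_real x
  have cy := hS.continuous_real y
  have csin : Continuous fun t : ℝ => (Real.sin (π * t / T) : ℂ) := by fun_prop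
  have c1 : Continuous fun t : ℝ => (Real.sin (π * t / T) : ℂ) • S t.toNNReal x := csin.smul cx
  have c2 : Continuous fun t : ℝ => (Real.sin (π * t / T) : ℂ) • S t.toNNReal y := csin.smul cy
  rw [← hS.timeFourier_eq h hT k, clm_timeFourier A T k c1, clm_timeFourier B T k c2]
  unfold timeFourier
  have cexp : Continuous fun t : ℝ =>
      Complex.exp (-(Complex.I * (2 * π * k / T : ℝ) * t)) := by fun_prop
  have c3 : Continuous fun t : ℝ => Complex.exp (-(Complex.I * (2 * π * k / T : ℝ) * t)) •
      A ((Real.sin (π * t / T) : ℂ) • S t.toNNReal x) := cexp.smul (A.continuous.comp c1)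
  have c4 : Continuous fun t : ℝ => Complex.exp (-(Complex.I * (2 * π * k / T : ℝ) * t)) •
      B ((Real.sin (π * t / T) : ℂ) • S t.toNNReal y) := cexp.smul (B.continuous.comp c2)
  rw [← intervalIntegral.integral_add (c3.intervalIntegrable _ _) (c4.intervalIntegrable _ _)]
  refine (intervalIntegral.integral_congr fun t _ => ?_).trans intervalIntegral.integral_zero
  rw [← smul_add, map_smul, map_smul, ← smul_add, hAB _ _ (hS.orbit_generator h _), smul_zero,
    smul_zero]

theorem timeFourier_parseval_scalar {T : ℝ} (hT : 0 < T) {f : ℝ → ℂ} (hf : Continuous f) :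
    ∑' k : ℤ, ENNReal.ofReal (‖timeFourier T k f‖ ^ 2)
      = ENNReal.ofReal T * ∫⁻ t in Ioc 0 T, ENNReal.ofReal (‖f t‖ ^ 2) := by
  have hmem : MemLp f 2 (volume.restrict (Ioc 0 T)) := by
    obtain ⟨K, hK⟩ := (isCompact_Icc (a := 0) (b := T)).exists_bound_of_continuousOn hf.continuousOn
    exact MemLp.of_bound hf.aestronglyMeasurable K ((ae_restrict_iff' measurableSet_Ioc).2
      (Eventually.of_forall fun x hx => hK x (Ioc_subset_Icc_self hx)))
  have h1 := hasSum_sq_fourierCoeffOn hT hmem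
  have h2 : ∀ k : ℤ, ‖timeFourier T k f‖ ^ 2 = T ^ 2 * ‖fourierCoeffOn hT f k‖ ^ 2 := by
    intro k
    rw [fourierCoeffOn_eq_integral, norm_smul, sub_zero, mul_pow, Real.norm_of_nonneg (by positivity),
      ← mul_assoc, ← mul_pow, mul_one_div_cancel hT.ne', one_pow, one_mul, timeFourier]
    congr 3
    funext t
    rw [fourier_coe_apply]
    congr 2
    push_cast
    ring
  have h3 := h1.mul_left (T ^ 2)
  simp only [← h2] at h3
  rw [← ENNReal.ofReal_tsum_of_nonneg (fun _ => by positivity) h3.summable, h3.tsum_eq, sub_zero,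
    smul_eq_mul, ← ofReal_integral_eq_lintegral_ofReal, ← ENNReal.ofReal_mul hT.le,
    intervalIntegral.integral_of_le hT.le]
  · congr 1
    field_simp
  · exact ((hf.norm.pow 2).integrableOn_Icc).mono_set Ioc_subset_Icc_self
  · exact Eventually.of_forall fun t => by positivity

/-- Parseval's identity in time, in a space normed by countably many coordinates. -/
theorem timeFourier_parseval [CompleteSpace E] {ι : Type*} [Countable ι] (l : ι → E →L[ℂ] ℂ)
    {c : ℝ} (hc : 0 < c) (hl : ∀ x, HasSum (fun i => ‖l i x‖ ^ 2) (c * ‖x‖ ^ 2)) {T : ℝ}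
    (hT : 0 < T) {f : ℝ → E} (hf : Continuous f) :
    ∑' k : ℤ, ENNReal.ofReal (‖timeFourier T k f‖ ^ 2)
      = ENNReal.ofReal T * ∫⁻ t in Ioc 0 T, ENNReal.ofReal (‖f t‖ ^ 2) := by
  have hl' : ∀ x, ∑' i, ENNReal.ofReal (‖l i x‖ ^ 2)
      = ENNReal.ofReal c * ENNReal.ofReal (‖x‖ ^ 2) := fun x => by
    rw [← ENNReal.ofReal_tsum_of_nonneg (fun _ => by positivity) (hl x).summable, (hl x).tsum_eq,
      ENNReal.ofReal_mul hc.le]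
  have hc0 : ENNReal.ofReal c ≠ 0 := by simpa using hc
  refine (ENNReal.mul_right_inj hc0 ENNReal.ofReal_ne_top).1 ?_
  rw [← ENNReal.tsum_mul_left]
  simp only [← hl', clm_timeFourier _ _ _ hf]
  -- All terms lie in `[0, ∞]`, so sums over frequencies and coordinates can be exchanged without
  -- any summability.
  rw [ENNReal.tsum_comm]
  have h1 : ∀ i, ∑' k : ℤ, ENNReal.ofReal (‖timeFourier T k fun t => l i (f t)‖ ^ 2)
      = ENNReal.ofReal T * ∫⁻ t in Ioc 0 T, ENNReal.ofReal (‖l i (f t)‖ ^ 2) := fun i =>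
    timeFourier_parseval_scalar hT ((l i).continuous.comp hf)
  simp only [h1]
  rw [ENNReal.tsum_mul_left, ← lintegral_tsum]
  · simp only [hl']
    rw [lintegral_const_mul' _ _ ENNReal.ofReal_ne_top]
    ring
  · intro i
    have : Continuous fun t => ENNReal.ofReal (‖l i (f t)‖ ^ 2) :=
      ENNReal.continuous_ofReal.comp (((l i).continuous.comp hf).norm.pow 2)
    exact this.aemeasurable

end TimeFourier

/-- Fourier coordinates on `L²(𝕊¹)`. -/
theorem hasSum_fourier_coordinates (u : L2) :
    HasSum (fun n : ℤ => ‖innerSL ℂ (H1.toL2 (isTest_fourier n).toH1) u‖ ^ 2)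
      (2 * π * ‖u‖ ^ 2) := by
  have hd : MemLp u 2 (AddCircle.haarAddCircle : Measure S1) :=
    memLp_haarAddCircle_iff.2 (Lp.memLp u)
  have h1 := hasSum_sq_fourierCoeff (hd.toLp u)
  have h2 : ∫ z, ‖hd.toLp u z‖ ^ 2 ∂(AddCircle.haarAddCircle : Measure S1)
      = (2 * π)⁻¹ * ‖u‖ ^ 2 := by
    rw [← integral_norm_sq]
    refine Eq.trans (integral_congr_ae ?_)
      (AddCircle.integral_haarAddCircle (T := 2 * π) (f := fun z : S1 => ‖u z‖ ^ 2))
    filter_upwards [hd.coeFn_toLp] with z hz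
    rw [hz]
  rw [h2, fourierCoeff_congr_ae hd.coeFn_toLp] at h1
  have h3 := h1.mul_left ((2 * π) ^ 2)
  have hpos := Real.two_pi_pos
  rw [show (2 * π) ^ 2 * ((2 * π)⁻¹ * ‖u‖ ^ 2) = 2 * π * ‖u‖ ^ 2 by field_simp] at h3
  suffices hn : (fun n : ℤ => ‖innerSL ℂ (H1.toL2 (isTest_fourier n).toH1) u‖ ^ 2)
      = fun n => (2 * π) ^ 2 * ‖fourierCoeff (u : S1 → ℂ) n‖ ^ 2 by
    rw [hn]
    exact h3
  funext n
  have h4 : innerSL ℂ (H1.toL2 (isTest_fourier n).toH1) u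
      = ∫ z : S1, fourier (-n) z • u z := by
    rw [innerSL_apply_apply, inner_L2_def]
    refine integral_congr_ae ?_
    filter_upwards [(isTest_fourier n).coeFn_toH1] with z hz
    rw [hz, fourier_neg, smul_eq_mul, mul_comm]
  have h5 : fourierCoeff (u : S1 → ℂ) n = (2 * π)⁻¹ • ∫ z : S1, fourier (-n) z • u z :=
    AddCircle.integral_haarAddCircle (T := 2 * π) (f := fun z : S1 => fourier (-n) z • u z)
  rw [h4, h5, norm_smul, Real.norm_of_nonneg (by positivity)]
  field_simp

end

/-! ### Decay of the energy along the semigroup. -/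

section

variable {W : S1 → ℝ}

/-- The gradient of the position, as a bounded operator on states. -/
def gradState : State →L[ℂ] L2 := gradL.comp (WithLp.fstL 2 ℂ H1 L2)

/-- The velocity, as a bounded operator on states. -/
def velState : State →L[ℂ] L2 := WithLp.sndL 2 ℂ H1 L2

theorem energySq_eq (U : State) : energySq U = ‖gradState U‖ ^ 2 + ‖velState U‖ ^ 2 := rfl

theorem continuous_energySq : Continuous energySq :=
  (gradState.continuous.norm.pow 2).add (velState.continuous.norm.pow 2)

theorem energySq_smul (c : ℂ) (U : State) : energySq (c • U) = ‖c‖ ^ 2 * energySq U := by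
  simp only [energySq_eq, map_smul, norm_smul]
  ring

/-- The truncated orbit and its Fourier coefficients solve the stationary equation. -/
theorem isDampedWaveOp_timeFourier (hW : Integrable W) {S : ℝ≥0 → State →L[ℂ] State}
    (hS : IsSemigroupGeneratedBy S (IsDampedWaveOp W)) {x y : State} (h : IsDampedWaveOp W x y)
    {T : ℝ} (hT : 0 < T) (k : ℤ) :
    IsDampedWaveOp W (timeFourier T k fun t => (Real.sin (π * t / T) : ℂ) • S t.toNNReal x)
      ((Complex.I * (2 * π * k / T : ℝ)) •
          timeFourier T k (fun t => (Real.sin (π * t / T) : ℂ) • S t.toNNReal x)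
        - timeFourier T k (fun t => ((π / T * Real.cos (π * t / T) : ℝ) : ℂ) • S t.toNNReal x)) := by
  refine (isDampedWaveOp_iff hW _ _).2 ⟨?_, fun w => ?_⟩
  · have h1 := hS.timeFourier_graph h hT k velState (-(toL2L.comp (WithLp.fstL 2 ℂ H1 L2)))
      fun x y hxy => by
        rw [show velState x = H1.toL2 y.fst from hxy.1]
        exact add_neg_cancel _
    exact add_neg_eq_zero.1 h1
  · have h1 := hS.timeFourier_graph h hT k ((innerSL ℂ (H1.grad w)).comp gradState)
      ((innerSL ℂ (H1.toL2 w)).comp velState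
        + (dampingForm hW w).comp (WithLp.fstL 2 ℂ H1 L2)) fun x y hxy => by
        have h2 := ((isDampedWaveOp_iff hW _ _).1 hxy).2 w
        refine Eq.trans ?_ h2
        change inner ℂ (H1.grad w) (H1.grad x.fst) + (inner ℂ (H1.toL2 w) y.snd
          + dampingForm hW w y.fst) = _
        ring
    refine Eq.trans ?_ h1
    change _ = inner ℂ (H1.grad w) (H1.grad (WithLp.fst _)) + (inner ℂ (H1.toL2 w) (WithLp.snd _)
          + dampingForm hW w (WithLp.fst _))
    ring

/-- Parseval is applied separately to `∂ₓu` and to the velocity, since the energy is only a seminorm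
on states. -/
theorem tsum_energySq_timeFourier {T : ℝ} (hT : 0 < T) {f : ℝ → State} (hf : Continuous f) :
    ∑' k : ℤ, ENNReal.ofReal (energySq (timeFourier T k f))
      = ENNReal.ofReal T * ∫⁻ t in Ioc 0 T, ENNReal.ofReal (energySq (f t)) := by
  have hadd : ∀ U : State, ENNReal.ofReal (energySq U)
      = ENNReal.ofReal (‖gradState U‖ ^ 2) + ENNReal.ofReal (‖velState U‖ ^ 2) := fun U => by
    rw [energySq_eq, ENNReal.ofReal_add (by positivity) (by positivity)]
  have key : ∀ A : State →L[ℂ] L2, ∑' k : ℤ, ENNReal.ofReal (‖A (timeFourier T k f)‖ ^ 2)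
      = ENNReal.ofReal T * ∫⁻ t in Ioc 0 T, ENNReal.ofReal (‖A (f t)‖ ^ 2) := fun A => by
    simp only [clm_timeFourier A T _ hf]
    exact timeFourier_parseval _ Real.two_pi_pos hasSum_fourier_coordinates hT
      (A.continuous.comp hf)
  have hm : Measurable fun t => ENNReal.ofReal (‖gradState (f t)‖ ^ 2) :=
    (ENNReal.continuous_ofReal.comp ((gradState.continuous.comp hf).norm.pow 2)).measurable
  simp only [hadd]
  rw [ENNReal.tsum_add, key, key, lintegral_add_left hm, mul_add]

/-- The resolvent bound, transported to the time variable. -/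
theorem integral_sin_sq_energySq_le {K : ℝ} (hK : 0 < K)
    (hres : ∀ (τ : ℝ) (U F : State), IsDampedWaveOp W U ((Complex.I * τ : ℂ) • U - F) →
      energySq U ≤ K * energySq F) (hW : Integrable W) {S : ℝ≥0 → State →L[ℂ] State}
    (hS : IsSemigroupGeneratedBy S (IsDampedWaveOp W)) {x y : State} (h : IsDampedWaveOp W x y)
    {T : ℝ} (hT : 0 < T) :
    ∫ t in 0..T, Real.sin (π * t / T) ^ 2 * energySq (S t.toNNReal x)
      ≤ K * ∫ t in 0..T, (π / T * Real.cos (π * t / T)) ^ 2 * energySq (S t.toNNReal x) := by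
  have cx := hS.continuous_real x
  have csin : Continuous fun t : ℝ => (Real.sin (π * t / T) : ℂ) := by fun_prop
  have ccos : Continuous fun t : ℝ => ((π / T * Real.cos (π * t / T) : ℝ) : ℂ) := by fun_prop
  have c1 : Continuous fun t : ℝ => (Real.sin (π * t / T) : ℂ) • S t.toNNReal x := csin.smul cx
  have c2 : Continuous fun t : ℝ =>
      ((π / T * Real.cos (π * t / T) : ℝ) : ℂ) • S t.toNNReal x := ccos.smul cx
  have ce : Continuous fun t : ℝ => energySq (S t.toNNReal x) := continuous_energySq.comp cx
  have d1 : Continuous fun t : ℝ => Real.sin (π * t / T) ^ 2 * energySq (S t.toNNReal x) := by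
    fun_prop
  have d2 : Continuous fun t : ℝ =>
      (π / T * Real.cos (π * t / T)) ^ 2 * energySq (S t.toNNReal x) := by fun_prop
  have h1 : ∑' k : ℤ, ENNReal.ofReal (energySq (timeFourier T k fun t =>
        (Real.sin (π * t / T) : ℂ) • S t.toNNReal x))
      ≤ ENNReal.ofReal K * ∑' k : ℤ, ENNReal.ofReal (energySq (timeFourier T k fun t =>
        ((π / T * Real.cos (π * t / T) : ℝ) : ℂ) • S t.toNNReal x)) := by
    rw [← ENNReal.tsum_mul_left]
    refine ENNReal.tsum_le_tsum fun k => ?_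
    rw [← ENNReal.ofReal_mul hK.le]
    exact ENNReal.ofReal_le_ofReal (hres _ _ _ (isDampedWaveOp_timeFourier hW hS h hT k))
  rw [tsum_energySq_timeFourier hT c1, tsum_energySq_timeFourier hT c2, mul_left_comm,
    ENNReal.mul_le_mul_iff_right (by simpa using hT) ENNReal.ofReal_ne_top] at h1
  simp only [energySq_smul, Complex.norm_real, Real.norm_eq_abs, sq_abs] at h1
  rw [← ofReal_integral_eq_lintegral_ofReal (d1.integrableOn_Icc.mono_set Ioc_subset_Icc_self)
      (Eventually.of_forall fun t => mul_nonneg (sq_nonneg _) (energySq_nonneg _)),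
    ← ofReal_integral_eq_lintegral_ofReal (d2.integrableOn_Icc.mono_set Ioc_subset_Icc_self)
      (Eventually.of_forall fun t => mul_nonneg (sq_nonneg _) (energySq_nonneg _)),
    ← ENNReal.ofReal_mul hK.le, ENNReal.ofReal_le_ofReal_iff] at h1
  · rwa [intervalIntegral.integral_of_le hT.le, intervalIntegral.integral_of_le hT.le]
  · exact mul_nonneg hK.le (integral_nonneg fun t => mul_nonneg (sq_nonneg _) (energySq_nonneg _))

/-- The energy is nonincreasing along orbits in the domain. -/
theorem energySq_orbit_le (hW : Integrable W) (h0 : ∀ᵐ z : S1, 0 ≤ W z)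
    {S : ℝ≥0 → State →L[ℂ] State} (hS : IsSemigroupGeneratedBy S (IsDampedWaveOp W)) {x y : State}
    (h : IsDampedWaveOp W x y) (t : ℝ≥0) : energySq (S t x) ≤ energySq x := by
  have h1 := le_add_mul_of_deriv_right_le (f := fun t : ℝ => energySq (S t.toNNReal x)) (C := 0)
    (b := t) (x := t) (continuous_energySq.comp (hS.continuous_real x)).continuousOn
    (fun s hs => (hasDerivWithinAt_norm_sq
      (hasDerivWithinAt_clm gradState (hS.hasDerivWithinAt h hs.1))).add
      (hasDerivWithinAt_norm_sq (hasDerivWithinAt_clm velState (hS.hasDerivWithinAt h hs.1))))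
    (fun s _ => by
      have h2 := (hS.orbit_generator h s.toNNReal).re_inner hW
      have h3 := dissipation_nonneg h0 (S s.toNNReal x).snd
      change 2 * (inner ℂ (H1.grad (S s.toNNReal x).fst) (H1.grad (S s.toNNReal y).fst)).re
        + 2 * (inner ℂ (S s.toNNReal x).snd (S s.toNNReal y).snd).re ≤ 0
      linarith) ⟨t.2, le_rfl⟩
  simpa [hS.map_zero] using h1

theorem integral_sin_sq_mul_div {T : ℝ} (hT : 0 < T) :
    ∫ t in 0..T, Real.sin (π * t / T) ^ 2 = T / 2 := by
  have h := intervalIntegral.integral_comp_mul_left (a := 0) (b := T)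
    (fun s => Real.sin s ^ 2) (c := π / T) (by positivity)
  have e : (fun t => Real.sin (π * t / T) ^ 2) = fun t => Real.sin (π / T * t) ^ 2 := by
    funext t
    rw [div_mul_eq_mul_div]
  rw [e, h, div_mul_cancel₀ _ hT.ne', mul_zero, integral_sin_sq]
  simp
  field_simp

theorem integral_cos_sq_mul_div {T : ℝ} (hT : 0 < T) :
    ∫ t in 0..T, Real.cos (π * t / T) ^ 2 = T / 2 := by
  have h := intervalIntegral.integral_comp_mul_left (a := 0) (b := T)
    (fun s => Real.cos s ^ 2) (c := π / T) (by positivity)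
  have e : (fun t => Real.cos (π * t / T) ^ 2) = fun t => Real.cos (π / T * t) ^ 2 := by
    funext t
    rw [div_mul_eq_mul_div]
  rw [e, h, div_mul_cancel₀ _ hT.ne', mul_zero, integral_cos_sq]
  simp
  field_simp

/-- The energy decays by a fixed factor over a fixed time. -/
theorem exists_energySq_le_half (hW : Integrable W) (h0 : ∀ᵐ z : S1, 0 ≤ W z)
    (hpos : 0 < ∫ z, W z) :
    ∃ T : ℝ≥0, 0 < T ∧ ∀ S : ℝ≥0 → State →L[ℂ] State,
      IsSemigroupGeneratedBy S (IsDampedWaveOp W) → ∀ x y, IsDampedWaveOp W x y →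
        energySq (S T x) ≤ energySq x / 2 := by
  obtain ⟨K, hK, hres⟩ := exists_resolvent_bound hW h0 hpos
  -- `T = π √(2K)` is chosen so that `K (π / T)² = 1 / 2`.
  have hTpos : 0 < π * √(2 * K) := by positivity
  refine ⟨⟨π * √(2 * K), hTpos.le⟩, hTpos, fun S hS x y h => ?_⟩
  set T := π * √(2 * K) with hT
  have h1 := integral_sin_sq_energySq_le hK hres hW hS h hTpos
  have ce : Continuous fun t : ℝ => energySq (S t.toNNReal x) :=
    continuous_energySq.comp (hS.continuous_real x)
  -- The energy at any time `t ≤ T` is at least the final energy, and `sin²` integrates to `T / 2`.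
  have h2 : T / 2 * energySq (S T.toNNReal x)
      ≤ ∫ t in 0..T, Real.sin (π * t / T) ^ 2 * energySq (S t.toNNReal x) := by
    rw [← integral_sin_sq_mul_div hTpos, ← intervalIntegral.integral_mul_const]
    refine intervalIntegral.integral_mono_on hTpos.le
      (Continuous.intervalIntegrable (by fun_prop) _ _)
      (Continuous.intervalIntegrable (by fun_prop) _ _) fun t ht => ?_
    refine mul_le_mul_of_nonneg_left ?_ (sq_nonneg _)
    have h3 := energySq_orbit_le hW h0 hS (hS.orbit_generator h t.toNNReal) (T - t).toNNReal
    have h4 : T.toNNReal = (T - t).toNNReal + t.toNNReal := by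
      rw [← Real.toNNReal_add (sub_nonneg.2 ht.2) ht.1, sub_add_cancel]
    rw [h4, hS.map_add]
    exact h3
  have h3 : ∫ t in 0..T, (π / T * Real.cos (π * t / T)) ^ 2 * energySq (S t.toNNReal x)
      ≤ (π / T) ^ 2 * (T / 2) * energySq x := by
    rw [← integral_cos_sq_mul_div hTpos, ← intervalIntegral.integral_const_mul,
      ← intervalIntegral.integral_mul_const]
    refine intervalIntegral.integral_mono_on hTpos.le
      (Continuous.intervalIntegrable (by fun_prop) _ _)
      (Continuous.intervalIntegrable (by fun_prop) _ _) fun t ht => ?_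
    rw [mul_pow]
    exact mul_le_mul_of_nonneg_left (energySq_orbit_le hW h0 hS h _) (by positivity)
  have h4 : K * (π / T) ^ 2 = 1 / 2 := by
    rw [hT, div_pow, mul_pow, Real.sq_sqrt (by positivity)]
    field_simp
  have h5 : T / 2 * energySq (S T.toNNReal x) ≤ T / 2 * (energySq x / 2) := by
    refine (h2.trans h1).trans ((mul_le_mul_of_nonneg_left h3 hK.le).trans_eq ?_)
    linear_combination T / 2 * energySq x * h4
  have h6 := le_of_mul_le_mul_left h5 (by positivity)
  rwa [Real.toNNReal_of_nonneg hTpos.le] at h6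

theorem dense_domain (hW : Integrable W) (h0 : ∀ᵐ z : S1, 0 ≤ W z) :
    Dense {x : State | ∃ y, IsDampedWaveOp W x y} := by
  refine (maxDissipative_waveGraph hW h0).dense.mono ?_
  rintro x ⟨y, hy⟩
  exact ⟨_, hy⟩

/-- Exponential decay of the energy. -/
theorem exists_energy_le_exp (hW : Integrable W) (h0 : ∀ᵐ z : S1, 0 ≤ W z)
    (hpos : 0 < ∫ z, W z) :
    ∃ C c : ℝ, 0 < C ∧ 0 < c ∧ ∀ S : ℝ≥0 → State →L[ℂ] State,
      IsSemigroupGeneratedBy S (IsDampedWaveOp W) → ∀ (x : State) (t : ℝ≥0),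
        energy (S t x) ≤ C * Real.exp (-c * (t : ℝ)) * energy x := by
  obtain ⟨T, hT, hhalf⟩ := exists_energySq_le_half hW h0 hpos
  have hT' : (0 : ℝ) < T := hT
  have hlog : 0 < Real.log 2 := Real.log_pos one_lt_two
  -- Halving over each period `T` gives the rate `log 2 / T`. The incomplete last period costs at
  -- most the factor `2`.
  refine ⟨2, Real.log 2 / T, two_pos, by positivity, fun S hS x t => ?_⟩
  -- Both sides are continuous in the state, so the estimates extend from the dense domain to all
  -- initial data.
  have hmono : ∀ (t : ℝ≥0) (x : State), energySq (S t x) ≤ energySq x := fun t x =>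
    (dense_domain hW h0).induction
      (fun x ⟨_, h⟩ => energySq_orbit_le hW h0 hS h t)
      (isClosed_le (continuous_energySq.comp (S t).continuous) continuous_energySq) x
  have hhalf' : ∀ x : State, energySq (S T x) ≤ energySq x / 2 := fun x =>
    (dense_domain hW h0).induction
      (fun x ⟨_, h⟩ => hhalf S hS x _ h)
      (isClosed_le (continuous_energySq.comp (S T).continuous)
        (continuous_energySq.div_const 2)) x
  have hiter : ∀ (n : ℕ) (x : State), energySq (S (n * T) x) ≤ energySq x / 2 ^ n := by
    intro n
    induction n with
    | zero => intro x; simp [hS.map_zero]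
    | succ n ih =>
      intro x
      rw [Nat.cast_succ, add_mul, one_mul, hS.map_add]
      refine (ih (S T x)).trans ?_
      rw [pow_succ', ← div_div]
      gcongr
      exact hhalf' x
  set n := ⌊(t : ℝ) / T⌋₊ with hn
  have hn1 : (n : ℝ) * T ≤ t := by
    rw [← le_div_iff₀ hT']
    exact Nat.floor_le (by positivity)
  have hn2 : (t : ℝ) / T < n + 1 := Nat.lt_floor_add_one _
  have hle : (n : ℝ≥0) * T ≤ t := by exact_mod_cast hn1
  have h1 : energySq (S t x) ≤ energySq x / 2 ^ n := by
    have e : t = (t - n * T) + n * T := (tsub_add_cancel_of_le hle).symm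
    rw [e, hS.map_add]
    exact (hmono _ _).trans (hiter n x)
  have h2 : (1 : ℝ) / 2 ^ n ≤ 2 * Real.exp (-(Real.log 2 / T) * t) := by
    have h3 : -(Real.log 2 * n) ≤ Real.log 2 + -(Real.log 2 / T) * t := by
      have : Real.log 2 * (t / T) ≤ Real.log 2 * (n + 1) := by gcongr
      have e : Real.log 2 / T * t = Real.log 2 * (t / T) := by ring
      linarith
    have h4 := Real.exp_le_exp.2 h3
    rw [Real.exp_add, Real.exp_log two_pos, Real.exp_neg, mul_comm (Real.log 2), Real.exp_nat_mul,
      Real.exp_log two_pos] at h4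
    rwa [one_div]
  rw [energy_eq, energy_eq]
  have h5 := mul_le_mul_of_nonneg_right h2 (energySq_nonneg x)
  have e : 1 / 2 ^ n * energySq x = energySq x / 2 ^ n := by ring
  linarith

end

end DampedWave

end

/-! ### Reduction of the theorem to integrable damping. -/

open DampedWave in
theorem theorem5 {n : ℕ} (Wj : Fin n → S1 → ℝ)
    (hWj : ∀ j, MemLp (Wj j) ⊤ (volume : Measure S1) ∨
      ∃ β : ℝ, ∃ θ : S1, -1 < β ∧ β < 0 ∧ IsPolyControlled β θ (Wj j))
    (W : S1 → ℝ) (hW : W = fun z => ∑ j, Wj j z)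
    (hW_nonneg : ∀ᵐ z : S1, 0 ≤ W z)
    (hW_ne : ¬ ∀ᵐ z : S1, W z = 0) :
    (∃! S : ℝ≥0 → State →L[ℂ] State, IsSemigroupGeneratedBy S (IsDampedWaveOp W)) ∧
      ∃ C c : ℝ, 0 < C ∧ 0 < c ∧
        ∀ S : ℝ≥0 → State →L[ℂ] State, IsSemigroupGeneratedBy S (IsDampedWaveOp W) →
          ∀ (u₀ : H1) (u₁ : L2) (t : ℝ≥0),
            energy (S t (WithLp.toLp 2 (u₀, u₁)))
              ≤ C * Real.exp (-c * (t : ℝ)) * energy (WithLp.toLp 2 (u₀, u₁)) := by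
  have hWi : Integrable W := by
    rw [hW]
    refine integrable_finsetSum _ fun j _ => ?_
    rcases hWj j with h | ⟨β, θ, hβ, -, h⟩
    · exact h.integrable le_top
    · exact integrable_of_isPolyControlled hβ h
  -- A nonnegative integrable function with zero integral vanishes almost everywhere, so
  -- nontriviality of `W` becomes positivity of its integral.
  have hpos : 0 < ∫ z, W z := by
    refine (integral_nonneg_of_ae hW_nonneg).lt_of_ne fun h => hW_ne ?_
    exact (integral_eq_zero_iff_of_nonneg_ae hW_nonneg hWi).1 h.symm
  refine ⟨existsUnique_semigroup hWi hW_nonneg, ?_⟩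
  obtain ⟨C, c, hC, hc, h⟩ := exists_energy_le_exp hWi hW_nonneg hpos
  exact ⟨C, c, hC, hc, fun S hS u₀ u₁ t => h S hS _ t⟩
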